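/- **Setting.** Let $\{P_\theta:\theta\in\Theta\}$, $\Theta\subset\mathbb R$ open, be probabilities on a measurable space, differentiable in quadratic mean at $\theta_0\in\Theta$ with scores $\Lambda$: writing $P=P_{\theta_0}$, $\Lambda\in L_2(P)$, $E\Lambda=0$ and $\|\sqrt{dP_{\theta_0+t}}-(1+\tfrac12 t\Lambda)\sqrt{dP}\|=o(t)$ as $t\to0$. Expectations, norms $\|\cdot\|$ and inner products $\langle\cdot|\cdot\rangle$ of functions are those of $P$ and $L_2(P)$. A tangent is a $g\in L_2(P)$ with $Eg=0$; for each tangent $g$ let $(P_{n,g})_n$ be probabilities with $\|\sqrt{dP_{n,g}}-(1+\tfrac12 s_n g)\sqrt{dP}\|=o(s_n)$, where $s_n=1/\sqrt n$. Observations $x_1,\dots,x_n$ are i.i.d.; $Q^n$ is the $n$-fold product of $Q$; tests $\delta_n$ take values in $[0,1]$. Let $\alpha\in(0,1)$, $\Phi$ the standard normal distribution function, $\Phi(-u_\alpha)=\alpha$. For sets $G_0,G_1$ of tangents, the maxmin asymptotic testing problem is to maximize $\inf_{g_1\in G_1}\liminf_n\int\delta_n\,dP_{n,g_1}^n$ subject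 to $\limsup_n\int\delta_n\,dP_{n,g_0}^n\le\alpha$ for all $g_0\in G_0$. A saddle point is a pair $(g,\delta)$, $g=(g_0,g_1)\in G_0\times G_1$, such that $\delta$ satisfies this level constraint on all of $G_0$, $\delta$ maximizes $\liminf_n\int\delta_n\,dP_{n,g_1}^n$ among all tests with $\limsup_n\int\delta_n\,dP^n_{n,g_0}\le\alpha$, and the asymptotic power $\liminf_n\int\delta_n\,dP_{n,g_1'}^n$ over $g_1'\in G_1$ is smallest at $g_1'=g_1$. The pair $g$ is then called least favorable. For a pair $g$ put $g_{10}=g_1-g_0$ and $$\delta_{n,g}=\mathbf 1\Bigl(s_n\sum_{i=1}^n g_{10}(x_i)>\|g_{10}\|u_\alpha+\langle g_{10}|g_0\rangle\Bigr).$$ Let $d_v(Q,Q')=\frac12\|dQ-dQ'\|_1$ and let $U_v(Q;\rho)$ be the set of all probabilities within $d_v$-distance $\rho$ of $Q$. Let $G_v$ be the set of tangents $g$ with $E|g|\le2$, let $\tau\in\mathbb R$, $r_0,r_1\ge0$, $r=r_0+r_1>0$, and $G_{v,0}=r_0G_v$, $G_{v,1}=\tau\Lambda+r_1G_v$. **Theorem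 (total variation balls).** Let $2r<\tau E|\Lambda|$. a) There are unique $v',v''$ with $\tau E(v'-\Lambda)_+=r=\tau E(\Lambda-v'')_+$, and $v'<0<v''$. Define $\tilde g_v$ by $r\tilde g_v=\tau(\Lambda-v'')_+-\tau(v'-\Lambda)_+$. Then $\tilde g_v\in G_v$, and $q_v=(q_{v,0},q_{v,1})$ with $q_{v,0}=r_0\tilde g_v$, $q_{v,1}=\tau\Lambda-r_1\tilde g_v$, is a least favorable pair in $G_{v,0}\times G_{v,1}$; $(q_v,\delta_{q_v})$ is a saddle point. For $g_0,g_1\in G_v$, the pair $(r_0g_0,\ \tau\Lambda-r_1g_1)$ is least favorable if and only if, $P$-a.e., $$r_0g_0^++r_1g_1^+=\tau(\Lambda-v'')_+,\qquad r_0g_0^-+r_1g_1^-=\tau(v'-\Lambda)_+ .$$ With $\Lambda^{(v)}=v'\vee\Lambda\wedge v''$, $$\delta_{n,q_v}=\mathbf 1\Bigl(s_n\sum_{i=1}^n\Lambda^{(v)}(x_i)>\|\Lambda^{(v)}\|u_\alpha+r_0(v''-v')\Bigr).$$ The test $\delta_{q_v}$ solves the maxmin problem for $G_{v,0}$ vs.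 $G_{v,1}$; every solution $\delta$ satisfies $\delta_n-\delta_{n,q_v}\to0$ in $P^n$-probability; and the maxmin asymptotic power is $\Phi(-u_\alpha+\tau\|\Lambda^{(v)}\|)$. b) Put $U_{0,n}=U_v(P_{\theta_0};r_0/\sqrt n)$ and $U_{1,n}=U_v(P_{\theta_0+\tau/\sqrt n};r_1/\sqrt n)$. A least favorable probability pair for $U_{0,n}$ vs. $U_{1,n}$ is $(Q_0,Q_1)\in U_{0,n}\times U_{1,n}$ with $dQ_1=\pi\,dQ_0$ for some measurable $\pi\geq 0$ such that $Q_0(\pi>t)\ge Q'(\pi>t)$ and $Q_1(\pi>t)\le Q''(\pi>t)$ for all $Q'\in U_{0,n}$, $Q''\in U_{1,n}$, $t>0$. A robust asymptotic test based on such pairs is a sequence of tests $\delta_n$ which, for all large $n$, are likelihood ratio tests rejecting for $\prod_i\pi_n(x_i)>c_n$, accepting for $\prod_i\pi_n(x_i)<c_n$, and randomizing with a constant probability on equality, for some least favorable probability pair with likelihood ratio $\pi_n$, and whose maximum size $\sup_{Q\in U_{0,n}}\int\delta_n\,dQ^n$ tends to $\alpha$. Such tests exist, and each of them coincides asymptotically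 with $\delta_{q_v}$: $\delta_n-\delta_{n,q_v}\to0$ in $P^n$-probability. Moreover $\delta_{q_v}$ maximizes $\liminf_n\inf_{Q\in U_{1,n}}\int\delta_n\,dQ^n$ among all tests subject to $\limsup_n\sup_{Q\in U_{0,n}}\int\delta_n\,dQ^n\le\alpha$. -/

import Mathlib

open MeasureTheory ProbabilityTheory Filter Topology Asymptotics
open scoped NNReal ENNReal

noncomputable section

namespace RobustTest

variable {Ω : Type*} [MeasurableSpace Ω]

/-- Standard normal distribution function. -/
def Phi (x : ℝ) : ℝ := cdf (gaussianReal 0 1) x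

/-- Inner product of `L₂(P)`. -/
def inn (P : Measure Ω) (f g : Ω → ℝ) : ℝ := ∫ x, f x * g x ∂P

/-- Norm of `L₂(P)`. -/
def nrm (P : Measure Ω) (f : Ω → ℝ) : ℝ := Real.sqrt (∫ x, f x ^ 2 ∂P)

/-- The density of `P` with respect to the dominating measure `P + Q`. -/
def dens (P Q : Measure Ω) (x : Ω) : ℝ := (P.rnDeriv (P + Q) x).toReal

/-- Total variation distance: `2 d_v(Q, P) = ‖dQ - dP‖₁`. -/
def tvDistance (Q P : Measure Ω) : ℝ :=
  (∫ x, |dens Q P x - dens P Q x| ∂(P + Q)) / 2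

/-- The total variation ball: all probabilities `Q` with `d_v(Q, P) ≤ r`. -/
def tvBall (P : Measure Ω) (r : ℝ) : Set (Measure Ω) :=
  {Q | IsProbabilityMeasure Q ∧ tvDistance Q P ≤ r}

/-- `‖√dQ - (1 + h / 2) √dP‖²`, the squared `L₂` remainder in the approximation
`dQ ≈ (1 + h) dP` (differentiability in quadratic mean). -/
def qmdRemainder (P Q : Measure Ω) (h : Ω → ℝ) : ℝ :=
  ∫ x, (Real.sqrt (dens Q P x) - (1 + h x / 2) * Real.sqrt (dens P Q x)) ^ 2 ∂(P + Q)

/-- Tangents at `P`: square integrable functions with mean zero. -/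
def IsTangent (P : Measure Ω) (g : Ω → ℝ) : Prop :=
  Measurable g ∧ MemLp g 2 P ∧ ∫ x, g x ∂P = 0

/-- The model `(P_θ)` is differentiable in quadratic mean at `θ₀` with scores `Λ`:
`dP_{θ₀+t} ≈ (1 + t Λ) dP_{θ₀}` as `t → 0`. -/
def HasScoresAt (P : ℝ → Measure Ω) (θ₀ : ℝ) (Λ : Ω → ℝ) : Prop :=
  IsTangent (P θ₀) Λ ∧
    (fun t : ℝ => qmdRemainder (P θ₀) (P (θ₀ + t)) (fun x => t * Λ x)) =o[𝓝 0]
      (fun t : ℝ => t ^ 2)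

/-- `A g n` is a choice of local alternatives `P_{n,g}` for every tangent `g`:
(for large `n`) probabilities with `dP_{n,g} ≈ (1 + g / √n) dP` as `n → ∞`. -/
def IsLocalAlternatives (P : Measure Ω) (A : (Ω → ℝ) → ℕ → Measure Ω) : Prop :=
  ∀ g, IsTangent P g →
    (∀ᶠ n in atTop, IsProbabilityMeasure (A g n)) ∧
    (fun n : ℕ => qmdRemainder P (A g n) (fun x => g x / Real.sqrt n)) =o[atTop]
      (fun n : ℕ => 1 / (n : ℝ))

/-- The `n`-fold product of `Q`: law of `n` i.i.d. observations. -/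
def iid (Q : Measure Ω) (n : ℕ) : Measure (Fin n → Ω) := Measure.pi fun _ => Q

/-- A sequence of (randomized) tests, `δ n` being based on `n` observations. -/
def IsTestSeq (δ : (n : ℕ) → (Fin n → Ω) → ℝ) : Prop :=
  ∀ n, Measurable (δ n) ∧ ∀ x, 0 ≤ δ n x ∧ δ n x ≤ 1

/-- `limsup ∫ δ_n dP_{n,g}^n`. -/
def asySize (A : (Ω → ℝ) → ℕ → Measure Ω) (δ : (n : ℕ) → (Fin n → Ω) → ℝ) (g : Ω → ℝ) : ℝ :=
  limsup (fun n => ∫ x, δ n x ∂(iid (A g n) n)) atTop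

/-- `liminf ∫ δ_n dP_{n,g}^n`. -/
def asyPower (A : (Ω → ℝ) → ℕ → Measure Ω) (δ : (n : ℕ) → (Fin n → Ω) → ℝ) (g : Ω → ℝ) : ℝ :=
  liminf (fun n => ∫ x, δ n x ∂(iid (A g n) n)) atTop

/-- Asymptotic level `α` for the hypothesis given by the tangent set `G₀`. -/
def HasAsyLevel (A : (Ω → ℝ) → ℕ → Measure Ω) (α : ℝ) (G₀ : Set (Ω → ℝ))
    (δ : (n : ℕ) → (Fin n → Ω) → ℝ) : Prop :=
  ∀ g₀ ∈ G₀, asySize A δ g₀ ≤ α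

/-- Minimum over `G₁` of the asymptotic power. -/
def minAsyPower (A : (Ω → ℝ) → ℕ → Measure Ω) (G₁ : Set (Ω → ℝ))
    (δ : (n : ℕ) → (Fin n → Ω) → ℝ) : ℝ :=
  ⨅ g₁ : G₁, asyPower A δ g₁

/-- `δ` solves the maxmin asymptotic testing problem `H_{G₀}` vs. `K_{G₁}` at level `α`. -/
def IsMaxminTest (A : (Ω → ℝ) → ℕ → Measure Ω) (α : ℝ) (G₀ G₁ : Set (Ω → ℝ))
    (δ : (n : ℕ) → (Fin n → Ω) → ℝ) : Prop :=
  IsTestSeq δ ∧ HasAsyLevel A α G₀ δ ∧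
    ∀ δ', IsTestSeq δ' → HasAsyLevel A α G₀ δ' → minAsyPower A G₁ δ' ≤ minAsyPower A G₁ δ

/-- `((g₀, g₁), δ)` is a saddle point of the maxmin asymptotic testing problem `H_{G₀}` vs.
`K_{G₁}` at level `α`: `δ` has asymptotic level `α` on all of `G₀`, it is optimal for the simple
problem `H_{g₀}` vs. `K_{g₁}` at level `α`, and its power is smallest at `g₁`. -/
def IsSaddlePoint (A : (Ω → ℝ) → ℕ → Measure Ω) (α : ℝ) (G₀ G₁ : Set (Ω → ℝ))
    (g₀ g₁ : Ω → ℝ) (δ : (n : ℕ) → (Fin n → Ω) → ℝ) : Prop :=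
  g₀ ∈ G₀ ∧ g₁ ∈ G₁ ∧ IsTestSeq δ ∧ HasAsyLevel A α G₀ δ ∧
    (∀ δ', IsTestSeq δ' → asySize A δ' g₀ ≤ α → asyPower A δ' g₁ ≤ asyPower A δ g₁) ∧
    ∀ g₁' ∈ G₁, asyPower A δ g₁ ≤ asyPower A δ g₁'

/-- A least favorable tangent pair: the pair component of a saddle point. -/
def IsLeastFavorable (A : (Ω → ℝ) → ℕ → Measure Ω) (α : ℝ) (G₀ G₁ : Set (Ω → ℝ))
    (g₀ g₁ : Ω → ℝ) : Prop :=
  ∃ δ, IsSaddlePoint A α G₀ G₁ g₀ g₁ δ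

open Classical in
/-- The test `δ_{n,g}` for the pair `g = (g₀, g₁)`, where `u` is the normal upper `α` point:
with `g₁₀ = g₁ - g₀`, the indicator of
`n^{-1/2} ∑ g₁₀(xᵢ) > ‖g₁₀‖ u + ⟨g₁₀, g₀⟩`. -/
def pairTest (P : Measure Ω) (u : ℝ) (g₀ g₁ : Ω → ℝ) (n : ℕ) (x : Fin n → Ω) : ℝ :=
  if nrm P (fun y => g₁ y - g₀ y) * u + inn P (fun y => g₁ y - g₀ y) g₀ <
      1 / Real.sqrt n * ∑ i, (g₁ (x i) - g₀ (x i)) then 1 else 0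

/-- The tangent ball `G_v` of total variation: tangents `g` with `E|g| ≤ 2`. -/
def tangentBall (P : Measure Ω) : Set (Ω → ℝ) :=
  {g | IsTangent P g ∧ ∫ x, |g x| ∂P ≤ 2}

/-- `G_{v,0} = r₀ G_v`. -/
def nullTangents (P : Measure Ω) (r₀ : ℝ) : Set (Ω → ℝ) :=
  {h | ∃ g ∈ tangentBall P, h = fun x => r₀ * g x}

/-- `G_{v,1} = τ Λ + r₁ G_v`. -/
def altTangents (P : Measure Ω) (Λ : Ω → ℝ) (τ r₁ : ℝ) : Set (Ω → ℝ) :=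
  {h | ∃ g ∈ tangentBall P, h = fun x => τ * Λ x + r₁ * g x}

/-- The clipped function `v' ∨ Λ ∧ v''`. -/
def clip (Λ : Ω → ℝ) (v' v'' : ℝ) (x : Ω) : ℝ := max v' (min (Λ x) v'')

/-- The difference of two test sequences tends to `0` in `P^n`-probability. -/
def AsyEquiv (P : Measure Ω) (δ δ' : (n : ℕ) → (Fin n → Ω) → ℝ) : Prop :=
  ∀ ε : ℝ, 0 < ε → Tendsto (fun n => iid P n {x | ε < |δ n x - δ' n x|}) atTop (𝓝 0)

/-- Maximum size of `δ n` over the ball of radius `r / √n` about `P`. -/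
def maxSize (P : Measure Ω) (r : ℝ)
    (δ : (n : ℕ) → (Fin n → Ω) → ℝ) (n : ℕ) : ℝ :=
  ⨆ Q : tvBall P (r / Real.sqrt (n : ℝ)), ∫ x, δ n x ∂(iid (Q : Measure Ω) n)

/-- Minimum power of `δ n` over the ball of radius `r / √n` about `P n`. -/
def minPower (P : ℕ → Measure Ω) (r : ℝ)
    (δ : (n : ℕ) → (Fin n → Ω) → ℝ) (n : ℕ) : ℝ :=
  ⨅ Q : tvBall (P n) (r / Real.sqrt (n : ℝ)), ∫ x, δ n x ∂(iid (Q : Measure Ω) n)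

/-- `(Q₀, Q₁)` with `dQ₁ = π dQ₀` is a (Huber-Strassen) least favorable probability pair for the
sets of probabilities `U₀` vs. `U₁`. -/
def IsLeastFavorableProbPair (U₀ U₁ : Set (Measure Ω)) (Q₀ Q₁ : Measure Ω) (π : Ω → ℝ≥0) : Prop :=
  Q₀ ∈ U₀ ∧ Q₁ ∈ U₁ ∧ Measurable π ∧ Q₁ = Q₀.withDensity (fun x => (π x : ℝ≥0∞)) ∧
    ∀ t : ℝ≥0, 0 < t →
      (∀ Q' ∈ U₀, Q' {x | t < π x} ≤ Q₀ {x | t < π x}) ∧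
      (∀ Q'' ∈ U₁, Q₁ {x | t < π x} ≤ Q'' {x | t < π x})

/-- `δ` is a robust asymptotic level `α` test of Huber-Strassen type, for the balls of radii
`r₀ / √n` about `P₀` and `r₁ / √n` about `P₁ n`: for all large `n`, `δ n` is a Neyman-Pearson
(likelihood ratio) test based on a least favorable probability pair, with critical value `c` and
randomization constant `γ`, and the maximum size over the null ball tends to `α`. -/
def IsHuberStrassenTest (P₀ : Measure Ω) (P₁ : ℕ → Measure Ω) (r₀ r₁ α : ℝ)
    (δ : (n : ℕ) → (Fin n → Ω) → ℝ) : Prop :=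
  IsTestSeq δ ∧
  (∀ᶠ n : ℕ in atTop, ∃ (Q₀ Q₁ : Measure Ω) (π : Ω → ℝ≥0) (c : ℝ≥0) (γ : ℝ),
    IsLeastFavorableProbPair (tvBall P₀ (r₀ / Real.sqrt n)) (tvBall (P₁ n) (r₁ / Real.sqrt n))
      Q₀ Q₁ π ∧
    ∀ x : Fin n → Ω,
      (c < ∏ i, π (x i) → δ n x = 1) ∧ (∏ i, π (x i) = c → δ n x = γ) ∧
      (∏ i, π (x i) < c → δ n x = 0)) ∧
  Tendsto (maxSize P₀ r₀ δ) atTop (𝓝 α)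

/-- `δ` maximizes the asymptotic minimum power over the balls of radius `r₁ / √n` about `P₁ n`
subject to asymptotic maximum size `≤ α` over the balls of radius `r₀ / √n` about `P₀`. -/
def IsRobustMaxminTest (P₀ : Measure Ω) (P₁ : ℕ → Measure Ω) (r₀ r₁ α : ℝ)
    (δ : (n : ℕ) → (Fin n → Ω) → ℝ) : Prop :=
  IsTestSeq δ ∧ limsup (maxSize P₀ r₀ δ) atTop ≤ α ∧
    ∀ δ', IsTestSeq δ' → limsup (maxSize P₀ r₀ δ') atTop ≤ α →
      liminf (minPower P₁ r₁ δ') atTop ≤ liminf (minPower P₁ r₁ δ) atTop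

end RobustTest

end

open MeasureTheory ProbabilityTheory Filter Topology Asymptotics
open scoped NNReal ENNReal

noncomputable section

namespace RobustTest

variable {Ω : Type*} [MeasurableSpace Ω]

/-! ### Product measures -/

/-! To first order only tangents matter. If two sequences of probabilities have tangents that are
close in L₂(P), their n-fold products are close in total variation; this is a Hellinger estimate
(`IsQMD.exists_iid_bound`). Testing a tangent b against d = b + f with f bounded thus becomes a
Gaussian shift problem: the alternative may be replaced by the exponential tilt of the null
sequence, with density proportional to exp(f/√n), and then the likelihood ratio of the products is
exactly an increasing function of n^{-1/2} ∑ f(xᵢ) (`IsQMD.exists_expTilt`). With a central limit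
theorem for triangular arrays this gives the maximal power Φ(-u + ‖f‖), and a quantitative
Neyman-Pearson identity shows that a test of nearly maximal power must be close to the optimal one
(`exists_neymanPearson_bound`, `eventually_power_le`, `asyEquiv_of_power`). Contiguity carries the
last statement from the null sequence to P^n.

What remains in part a) is geometry in L₂(P): the least favorable pair has the difference of
smallest norm. Subtracting r g̃ from τΛ clips the score, so that this difference is τ Λ^{(v)}. The
decisive inequality is ⟨Λ^{(v)} | g⟩ ≤ v'' - v' for every g in the tangent ball, with equality at g̃
(`ClipData.inn_clip_le`, `ClipData.inn_clip_extremeTangent`). It says that the test based on Λ^{(v)}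
has its largest size at r₀ g̃ and its smallest power at τΛ - r₁ g̃, which is the saddle point. It
also is the variational inequality of a projection, so every least favorable pair has the same
difference (`ClipData.diff_eq_of_isLeastFavorable`). The characterization follows because the
positive and negative parts then have no mass to spare.

For part b), the members of the balls need not be differentiable in any sense. Since Λ^{(v)} is
bounded, its oscillation v'' - v' bounds the drift of the sum over the whole ball, which controls
size and power of the test uniformly. Conversely the balls contain sequences whose tangents form the
least favorable pair (`IsQMD.exists_mem_tvBall`), so the power bound of the simple problem applies
to every competitor. Least favorable probability pairs are built by truncating the likelihood ratio
near 1 (`eventually_exists_isLeastFavorableProbPair`). A test based on such a pair is compared, by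
the exact Neyman-Pearson lemma, with the clipped test at a slightly smaller level; so it is
asymptotically optimal along the least favorable sequences, and uniqueness of optimal tests
identifies it (`ClipData.asyEquiv_of_isHuberStrassenTest`). -/

instance iid_isProbabilityMeasure (Q : Measure Ω) [IsProbabilityMeasure Q] (n : ℕ) :
    IsProbabilityMeasure (iid Q n) := by
  unfold iid; infer_instance

lemma integrable_fun_sub {S : Type*} [MeasurableSpace S] {μ : Measure S} {f g : S → ℝ}
    (hf : Integrable f μ) (hg : Integrable g μ) : Integrable (fun x => f x - g x) μ :=
  hf.sub hg

lemma integral_withDensity_ofReal {P : Measure Ω} {f : Ω → ℝ} (hf : Measurable f)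
    (hf0 : ∀ x, 0 ≤ f x) (g : Ω → ℝ) :
    ∫ x, g x ∂(P.withDensity fun x => ENNReal.ofReal (f x)) = ∫ x, f x * g x ∂P := by
  rw [integral_withDensity_eq_integral_toReal_smul hf.ennreal_ofReal (by simp)]
  simp [hf0]

lemma integrable_withDensity_ofReal_iff {P : Measure Ω} {f : Ω → ℝ} (hf : Measurable f)
    (hf0 : ∀ x, 0 ≤ f x) (g : Ω → ℝ) :
    Integrable g (P.withDensity fun x => ENNReal.ofReal (f x)) ↔
      Integrable (fun x => f x * g x) P := by
  rw [integrable_withDensity_iff_integrable_smul' hf.ennreal_ofReal (by simp)]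
  simp [hf0]

lemma lintegral_iid_prod (P : Measure Ω) [IsProbabilityMeasure P]
    (n : ℕ) {g : Fin n → Ω → ℝ≥0∞} (hg : ∀ i, Measurable (g i)) :
    ∫⁻ x, ∏ i, g i (x i) ∂(iid P n) = ∏ i, ∫⁻ x, g i x ∂P := by
  have h := lintegral_prod_eq_prod_lintegral_of_indepFun (μ := iid P n) Finset.univ
    (fun i (x : Fin n → Ω) => g i (x i))
    (iIndepFun_pi (μ := fun _ : Fin n => P) (fun i => (hg i).aemeasurable))
    (fun i => (hg i).comp (measurable_pi_apply i))
  rw [h]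
  refine Finset.prod_congr rfl fun i _ => ?_
  exact (measurePreserving_eval (fun _ : Fin n => P) i).lintegral_comp (hg i)

lemma iid_withDensity (P : Measure Ω) [IsProbabilityMeasure P] {f : Ω → ℝ≥0∞}
    (hf : Measurable f) [SigmaFinite (P.withDensity f)] (n : ℕ) :
    iid (P.withDensity f) n = (iid P n).withDensity fun x => ∏ i, f (x i) := by
  refine Measure.pi_eq fun s hs => ?_
  rw [withDensity_apply _ (MeasurableSet.univ_pi hs), ← lintegral_indicator (MeasurableSet.univ_pi hs)]
  have h : ∀ x : Fin n → Ω, (Set.univ.pi s).indicator (fun x => ∏ i, f (x i)) x =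
      ∏ i, (s i).indicator f (x i) := by
    intro x
    by_cases hx : x ∈ Set.univ.pi s
    · rw [Set.indicator_of_mem hx]
      exact Finset.prod_congr rfl fun i _ => by rw [Set.indicator_of_mem (hx i trivial)]
    · rw [Set.indicator_of_notMem hx]
      simp only [Set.mem_pi, Set.mem_univ, true_imp_iff, not_forall] at hx
      obtain ⟨i, hi⟩ := hx
      exact (Finset.prod_eq_zero (Finset.mem_univ i) (Set.indicator_of_notMem hi _)).symm
  simp_rw [h]
  rw [lintegral_iid_prod P n fun i => hf.indicator (hs i)]
  refine Finset.prod_congr rfl fun i _ => ?_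
  rw [withDensity_apply _ (hs i), lintegral_indicator (hs i)]

/-- Used to compare `Q^n` with the product of the part of `Q` dominated by `P`. The density of `R`
with respect to `Q` is at most one, and so is a product of such densities. -/
lemma iid_mono {R Q : Measure Ω} [IsProbabilityMeasure Q] (h : R ≤ Q) (n : ℕ) :
    iid R n ≤ iid Q n := by
  have : IsFiniteMeasure R := isFiniteMeasure_of_le Q h
  have hR : R = Q.withDensity (R.rnDeriv Q) :=
    (Measure.withDensity_rnDeriv_eq R Q (Measure.absolutelyContinuous_of_le h)).symm
  have h1 : ∀ᵐ x ∂(iid Q n), ∀ i, R.rnDeriv Q (x i) ≤ 1 := by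
    rw [ae_all_iff]
    intro i
    exact (measurePreserving_eval (fun _ : Fin n => Q) i).quasiMeasurePreserving.ae
      (Measure.rnDeriv_le_one_of_le h)
  have : SigmaFinite (Q.withDensity (R.rnDeriv Q)) := by rw [← hR]; infer_instance
  rw [hR, iid_withDensity Q (Measure.measurable_rnDeriv R Q)]
  calc (iid Q n).withDensity (fun x => ∏ i, R.rnDeriv Q (x i))
      ≤ (iid Q n).withDensity 1 := by
        refine withDensity_mono ?_
        filter_upwards [h1] with x hx
        exact Finset.prod_le_one' fun i _ => hx i
    _ = iid Q n := withDensity_one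

/-- A measurable function with values in `[0, 1]`. -/
def IsTest {S : Type*} [MeasurableSpace S] (φ : S → ℝ) : Prop :=
  Measurable φ ∧ ∀ x, 0 ≤ φ x ∧ φ x ≤ 1

lemma IsTest.integrable {S : Type*} [MeasurableSpace S] {φ : S → ℝ} (h : IsTest φ)
    (μ : Measure S) [IsFiniteMeasure μ] : Integrable φ μ :=
  Integrable.of_bound h.1.aestronglyMeasurable 1
    (ae_of_all _ fun x => by rw [Real.norm_eq_abs, abs_le]; constructor <;> linarith [h.2 x])

lemma IsTest.integral_nonneg {S : Type*} [MeasurableSpace S] {φ : S → ℝ} (h : IsTest φ)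
    (μ : Measure S) : 0 ≤ ∫ x, φ x ∂μ :=
  MeasureTheory.integral_nonneg fun x => (h.2 x).1

lemma IsTest.integral_le_one {S : Type*} [MeasurableSpace S] {φ : S → ℝ} (h : IsTest φ)
    (μ : Measure S) [IsProbabilityMeasure μ] : ∫ x, φ x ∂μ ≤ 1 := by
  calc ∫ x, φ x ∂μ ≤ ∫ _, (1 : ℝ) ∂μ :=
        integral_mono (h.integrable μ) (integrable_const _) fun x => (h.2 x).2
    _ = 1 := by simp

lemma IsTest.one_sub {S : Type*} [MeasurableSpace S] {φ : S → ℝ} (h : IsTest φ) :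
    IsTest fun x => 1 - φ x :=
  ⟨measurable_const.sub h.1, fun x => ⟨by linarith [h.2 x], by linarith [h.2 x]⟩⟩

/-- Monotonicity applied to `φ` and to `1 - φ`: a test loses at most the mass that `ν` lacks. -/
lemma integral_sub_integral_of_le {S : Type*} [MeasurableSpace S] {ν Q : Measure S}
    [IsProbabilityMeasure Q] (h : ν ≤ Q) {φ : S → ℝ} (hφ : IsTest φ) :
    0 ≤ ∫ x, φ x ∂Q - ∫ x, φ x ∂ν ∧ ∫ x, φ x ∂Q - ∫ x, φ x ∂ν ≤ 1 - ν.real Set.univ := by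
  have : IsFiniteMeasure ν := isFiniteMeasure_of_le Q h
  have key : ∀ ψ : S → ℝ, IsTest ψ → ∫ x, ψ x ∂ν ≤ ∫ x, ψ x ∂Q := fun ψ hψ =>
    integral_mono_measure h (ae_of_all _ fun x => (hψ.2 x).1) (hψ.integrable Q)
  refine ⟨sub_nonneg.2 (key φ hφ), ?_⟩
  have h1 := key _ hφ.one_sub
  rw [integral_sub (integrable_const _) (hφ.integrable _),
    integral_sub (integrable_const _) (hφ.integrable _)] at h1
  simp at h1
  linarith

/-! ### Total variation -/

section TV

variable {Q P : Measure Ω} [IsProbabilityMeasure Q] [IsProbabilityMeasure P]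

lemma measurable_dens (Q P : Measure Ω) : Measurable (dens Q P) :=
  (Measure.measurable_rnDeriv _ _).ennreal_toReal

lemma dens_nonneg (Q P : Measure Ω) (x : Ω) : 0 ≤ dens Q P x := ENNReal.toReal_nonneg

lemma withDensity_dens (Q P : Measure Ω) [IsProbabilityMeasure Q] [IsProbabilityMeasure P] :
    (Q + P).withDensity (fun x => ENNReal.ofReal (dens Q P x)) = Q := by
  have hQ : Q ≪ Q + P := Measure.absolutelyContinuous_of_le (Measure.le_add_right le_rfl)
  conv_rhs => rw [← Measure.withDensity_rnDeriv_eq Q (Q + P) hQ]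
  refine withDensity_congr_ae ?_
  filter_upwards [Measure.rnDeriv_lt_top Q (Q + P)] with x hx
  exact ENNReal.ofReal_toReal hx.ne

lemma integral_dens_mul (f : Ω → ℝ) :
    ∫ x, dens Q P x * f x ∂(P + Q) = ∫ x, f x ∂Q := by
  conv_rhs => rw [← withDensity_dens Q P]
  rw [integral_withDensity_ofReal (measurable_dens Q P) (dens_nonneg Q P), add_comm]

lemma integral_dens_mul' (f : Ω → ℝ) :
    ∫ x, dens P Q x * f x ∂(P + Q) = ∫ x, f x ∂P := by
  rw [add_comm, integral_dens_mul]

lemma integrable_dens_mul {f : Ω → ℝ} (hf : Integrable f Q) :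
    Integrable (fun x => dens Q P x * f x) (P + Q) := by
  rw [← integrable_withDensity_ofReal_iff (measurable_dens Q P) (dens_nonneg Q P), add_comm,
    withDensity_dens]
  exact hf

lemma integrable_dens_mul' {f : Ω → ℝ} (hf : Integrable f P) :
    Integrable (fun x => dens P Q x * f x) (P + Q) := by
  rw [add_comm]; exact integrable_dens_mul hf

lemma integral_sub_eq_dens {f : Ω → ℝ} (hQ : Integrable f Q) (hP : Integrable f P) :
    ∫ x, f x ∂Q - ∫ x, f x ∂P = ∫ x, (dens Q P x - dens P Q x) * f x ∂(P + Q) := by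
  rw [← integral_dens_mul (P := P) f, ← integral_dens_mul' (Q := Q) (P := P) f,
    ← integral_sub (integrable_dens_mul hQ) (integrable_dens_mul' hP)]
  simp_rw [sub_mul]

lemma integrable_dens_sub (Q P : Measure Ω) [IsProbabilityMeasure Q] [IsProbabilityMeasure P] :
    Integrable (fun x => dens Q P x - dens P Q x) (P + Q) := by
  have h1 := integrable_dens_mul (P := P) (integrable_const (1 : ℝ) (μ := Q))
  have h2 := integrable_dens_mul' (Q := Q) (integrable_const (1 : ℝ) (μ := P))
  simp only [mul_one] at h1 h2
  exact h1.sub h2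

lemma integrable_of_mem_Icc {S : Type*} [MeasurableSpace S] {μ : Measure S} [IsFiniteMeasure μ]
    {f : S → ℝ} (hf : Measurable f) {a b : ℝ} (hab : ∀ x, a ≤ f x ∧ f x ≤ b) :
    Integrable f μ :=
  Integrable.of_bound hf.aestronglyMeasurable (max |a| |b|)
    (ae_of_all _ fun x => abs_le_max_abs_abs (hab x).1 (hab x).2)

/-- Both measures have mass one, so `f` may be centred at the midpoint of its range. This gives the
oscillation `b - a` as the constant, which later becomes the `v'' - v'` of the critical value. -/
lemma abs_integral_sub_le_tvDistance {f : Ω → ℝ} (hf : Measurable f) {a b : ℝ}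
    (hab : ∀ x, a ≤ f x ∧ f x ≤ b) :
    |∫ x, f x ∂Q - ∫ x, f x ∂P| ≤ (b - a) * tvDistance Q P := by
  set m := (a + b) / 2
  have hg : Measurable fun x => f x - m := hf.sub_const m
  have hgb : ∀ x, |f x - m| ≤ (b - a) / 2 := fun x => by
    rw [abs_le]; constructor <;> simp only [m] <;> linarith [hab x]
  have hgQ : ∀ μ : Measure Ω, IsProbabilityMeasure μ → Integrable (fun x => f x - m) μ :=
    fun μ _ => Integrable.of_bound hg.aestronglyMeasurable _ (ae_of_all _ hgb)
  have hfQ : ∀ μ : Measure Ω, IsProbabilityMeasure μ → Integrable f μ :=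
    fun μ _ => integrable_of_mem_Icc hf hab
  have h1 := integral_sub_eq_dens (hgQ Q inferInstance) (hgQ P inferInstance)
  rw [integral_sub (hfQ Q inferInstance) (integrable_const _),
    integral_sub (hfQ P inferInstance) (integrable_const _)] at h1
  simp only [integral_const, probReal_univ, smul_eq_mul, one_mul, sub_sub_sub_cancel_right] at h1
  rw [h1]
  calc |∫ x, (dens Q P x - dens P Q x) * (f x - m) ∂(P + Q)|
      ≤ ∫ x, |dens Q P x - dens P Q x| * ((b - a) / 2) ∂(P + Q) := by
        refine abs_integral_le_integral_abs.trans (integral_mono_of_nonneg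
          (ae_of_all _ fun x => abs_nonneg _) ((integrable_dens_sub Q P).abs.mul_const _)
          (ae_of_all _ fun x => ?_))
        dsimp only
        rw [abs_mul]
        exact mul_le_mul_of_nonneg_left (hgb x) (abs_nonneg _)
    _ = (b - a) * tvDistance Q P := by
        rw [integral_mul_const, tvDistance]; ring

lemma real_sub_le_tvDistance {A : Set Ω} (hA : MeasurableSet A) :
    |Q.real A - P.real A| ≤ tvDistance Q P := by
  have h := abs_integral_sub_le_tvDistance (Q := Q) (P := P) (f := A.indicator 1)
    (measurable_one.indicator hA) (a := 0) (b := 1) fun x => by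
      by_cases hx : x ∈ A <;> simp [hx]
  simpa [integral_indicator_one hA] using h

/-- The distance is attained on the set where `dQ > dP`, because `|d| = 2 d⁺ - d` and `d` integrates
to zero. -/
lemma tvDistance_le_of_forall {ρ : ℝ}
    (h : ∀ A, MeasurableSet A → Q.real A - P.real A ≤ ρ) : tvDistance Q P ≤ ρ := by
  set d := fun x => dens Q P x - dens P Q x with hd
  have hdm : Measurable d := (measurable_dens Q P).sub (measurable_dens P Q)
  have hA : MeasurableSet {x | 0 < d x} := hdm measurableSet_Ioi
  have h0 := integral_sub_eq_dens (Q := Q) (P := P) (integrable_const (1 : ℝ))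
    (integrable_const (1 : ℝ))
  have h1 := integral_sub_eq_dens (Q := Q) (P := P) (f := {x | 0 < d x}.indicator 1)
    ((integrable_const (1 : ℝ)).indicator hA) ((integrable_const (1 : ℝ)).indicator hA)
  rw [integral_indicator_one hA, integral_indicator_one hA] at h1
  simp only [integral_const, probReal_univ, smul_eq_mul, mul_one, sub_self] at h0
  have h2 : ∀ x, |d x| = 2 * (d x * {x | 0 < d x}.indicator (1 : Ω → ℝ) x) - d x := by
    intro x
    by_cases hx : 0 < d x
    · rw [Set.indicator_of_mem (by exact hx), abs_of_pos hx]; simp; ring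
    · rw [Set.indicator_of_notMem (by exact hx), abs_of_nonpos (not_lt.1 hx)]; simp
  have hdi : Integrable d (P + Q) := integrable_dens_sub Q P
  have hdi2 : Integrable (fun x => d x * {x | 0 < d x}.indicator (1 : Ω → ℝ) x) (P + Q) := by
    refine (hdi.indicator hA).congr (ae_of_all _ fun x => ?_)
    by_cases hx : 0 < d x <;> simp [hx]
  have h3 : tvDistance Q P = Q.real {x | 0 < d x} - P.real {x | 0 < d x} := by
    rw [h1, tvDistance]
    change (∫ x, |d x| ∂(P + Q)) / 2 = ∫ x, d x * _ ∂(P + Q)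
    simp_rw [h2]
    rw [integral_sub (hdi2.const_mul 2) hdi, integral_const_mul]
    change 0 = ∫ x, d x ∂(P + Q) at h0
    rw [← h0]; ring
  rw [h3]; exact h _ hA

lemma self_mem_tvBall (P : Measure Ω) [IsProbabilityMeasure P] {r : ℝ} (hr : 0 ≤ r) :
    P ∈ tvBall P r :=
  ⟨inferInstance, tvDistance_le_of_forall fun A _ => by simpa using hr⟩

end TV


/-! ### Square roots of densities -/

lemma abs_integral_mul_le_sqrt {S : Type*} [MeasurableSpace S] {μ : Measure S} {f g : S → ℝ}
    (hf : MemLp f 2 μ) (hg : MemLp g 2 μ) :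
    ∫ x, |f x * g x| ∂μ ≤ Real.sqrt (∫ x, f x ^ 2 ∂μ) * Real.sqrt (∫ x, g x ^ 2 ∂μ) := by
  have h := integral_mul_norm_le_Lp_mul_Lq (μ := μ) (f := f) (g := g)
    Real.HolderConjugate.two_two (by simpa using hf) (by simpa using hg)
  simp only [Real.norm_eq_abs, Real.rpow_two, sq_abs] at h
  simp_rw [abs_mul]
  rw [Real.sqrt_eq_rpow, Real.sqrt_eq_rpow]
  exact h

/-- `ξ²` is (up to mass orthogonal to `P`) a density of `Q` with respect to `P`. -/
def IsRoot (P Q : Measure Ω) (ξ : Ω → ℝ) : Prop :=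
  Measurable ξ ∧ (∀ x, 0 ≤ ξ x) ∧ P.withDensity (fun x => ENNReal.ofReal (ξ x ^ 2)) ≤ Q

namespace IsRoot

variable {P Q Q' : Measure Ω} [IsProbabilityMeasure P] [IsProbabilityMeasure Q]
  [IsProbabilityMeasure Q'] {ξ ξ' : Ω → ℝ}

lemma integrable_sq (h : IsRoot P Q ξ) : Integrable (fun x => ξ x ^ 2) P := by
  have := isFiniteMeasure_of_le Q h.2.2
  simpa using (integrable_withDensity_ofReal_iff (h.1.pow_const 2) (fun x => sq_nonneg (ξ x))
    (fun _ => (1 : ℝ))).1 (integrable_const 1)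

lemma memLp (h : IsRoot P Q ξ) : MemLp ξ 2 P :=
  (memLp_two_iff_integrable_sq h.1.aestronglyMeasurable).2 h.integrable_sq

lemma real_univ (ξ : Ω → ℝ) (h : Measurable ξ) :
    (P.withDensity fun x => ENNReal.ofReal (ξ x ^ 2)).real Set.univ = ∫ x, ξ x ^ 2 ∂P := by
  have h1 := integral_withDensity_ofReal (P := P) (h.pow_const 2) (fun x => sq_nonneg (ξ x))
    (fun _ => (1 : ℝ))
  simpa using h1

lemma integral_sub (h : IsRoot P Q ξ) {φ : Ω → ℝ} (hφ : IsTest φ) :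
    0 ≤ ∫ x, φ x ∂Q - ∫ x, ξ x ^ 2 * φ x ∂P ∧
      ∫ x, φ x ∂Q - ∫ x, ξ x ^ 2 * φ x ∂P ≤ 1 - ∫ x, ξ x ^ 2 ∂P := by
  have h1 := integral_sub_integral_of_le h.2.2 hφ
  rwa [integral_withDensity_ofReal (h.1.pow_const 2) (fun x => sq_nonneg (ξ x)),
    real_univ ξ h.1] at h1

lemma integral_sq_le_one (h : IsRoot P Q ξ) : ∫ x, ξ x ^ 2 ∂P ≤ 1 := by
  have := (h.integral_sub (φ := fun _ => 0) ⟨measurable_const, fun x => by simp⟩).2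
  simp at this
  exact this

lemma integral_sub_iid (h : IsRoot P Q ξ) (n : ℕ) {φ : (Fin n → Ω) → ℝ} (hφ : IsTest φ) :
    0 ≤ ∫ x, φ x ∂(iid Q n) - ∫ x, (∏ i, ξ (x i)) ^ 2 * φ x ∂(iid P n) ∧
      ∫ x, φ x ∂(iid Q n) - ∫ x, (∏ i, ξ (x i)) ^ 2 * φ x ∂(iid P n) ≤
        n * (1 - ∫ x, ξ x ^ 2 ∂P) := by
  have := isFiniteMeasure_of_le Q h.2.2
  have hm : Measurable fun x : Fin n → Ω => ∏ i, ξ (x i) :=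
    Finset.measurable_fun_prod _ fun i _ => h.1.comp (measurable_pi_apply i)
  have h2 : iid (P.withDensity fun x => ENNReal.ofReal (ξ x ^ 2)) n =
      (iid P n).withDensity fun x => ENNReal.ofReal ((∏ i, ξ (x i)) ^ 2) := by
    rw [iid_withDensity P (h.1.pow_const 2).ennreal_ofReal]
    congr 1; ext x
    rw [← Finset.prod_pow, ENNReal.ofReal_prod_of_nonneg fun i _ => sq_nonneg _]
  have h1 := integral_sub_integral_of_le (iid_mono h.2.2 n) hφ
  rw [h2, integral_withDensity_ofReal (hm.pow_const 2) (fun x => sq_nonneg _),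
    real_univ _ hm] at h1
  refine ⟨h1.1, h1.2.trans ?_⟩
  have h3 : ∫ x : Fin n → Ω, (∏ i, ξ (x i)) ^ 2 ∂(iid P n) = (∫ x, ξ x ^ 2 ∂P) ^ n := by
    simp_rw [← Finset.prod_pow]
    have := integral_fintype_prod_eq_pow (ι := Fin n) (μ := P) (fun x => ξ x ^ 2)
    rw [Fintype.card_fin] at this
    exact this
  rw [h3]
  have h0 : 0 ≤ ∫ x, ξ x ^ 2 ∂P := integral_nonneg fun x => sq_nonneg _
  have := one_add_mul_le_pow (a := (∫ x, ξ x ^ 2 ∂P) - 1) (by linarith) n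
  rw [add_sub_cancel] at this
  linarith

/-- With `F`, `G` the products of the roots, `F² - G² = (F - G)(F + G)`, and Cauchy-Schwarz bounds
the dominated parts by `‖F - G‖ ‖F + G‖`. The Hellinger affinity factorizes over products, and
Bernoulli's inequality makes the first factor linear in `n`. The remaining terms account for mass
orthogonal to `P`. -/
lemma abs_integral_iid_sub_le (h : IsRoot P Q ξ) (h' : IsRoot P Q' ξ') (n : ℕ)
    {φ : (Fin n → Ω) → ℝ} (hφ : IsTest φ) :
    |∫ x, φ x ∂(iid Q n) - ∫ x, φ x ∂(iid Q' n)| ≤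
      n * (1 - ∫ x, ξ x ^ 2 ∂P) + n * (1 - ∫ x, ξ' x ^ 2 ∂P) +
        2 * Real.sqrt (n * ∫ x, (ξ x - ξ' x) ^ 2 ∂P + n * (1 - ∫ x, ξ x ^ 2 ∂P) +
          n * (1 - ∫ x, ξ' x ^ 2 ∂P)) := by
  have ha := h.integral_sub_iid n hφ
  have hb := h'.integral_sub_iid n hφ
  set a := ∫ x, ξ x ^ 2 ∂P with ha_def
  set b := ∫ x, ξ' x ^ 2 ∂P with hb_def
  set ρ := ∫ x, ξ x * ξ' x ∂P with hρ_def
  have ha1 : a ≤ 1 := h.integral_sq_le_one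
  have hb1 : b ≤ 1 := h'.integral_sq_le_one
  have ha0 : 0 ≤ a := integral_nonneg fun x => sq_nonneg _
  have hb0 : 0 ≤ b := integral_nonneg fun x => sq_nonneg _
  have hρ0 : 0 ≤ ρ := integral_nonneg fun x => mul_nonneg (h.2.1 x) (h'.2.1 x)
  have hii : Integrable (fun x => ξ x * ξ' x) P := h.memLp.integrable_mul h'.memLp
  have hsq : ∫ x, (ξ x - ξ' x) ^ 2 ∂P = a + b - 2 * ρ := by
    have : ∀ x, (ξ x - ξ' x) ^ 2 = ξ x ^ 2 + ξ' x ^ 2 - 2 * (ξ x * ξ' x) := fun x => by ring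
    simp_rw [this]
    rw [MeasureTheory.integral_sub (h.integrable_sq.fun_add h'.integrable_sq) (hii.const_mul 2),
      integral_add h.integrable_sq h'.integrable_sq, integral_const_mul]
  set F : (Fin n → Ω) → ℝ := fun x => ∏ i, ξ (x i) with hF
  set G : (Fin n → Ω) → ℝ := fun x => ∏ i, ξ' (x i) with hG
  have hFm : Measurable F := Finset.measurable_fun_prod _ fun i _ => h.1.comp (measurable_pi_apply i)
  have hGm : Measurable G :=
    Finset.measurable_fun_prod _ fun i _ => h'.1.comp (measurable_pi_apply i)
  have hpow : ∀ f : Ω → ℝ, ∫ x : Fin n → Ω, ∏ i, f (x i) ∂(iid P n) = (∫ x, f x ∂P) ^ n := by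
    intro f
    have := integral_fintype_prod_eq_pow (ι := Fin n) (μ := P) f
    rwa [Fintype.card_fin] at this
  have hint : ∀ f : Ω → ℝ, Integrable f P →
      Integrable (fun x : Fin n → Ω => ∏ i, f (x i)) (iid P n) :=
    fun f hf => Integrable.fintype_prod (f := fun _ : Fin n => f) fun _ => hf
  have hF2 : Integrable (fun x => F x ^ 2) (iid P n) := by
    simp_rw [hF, ← Finset.prod_pow]; exact hint _ h.integrable_sq
  have hG2 : Integrable (fun x => G x ^ 2) (iid P n) := by
    simp_rw [hG, ← Finset.prod_pow]; exact hint _ h'.integrable_sq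
  have hFG : Integrable (fun x => F x * G x) (iid P n) := by
    simp_rw [hF, hG, ← Finset.prod_mul_distrib]; exact hint _ hii
  have hF2i : ∫ x, F x ^ 2 ∂(iid P n) = a ^ n := by
    simp_rw [hF, ← Finset.prod_pow]; exact hpow fun x => ξ x ^ 2
  have hG2i : ∫ x, G x ^ 2 ∂(iid P n) = b ^ n := by
    simp_rw [hG, ← Finset.prod_pow]; exact hpow fun x => ξ' x ^ 2
  have hFGi : ∫ x, F x * G x ∂(iid P n) = ρ ^ n := by
    simp_rw [hF, hG, ← Finset.prod_mul_distrib]; exact hpow fun x => ξ x * ξ' x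
  have hFL : MemLp F 2 (iid P n) := (memLp_two_iff_integrable_sq hFm.aestronglyMeasurable).2 hF2
  have hGL : MemLp G 2 (iid P n) := (memLp_two_iff_integrable_sq hGm.aestronglyMeasurable).2 hG2
  have hmin : ∫ x, (F x - G x) ^ 2 ∂(iid P n) = a ^ n + b ^ n - 2 * ρ ^ n := by
    have : ∀ x, (F x - G x) ^ 2 = F x ^ 2 + G x ^ 2 - 2 * (F x * G x) := fun x => by ring
    simp_rw [this]
    rw [MeasureTheory.integral_sub (hF2.fun_add hG2) (hFG.const_mul 2),
      integral_add hF2 hG2, integral_const_mul, hF2i, hG2i, hFGi]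
  have hplus : ∫ x, (F x + G x) ^ 2 ∂(iid P n) = a ^ n + b ^ n + 2 * ρ ^ n := by
    have : ∀ x, (F x + G x) ^ 2 = F x ^ 2 + G x ^ 2 + 2 * (F x * G x) := fun x => by ring
    simp_rw [this]
    rw [integral_add (hF2.fun_add hG2) (hFG.const_mul 2),
      integral_add hF2 hG2, integral_const_mul, hF2i, hG2i, hFGi]
  have han : a ^ n ≤ 1 := pow_le_one₀ ha0 ha1
  have hbn : b ^ n ≤ 1 := pow_le_one₀ hb0 hb1
  have hρ1 : ρ ≤ 1 := by
    have : 0 ≤ a + b - 2 * ρ := by rw [← hsq]; exact integral_nonneg fun x => sq_nonneg _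
    linarith
  have hρn : ρ ^ n ≤ 1 := pow_le_one₀ hρ0 hρ1
  have hbern : 1 - ρ ^ n ≤ n * (1 - ρ) := by
    have := one_add_mul_le_pow (a := ρ - 1) (by linarith) n
    rw [add_sub_cancel] at this
    linarith
  have hcs := abs_integral_mul_le_sqrt (hFL.sub hGL) (hFL.add hGL)
  simp only [Pi.sub_apply, Pi.add_apply] at hcs
  rw [hmin, hplus] at hcs
  have h1 : Real.sqrt (a ^ n + b ^ n + 2 * ρ ^ n) ≤ 2 := by
    rw [Real.sqrt_le_left (by norm_num)]; linarith
  -- As `a ^ n` and `b ^ n` are at most one, the radicand is at most `2 (1 - ρ ^ n) ≤ 2 n (1 - ρ)`,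
  -- and `2 (1 - ρ) = (a + b - 2 ρ) + (1 - a) + (1 - b)`.
  have h2 : Real.sqrt (a ^ n + b ^ n - 2 * ρ ^ n) ≤
      Real.sqrt (n * (a + b - 2 * ρ) + n * (1 - a) + n * (1 - b)) := by
    refine Real.sqrt_le_sqrt ?_
    nlinarith
  have hφb : ∀ x, ‖φ x‖ ≤ 1 := fun x => by
    rw [Real.norm_eq_abs, abs_le]; constructor <;> linarith [hφ.2 x]
  have hFφ : Integrable (fun x => F x ^ 2 * φ x) (iid P n) :=
    hF2.mul_bdd (c := 1) hφ.1.aestronglyMeasurable (ae_of_all _ hφb)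
  have hGφ : Integrable (fun x => G x ^ 2 * φ x) (iid P n) :=
    hG2.mul_bdd (c := 1) hφ.1.aestronglyMeasurable (ae_of_all _ hφb)
  have h3 : |∫ x, F x ^ 2 * φ x ∂(iid P n) - ∫ x, G x ^ 2 * φ x ∂(iid P n)| ≤
      Real.sqrt (a ^ n + b ^ n - 2 * ρ ^ n) * Real.sqrt (a ^ n + b ^ n + 2 * ρ ^ n) := by
    rw [← MeasureTheory.integral_sub hFφ hGφ]
    refine le_trans (abs_integral_le_integral_abs.trans ?_) hcs
    refine integral_mono_of_nonneg (ae_of_all _ fun x => abs_nonneg _)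
      ((hFL.sub hGL).integrable_mul (hFL.add hGL)).abs (ae_of_all _ fun x => ?_)
    have : F x ^ 2 * φ x - G x ^ 2 * φ x = ((F x - G x) * (F x + G x)) * φ x := by ring
    dsimp only
    rw [this, abs_mul]
    exact mul_le_of_le_one_right (abs_nonneg _) (hφb x)
  have h4 : |∫ x, F x ^ 2 * φ x ∂(iid P n) - ∫ x, G x ^ 2 * φ x ∂(iid P n)| ≤
      2 * Real.sqrt (n * (a + b - 2 * ρ) + n * (1 - a) + n * (1 - b)) := by
    refine h3.trans ?_
    rw [mul_comm]
    exact mul_le_mul h1 h2 (Real.sqrt_nonneg _) zero_le_two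
  rw [hsq]
  rw [abs_le] at h4 ⊢
  constructor <;> linarith [h4.1, h4.2, ha.1, ha.2, hb.1, hb.2]

end IsRoot

/-- `Q n` is differentiable in quadratic mean with tangent `h` along `1 / √n`, in terms of square
roots `ξ n` of the densities of the absolutely continuous parts. -/
structure IsQMD (P : Measure Ω) (Q : ℕ → Measure Ω) (h : Ω → ℝ) (ξ : ℕ → Ω → ℝ) : Prop where
  prob : ∀ᶠ n in atTop, IsProbabilityMeasure (Q n)
  root : ∀ᶠ n in atTop, IsRoot P (Q n) (ξ n)
  memLp : MemLp h 2 P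
  err : Tendsto (fun n : ℕ => (n : ℝ) * ∫ x, (ξ n x - 1 - h x / (2 * Real.sqrt n)) ^ 2 ∂P) atTop (𝓝 0)
  mass : Tendsto (fun n : ℕ => n * (1 - ∫ x, ξ n x ^ 2 ∂P)) atTop (𝓝 0)

/-- Square root of the density of the absolutely continuous part of `Q`. -/
def densRoot (P Q : Measure Ω) (x : Ω) : ℝ := Real.sqrt (dens Q P x / dens P Q x)

lemma isRoot_densRoot (P Q : Measure Ω) [IsProbabilityMeasure P] [IsProbabilityMeasure Q] :
    IsRoot P Q (densRoot P Q) := by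
  have hm : Measurable (fun x => dens Q P x / dens P Q x) :=
    (measurable_dens Q P).div (measurable_dens P Q)
  refine ⟨hm.sqrt, fun x => Real.sqrt_nonneg _, ?_⟩
  have h1 : ∀ x, densRoot P Q x ^ 2 = dens Q P x / dens P Q x := fun x =>
    Real.sq_sqrt (div_nonneg (dens_nonneg Q P x) (dens_nonneg P Q x))
  simp_rw [h1]
  have e : P.withDensity (fun x => ENNReal.ofReal (dens Q P x / dens P Q x)) =
      (Q + P).withDensity ((fun x => ENNReal.ofReal (dens P Q x)) *
        fun x => ENNReal.ofReal (dens Q P x / dens P Q x)) := by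
    rw [withDensity_mul _ (measurable_dens P Q).ennreal_ofReal hm.ennreal_ofReal, add_comm Q P,
      withDensity_dens]
  rw [e]
  conv_rhs => rw [← withDensity_dens Q P]
  refine withDensity_mono (ae_of_all _ fun x => ?_)
  dsimp only [Pi.mul_apply]
  rw [← ENNReal.ofReal_mul (dens_nonneg P Q x)]
  refine ENNReal.ofReal_le_ofReal ?_
  -- Where the density of `P` vanishes the quotient is zero by convention; only mass of `Q` is
  -- discarded there.
  by_cases hx : dens P Q x = 0
  · rw [hx, zero_mul]; exact dens_nonneg Q P x
  · rw [mul_div_cancel₀ _ hx]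

/-- Split the integral according to whether the density of `P` vanishes: the zero set contributes
the mass of `Q` orthogonal to `P`, its complement the L₂(P) error of the root. Both terms are
nonnegative, so differentiability in quadratic mean makes each of them `o(1/n)`. -/
lemma densRoot_err (P Q : Measure Ω) [IsProbabilityMeasure P] [IsProbabilityMeasure Q]
    {h : Ω → ℝ} (hh : MemLp h 2 P) :
    ∫ x, (densRoot P Q x - 1 - h x / 2) ^ 2 ∂P + (1 - ∫ x, densRoot P Q x ^ 2 ∂P) =
      qmdRemainder P Q h := by
  have hR := isRoot_densRoot P Q
  have hL : MemLp (fun x => densRoot P Q x - 1 - h x / 2) 2 P :=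
    (hR.memLp.sub (memLp_const 1)).sub (by simpa [div_eq_mul_inv] using hh.mul_const (2⁻¹ : ℝ))
  have i1 := integrable_dens_mul' (Q := Q) hL.integrable_sq
  have i2 := integrable_dens_mul' (Q := Q) hR.integrable_sq
  have i3 := integrable_dens_mul (P := P) (integrable_const (1 : ℝ) (μ := Q))
  have e3 : (1 : ℝ) = ∫ x, dens Q P x * 1 ∂(P + Q) := by
    rw [integral_dens_mul]; simp
  have e4 : 1 - ∫ x, densRoot P Q x ^ 2 ∂P =
      ∫ x, (dens Q P x * 1 - dens P Q x * densRoot P Q x ^ 2) ∂(P + Q) := by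
    rw [integral_sub i3 i2, ← e3, integral_dens_mul']
  rw [e4, ← integral_dens_mul' (Q := Q) (P := P), ← integral_add i1 (integrable_fun_sub i3 i2), qmdRemainder]
  refine integral_congr_ae (ae_of_all _ fun x => ?_)
  have hp := dens_nonneg P Q x
  have hq := dens_nonneg Q P x
  simp only [densRoot]
  by_cases hx : dens P Q x = 0
  · simp [hx, Real.sq_sqrt hq]
  · have hp' : 0 < dens P Q x := lt_of_le_of_ne hp (Ne.symm hx)
    rw [Real.sqrt_div hq]
    have hs : 0 < Real.sqrt (dens P Q x) := Real.sqrt_pos.2 hp'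
    set p := Real.sqrt (dens P Q x)
    set q := Real.sqrt (dens Q P x)
    have e1 : dens P Q x = p ^ 2 := (Real.sq_sqrt hp).symm
    have e2 : dens Q P x = q ^ 2 := (Real.sq_sqrt hq).symm
    rw [e1, e2]
    field_simp
    ring

lemma isQMD_of_remainder {P : Measure Ω} [IsProbabilityMeasure P] {Q : ℕ → Measure Ω}
    {h : Ω → ℝ} (hh : MemLp h 2 P) (hQ : ∀ᶠ n in atTop, IsProbabilityMeasure (Q n))
    (hr : Tendsto (fun n : ℕ => n * qmdRemainder P (Q n) (fun x => h x / Real.sqrt n)) atTop (𝓝 0)) :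
    IsQMD P Q h (fun n => densRoot P (Q n)) := by
  have hLn : ∀ n : ℕ, MemLp (fun x => h x / Real.sqrt n) 2 P := fun n => by
    simpa [div_eq_mul_inv] using hh.mul_const (Real.sqrt n)⁻¹
  have key : ∀ᶠ n : ℕ in atTop,
      (n : ℝ) * ∫ x, (densRoot P (Q n) x - 1 - h x / (2 * Real.sqrt n)) ^ 2 ∂P +
        n * (1 - ∫ x, densRoot P (Q n) x ^ 2 ∂P) =
      n * qmdRemainder P (Q n) (fun x => h x / Real.sqrt n) := by
    filter_upwards [hQ] with n hn
    rw [← densRoot_err P (Q n) (hLn n), mul_add]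
    simp_rw [div_div, mul_comm (Real.sqrt n) 2]
  have hR : ∀ᶠ n in atTop, IsRoot P (Q n) (densRoot P (Q n)) := by
    filter_upwards [hQ] with n hn
    exact isRoot_densRoot P (Q n)
  have hm : ∀ᶠ n : ℕ in atTop, 0 ≤ (n : ℝ) * (1 - ∫ x, densRoot P (Q n) x ^ 2 ∂P) := by
    filter_upwards [hQ, hR] with n hn hn'
    exact mul_nonneg n.cast_nonneg (sub_nonneg.2 hn'.integral_sq_le_one)
  have he : ∀ n : ℕ, 0 ≤ (n : ℝ) * ∫ x, (densRoot P (Q n) x - 1 - h x / (2 * Real.sqrt n)) ^ 2 ∂P :=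
    fun n => mul_nonneg n.cast_nonneg (integral_nonneg fun x => sq_nonneg _)
  refine ⟨hQ, hR, hh, ?_, ?_⟩
  · refine tendsto_of_tendsto_of_tendsto_of_le_of_le' tendsto_const_nhds hr
      (Eventually.of_forall he) ?_
    filter_upwards [key, hm] with n h1 h2
    linarith
  · refine tendsto_of_tendsto_of_tendsto_of_le_of_le' tendsto_const_nhds hr hm ?_
    filter_upwards [key] with n h1
    linarith [he n]

/-! ### Sequences differentiable in quadratic mean -/

lemma tendsto_sqrt_natCast : Tendsto (fun n : ℕ => Real.sqrt n) atTop atTop :=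
  Real.tendsto_sqrt_atTop.comp tendsto_natCast_atTop_atTop

lemma eventually_natCast_pos : ∀ᶠ n : ℕ in atTop, (0 : ℝ) < n := by
  filter_upwards [eventually_gt_atTop 0] with n hn
  exact_mod_cast hn

lemma memLp_div_const {P : Measure Ω} {h : Ω → ℝ} (hh : MemLp h 2 P) (c : ℝ) :
    MemLp (fun x => h x / c) 2 P := by
  simpa [div_eq_mul_inv] using hh.mul_const c⁻¹

namespace IsQMD

variable {P : Measure Ω} [IsProbabilityMeasure P] {Q Q' : ℕ → Measure Ω} {h h' : Ω → ℝ}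
  {ξ ξ' : ℕ → Ω → ℝ}

lemma memLp_err (hQ : IsQMD P Q h ξ) {n : ℕ} [IsProbabilityMeasure (Q n)]
    (hR : IsRoot P (Q n) (ξ n)) :
    MemLp (fun x => ξ n x - 1 - h x / (2 * Real.sqrt n)) 2 P :=
  (hR.memLp.sub (memLp_const 1)).sub (memLp_div_const hQ.memLp _)

/-- Product measures of sequences with nearby tangents are close in total variation. -/
lemma exists_iid_bound (hQ : IsQMD P Q h ξ) (hQ' : IsQMD P Q' h' ξ') :
    ∃ e : ℕ → ℝ, Tendsto e atTop (𝓝 (2 * Real.sqrt (∫ x, (h x - h' x) ^ 2 ∂P))) ∧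
      ∀ᶠ n in atTop, ∀ φ : (Fin n → Ω) → ℝ, IsTest φ →
        |∫ x, φ x ∂(iid (Q n) n) - ∫ x, φ x ∂(iid (Q' n) n)| ≤ e n := by
  set E : ℕ → ℝ := fun n => n * ∫ x, (ξ n x - 1 - h x / (2 * Real.sqrt n)) ^ 2 ∂P
  set E' : ℕ → ℝ := fun n => n * ∫ x, (ξ' n x - 1 - h' x / (2 * Real.sqrt n)) ^ 2 ∂P
  set m : ℕ → ℝ := fun n => n * (1 - ∫ x, ξ n x ^ 2 ∂P)
  set m' : ℕ → ℝ := fun n => n * (1 - ∫ x, ξ' n x ^ 2 ∂P)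
  set D := ∫ x, (h x - h' x) ^ 2 ∂P with hD
  refine ⟨fun n => m n + m' n + 2 * Real.sqrt (4 * E n + 4 * E' n + D + m n + m' n), ?_, ?_⟩
  · have h1 : Tendsto (fun n => 4 * E n + 4 * E' n + D + m n + m' n) atTop
        (𝓝 (4 * 0 + 4 * 0 + D + 0 + 0)) :=
      ((((hQ.err.const_mul 4).add (hQ'.err.const_mul 4)).add_const D).add hQ.mass).add hQ'.mass
    have h2 := (hQ.mass.add hQ'.mass).add (h1.sqrt.const_mul 2)
    simpa using h2
  · filter_upwards [hQ.prob, hQ'.prob, hQ.root, hQ'.root, eventually_natCast_pos] with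
      n i1 i2 r1 r2 hn φ hφ
    refine (r1.abs_integral_iid_sub_le r2 n hφ).trans ?_
    have hs : Real.sqrt n ^ 2 = n := Real.sq_sqrt hn.le
    have hs0 : 0 < Real.sqrt n := Real.sqrt_pos.2 hn
    -- `√n (ξ - ξ')` is the difference of the two scaled remainders plus `(h - h') / 2`. The
    -- constants are not sharp; the bound is only used when `D` is zero or arbitrarily small.
    have key : n * ∫ x, (ξ n x - ξ' n x) ^ 2 ∂P ≤ 4 * E n + 4 * E' n + D := by
      have l1 := (hQ.memLp_err r1).integrable_sq
      have l2 := (hQ'.memLp_err r2).integrable_sq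
      have l3 := (hQ.memLp.sub hQ'.memLp).integrable_sq
      simp only [Pi.sub_apply] at l3
      have : ∫ x, n * (ξ n x - ξ' n x) ^ 2 ∂P ≤
          ∫ x, (4 * (n * (ξ n x - 1 - h x / (2 * Real.sqrt n)) ^ 2) +
            4 * (n * (ξ' n x - 1 - h' x / (2 * Real.sqrt n)) ^ 2) + (h x - h' x) ^ 2) ∂P := by
        refine integral_mono ((r1.memLp.sub r2.memLp).integrable_sq.const_mul _)
          ((((l1.const_mul _).const_mul _).add ((l2.const_mul _).const_mul _)).add l3) fun x => ?_
        dsimp only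
        set a := ξ n x - 1 - h x / (2 * Real.sqrt n) with ha
        set b := ξ' n x - 1 - h' x / (2 * Real.sqrt n) with hb
        have e1 : Real.sqrt n * (ξ n x - ξ' n x) =
            Real.sqrt n * a - Real.sqrt n * b + (h x - h' x) / 2 := by
          rw [ha, hb]; field_simp; ring
        have e2 : (n : ℝ) * (ξ n x - ξ' n x) ^ 2 =
            (Real.sqrt n * a - Real.sqrt n * b + (h x - h' x) / 2) ^ 2 := by
          rw [← e1, mul_pow, hs]
        have e3 : (n : ℝ) * a ^ 2 = (Real.sqrt n * a) ^ 2 := by rw [mul_pow, hs]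
        have e4 : (n : ℝ) * b ^ 2 = (Real.sqrt n * b) ^ 2 := by rw [mul_pow, hs]
        rw [e2, e3, e4]
        nlinarith [sq_nonneg (Real.sqrt n * a + Real.sqrt n * b),
          sq_nonneg (Real.sqrt n * a - Real.sqrt n * b - (h x - h' x) / 2)]
      rw [integral_add (((l1.const_mul _).const_mul _).fun_add ((l2.const_mul _).const_mul _)) l3,
        integral_add ((l1.const_mul _).const_mul _) ((l2.const_mul _).const_mul _)] at this
      simp only [integral_const_mul] at this
      exact this
    have h4 : Real.sqrt (n * ∫ x, (ξ n x - ξ' n x) ^ 2 ∂P + n * (1 - ∫ x, ξ n x ^ 2 ∂P) +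
        n * (1 - ∫ x, ξ' n x ^ 2 ∂P)) ≤ Real.sqrt (4 * E n + 4 * E' n + D + m n + m' n) :=
      Real.sqrt_le_sqrt (by simp only [m, m']; linarith)
    simp only [m, m'] at h4 ⊢
    linarith

lemma exists_iid_bound_of_ae_eq (hQ : IsQMD P Q h ξ) (hQ' : IsQMD P Q' h' ξ')
    (hh : h =ᵐ[P] h') :
    ∃ e : ℕ → ℝ, Tendsto e atTop (𝓝 0) ∧
      ∀ᶠ n in atTop, ∀ φ : (Fin n → Ω) → ℝ, IsTest φ →
        |∫ x, φ x ∂(iid (Q n) n) - ∫ x, φ x ∂(iid (Q' n) n)| ≤ e n := by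
  obtain ⟨e, he, hb⟩ := hQ.exists_iid_bound hQ'
  have : ∫ x, (h x - h' x) ^ 2 ∂P = 0 := by
    rw [integral_eq_zero_of_ae]
    filter_upwards [hh] with x hx
    simp [hx]
  rw [this] at he
  exact ⟨e, by simpa using he, hb⟩

/-- Integrals of bounded functions are linear in the tangent up to `o(1 / √n)`, uniformly. -/
lemma exists_integral_bound (hQ : IsQMD P Q h ξ) :
    ∃ e : ℕ → ℝ, Tendsto e atTop (𝓝 0) ∧ ∀ᶠ n : ℕ in atTop, ∀ f : Ω → ℝ, Measurable f →
      ∀ C, 0 ≤ C → (∀ x, |f x| ≤ C) →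
        |Real.sqrt n * (∫ x, f x ∂(Q n) - ∫ x, f x ∂P) - ∫ x, f x * h x ∂P| ≤ C * e n := by
  set E : ℕ → ℝ := fun n => n * ∫ x, (ξ n x - 1 - h x / (2 * Real.sqrt n)) ^ 2 ∂P with hE
  set m : ℕ → ℝ := fun n => n * (1 - ∫ x, ξ n x ^ 2 ∂P)
  set H := ∫ x, h x ^ 2 ∂P with hH
  have hH0 : 0 ≤ H := integral_nonneg fun x => sq_nonneg _
  refine ⟨fun n => m n + Real.sqrt (E n) * Real.sqrt (6 + H) + H / (4 * Real.sqrt n), ?_, ?_⟩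
  · have h1 : Tendsto (fun n : ℕ => H / (4 * Real.sqrt n)) atTop (𝓝 0) :=
      (tendsto_sqrt_natCast.const_mul_atTop four_pos).const_div_atTop H
    have h2 := (hQ.mass.add (hQ.err.sqrt.mul_const (Real.sqrt (6 + H)))).add h1
    rw [Real.sqrt_zero, zero_mul, add_zero, add_zero] at h2
    exact h2
  · filter_upwards [hQ.prob, hQ.root, eventually_ge_atTop 1] with n i1 r1 hn1 f hf C hC hfC
    have hn1' : (1 : ℝ) ≤ n := by exact_mod_cast hn1
    have hn : (0 : ℝ) < n := by linarith
    have hs : Real.sqrt n ^ 2 = n := Real.sq_sqrt hn.le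
    have hs0 : 0 < Real.sqrt n := Real.sqrt_pos.2 hn
    have hs1 : 1 ≤ Real.sqrt n := Real.one_le_sqrt.2 hn1'
    have hsn : Real.sqrt n ≤ n := by nlinarith
    have hfi : ∀ μ : Measure Ω, IsFiniteMeasure μ → Integrable f μ := fun μ _ =>
      Integrable.of_bound hf.aestronglyMeasurable C (ae_of_all _ hfC)
    have l1 := hQ.memLp_err r1
    set k : Ω → ℝ := fun x => h x / (2 * Real.sqrt n) with hk
    have lk : MemLp k 2 P := memLp_div_const hQ.memLp _
    have lk1 : MemLp (fun x => 1 + k x) 2 P := (memLp_const (1 : ℝ)).add lk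
    have l2 : MemLp (fun x => ξ n x + (1 + k x)) 2 P := r1.memLp.add lk1
    have hξf : Integrable (fun x => ξ n x ^ 2 * f x) P :=
      r1.integrable_sq.mul_bdd (c := C) hf.aestronglyMeasurable (ae_of_all _ hfC)
    have hfh : Integrable (fun x => f x * h x) P :=
      (hQ.memLp.integrable one_le_two).bdd_mul (c := C) hf.aestronglyMeasurable (ae_of_all _ hfC)
    -- the part of `Q n` not accounted for by `ξ n`
    have s1 : |∫ x, f x ∂(Q n) - ∫ x, ξ n x ^ 2 * f x ∂P| ≤ C * (1 - ∫ x, ξ n x ^ 2 ∂P) := by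
      rcases hC.eq_or_lt with rfl | hC
      · have : ∀ x, f x = 0 := fun x => abs_nonpos_iff.1 (hfC x)
        simp [this]
      -- An affine change of `f` into a test, so that `IsRoot.integral_sub` applies. The centring
      -- recovers the factor `C` after rescaling.
      have ht : IsTest fun x => (f x / C + 1) / 2 := by
        refine ⟨by fun_prop, fun x => ?_⟩
        have := abs_le.1 (hfC x)
        have h1 : -1 ≤ f x / C := by rw [le_div_iff₀ hC]; linarith
        have h2 : f x / C ≤ 1 := by rw [div_le_iff₀ hC]; linarith
        constructor <;> linarith
      have h1 := r1.integral_sub ht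
      have e1 : ∫ x, (f x / C + 1) / 2 ∂(Q n) = (∫ x, f x ∂(Q n)) / (2 * C) + 1 / 2 := by
        rw [integral_div, integral_add ((hfi _ inferInstance).div_const _) (integrable_const _),
          integral_div]
        simp; field_simp
      have e2 : ∫ x, ξ n x ^ 2 * ((f x / C + 1) / 2) ∂P =
          (∫ x, ξ n x ^ 2 * f x ∂P) / (2 * C) + (∫ x, ξ n x ^ 2 ∂P) / 2 := by
        rw [← integral_div, ← integral_div, ← integral_add (hξf.div_const _)
          (r1.integrable_sq.div_const _)]
        refine integral_congr_ae (ae_of_all _ fun x => ?_)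
        dsimp only
        field_simp
      rw [e1, e2] at h1
      set A := ∫ x, f x ∂(Q n)
      set B := ∫ x, ξ n x ^ 2 * f x ∂P
      set a := ∫ x, ξ n x ^ 2 ∂P
      have e3 : (A - B) / (2 * C) * (2 * C) = A - B := by field_simp
      have e4 : A / (2 * C) - B / (2 * C) = (A - B) / (2 * C) := by ring
      rw [← e3, abs_le]
      constructor <;> nlinarith [h1.1, h1.2]
    -- the part of `P` under the square root expansion
    have s2 : |Real.sqrt n * (∫ x, ξ n x ^ 2 * f x ∂P - ∫ x, f x ∂P) - ∫ x, f x * h x ∂P| ≤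
        C * (Real.sqrt (E n) * Real.sqrt (6 + H) + H / (4 * Real.sqrt n)) := by
      -- `ξ² - 1 = (ξ - 1 - k)(ξ + 1 + k) + 2 k + k²`, and `2 √n k = h` is the linear term.
      have e1 : Real.sqrt n * (∫ x, ξ n x ^ 2 * f x ∂P - ∫ x, f x ∂P) - ∫ x, f x * h x ∂P =
          ∫ x, f x * (Real.sqrt n * ((ξ n x - 1 - k x) * (ξ n x + (1 + k x))) +
            Real.sqrt n * k x ^ 2) ∂P := by
        rw [← integral_sub hξf (hfi _ inferInstance), ← integral_const_mul,
          ← integral_sub ((integrable_fun_sub hξf (hfi _ inferInstance)).const_mul _) hfh]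
        refine integral_congr_ae (ae_of_all _ fun x => ?_)
        simp only [hk]
        field_simp
        ring
      have i3 : Integrable (fun x => Real.sqrt n * |(ξ n x - 1 - k x) * (ξ n x + (1 + k x))| +
          Real.sqrt n * k x ^ 2) P :=
        ((l1.integrable_mul l2).abs.const_mul _).add (lk.integrable_sq.const_mul _)
      have e2 : |∫ x, f x * (Real.sqrt n * ((ξ n x - 1 - k x) * (ξ n x + (1 + k x))) +
            Real.sqrt n * k x ^ 2) ∂P| ≤
          ∫ x, C * (Real.sqrt n * |(ξ n x - 1 - k x) * (ξ n x + (1 + k x))| +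
            Real.sqrt n * k x ^ 2) ∂P := by
        refine abs_integral_le_integral_abs.trans (integral_mono_of_nonneg
          (ae_of_all _ fun x => abs_nonneg _) (i3.const_mul C) (ae_of_all _ fun x => ?_))
        dsimp only
        rw [abs_mul]
        refine mul_le_mul (hfC x) ?_ (abs_nonneg _) hC
        refine (abs_add_le _ _).trans (le_of_eq ?_)
        rw [abs_mul, abs_of_pos hs0, abs_of_nonneg (by positivity : 0 ≤ Real.sqrt n * k x ^ 2)]
      rw [e1]
      refine e2.trans ?_
      rw [integral_const_mul]
      refine mul_le_mul_of_nonneg_left ?_ hC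
      have i4 : Integrable (fun x => |(ξ n x - 1 - k x) * (ξ n x + (1 + k x))|) P :=
        (l1.integrable_mul l2).abs
      rw [integral_add (i4.const_mul _) (lk.integrable_sq.const_mul _),
        integral_const_mul, integral_const_mul]
      have c1 := abs_integral_mul_le_sqrt l1 l2
      -- The square is at most `2 ξ² + 4 + 4 k²`, where `∫ ξ² ≤ 1` and `4 k² ≤ h²`.
      have c2 : ∫ x, (ξ n x + (1 + k x)) ^ 2 ∂P ≤ 6 + H := by
        have : ∫ x, (ξ n x + (1 + k x)) ^ 2 ∂P ≤ ∫ x, (2 * ξ n x ^ 2 + 4 + h x ^ 2) ∂P := by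
          refine integral_mono l2.integrable_sq (((r1.integrable_sq.const_mul 2).add
            (integrable_const 4)).add hQ.memLp.integrable_sq) fun x => ?_
          dsimp only
          have : k x ^ 2 ≤ h x ^ 2 / 4 := by
            simp only [hk, div_pow, mul_pow, hs]
            exact div_le_div_of_nonneg_left (sq_nonneg _) (by norm_num) (by linarith)
          nlinarith [sq_nonneg (ξ n x - (1 + k x)), sq_nonneg (1 - k x)]
        rw [integral_add ((r1.integrable_sq.const_mul 2).fun_add (integrable_const 4))
          hQ.memLp.integrable_sq, integral_add (r1.integrable_sq.const_mul 2) (integrable_const 4),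
          integral_const_mul] at this
        have h1 := r1.integral_sq_le_one
        simp at this
        linarith
      have c3 : Real.sqrt (E n) =
          Real.sqrt n * Real.sqrt (∫ x, (ξ n x - 1 - k x) ^ 2 ∂P) := by
        simp only [hE]; rw [Real.sqrt_mul hn.le]
      have c4 : Real.sqrt n * ∫ x, k x ^ 2 ∂P = H / (4 * Real.sqrt n) := by
        have : ∀ x, k x ^ 2 = h x ^ 2 * (1 / (4 * n)) := fun x => by
          simp only [hk, div_pow, mul_pow, hs]; ring
        simp_rw [this]
        rw [integral_mul_const, ← hH]
        field_simp
        rw [hs, mul_comm]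
      rw [c3, c4, mul_assoc]
      gcongr
      exact c1.trans (mul_le_mul_of_nonneg_left (Real.sqrt_le_sqrt c2) (Real.sqrt_nonneg _))
    have e5 : Real.sqrt n * (∫ x, f x ∂(Q n) - ∫ x, f x ∂P) - ∫ x, f x * h x ∂P =
        Real.sqrt n * (∫ x, f x ∂(Q n) - ∫ x, ξ n x ^ 2 * f x ∂P) +
        (Real.sqrt n * (∫ x, ξ n x ^ 2 * f x ∂P - ∫ x, f x ∂P) - ∫ x, f x * h x ∂P) := by ring
    rw [e5]
    refine (abs_add_le _ _).trans ?_
    have h6 : |Real.sqrt n * (∫ x, f x ∂(Q n) - ∫ x, ξ n x ^ 2 * f x ∂P)| ≤ C * m n := by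
      rw [abs_mul, abs_of_pos hs0]
      have h1 := r1.integral_sq_le_one
      have h2 : 0 ≤ C * (1 - ∫ x, ξ n x ^ 2 ∂P) := mul_nonneg hC (by linarith)
      calc _ ≤ n * (C * (1 - ∫ x, ξ n x ^ 2 ∂P)) :=
            mul_le_mul hsn s1 (abs_nonneg _) hn.le
        _ = C * m n := by simp only [m]; ring
    linarith

end IsQMD

/-! ### Tilting by bounded densities -/

lemma sqrt_one_add_bound {y : ℝ} (hy : |y| ≤ 1) :
    |Real.sqrt (1 + y) - 1 - y / 2| ≤ y ^ 2 / 2 := by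
  have h0 : 0 ≤ 1 + y := by linarith [(abs_le.1 hy).1]
  set s := Real.sqrt (1 + y)
  have hs : s ^ 2 = 1 + y := Real.sq_sqrt h0
  have hs0 : 0 ≤ s := Real.sqrt_nonneg _
  have e1 : s - 1 - y / 2 = -((s - 1) ^ 2 / 2) := by nlinarith
  have e2 : y ^ 2 = (s - 1) ^ 2 * (s + 1) ^ 2 := by
    have : y = (s - 1) * (s + 1) := by nlinarith
    rw [this]; ring
  rw [e1, abs_neg, abs_of_nonneg (by positivity), e2]
  have : 1 ≤ (s + 1) ^ 2 := by nlinarith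
  nlinarith [sq_nonneg (s - 1)]

/-- In the application `k` is `h / (2 √n)`, `y` is the tilting function `w / √n`, and `d` is half
the scaled error of `w` as an approximation of its limit, so that `k + (y / 2 - d)` is half the new
scaled tangent. The four terms are the old error times `√(1 + y)`, the second order remainder of the
square root, the cross term `k y / 2`, and `d`. The two in the middle are small because `ε` is. -/
lemma tilt_err_pointwise {ξ k y d ε : ℝ} (hy : |y| ≤ ε) (hε : ε ≤ 1 / 2) :
    (ξ * Real.sqrt (1 + y) - 1 - (k + (y / 2 - d))) ^ 2 ≤
      8 * (ξ - 1 - k) ^ 2 + 2 * ε ^ 2 * y ^ 2 + 3 * ε ^ 2 * k ^ 2 + 4 * d ^ 2 := by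
  have hb := sqrt_one_add_bound (y := y) (by linarith)
  have h0 : 0 ≤ 1 + y := by linarith [(abs_le.1 hy).1]
  have hs2 : Real.sqrt (1 + y) ^ 2 ≤ 2 := by
    rw [Real.sq_sqrt h0]; linarith [(abs_le.1 hy).2]
  set s := Real.sqrt (1 + y)
  set t := s - 1 - y / 2
  have e : ξ * s - 1 - (k + (y / 2 - d)) = (ξ - 1 - k) * s + (1 + k) * t + k * y / 2 + d := by
    simp only [t]; ring
  have hy2 : y ^ 2 ≤ ε ^ 2 := sq_le_sq' (by linarith [(abs_le.1 hy).1]) (abs_le.1 hy).2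
  have ht2 : t ^ 2 ≤ y ^ 4 / 4 := by
    have := sq_le_sq' (abs_le.1 hb).1 (abs_le.1 hb).2
    calc t ^ 2 ≤ (y ^ 2 / 2) ^ 2 := this
      _ = y ^ 4 / 4 := by ring
  have hy4 : y ^ 4 ≤ ε ^ 2 * y ^ 2 := by nlinarith [sq_nonneg y]
  have hε2 : ε ^ 2 ≤ 1 := by
    have : 0 ≤ ε := (abs_nonneg y).trans hy
    nlinarith
  have hy4' : y ^ 4 ≤ ε ^ 2 := by nlinarith [sq_nonneg y]
  have a1 : ((ξ - 1 - k) * s) ^ 2 ≤ 2 * (ξ - 1 - k) ^ 2 := by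
    rw [mul_pow]; nlinarith [sq_nonneg (ξ - 1 - k)]
  have a2 : ((1 + k) * t) ^ 2 ≤ ε ^ 2 * y ^ 2 / 2 + ε ^ 2 * k ^ 2 / 2 := by
    have b1 : (1 + k) ^ 2 ≤ 2 + 2 * k ^ 2 := by nlinarith [sq_nonneg (1 - k)]
    calc ((1 + k) * t) ^ 2 = (1 + k) ^ 2 * t ^ 2 := by ring
      _ ≤ (2 + 2 * k ^ 2) * (y ^ 4 / 4) := by gcongr
      _ = y ^ 4 / 2 + y ^ 4 * k ^ 2 / 2 := by ring
      _ ≤ ε ^ 2 * y ^ 2 / 2 + ε ^ 2 * k ^ 2 / 2 := by gcongr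
  have a3 : (k * y / 2) ^ 2 ≤ ε ^ 2 * k ^ 2 / 4 := by nlinarith [sq_nonneg k]
  rw [e]
  set A := (ξ - 1 - k) * s
  set B := (1 + k) * t
  set C := k * y / 2
  have : (A + B + C + d) ^ 2 ≤ 4 * (A ^ 2 + B ^ 2 + C ^ 2 + d ^ 2) := by
    have e : 4 * (A ^ 2 + B ^ 2 + C ^ 2 + d ^ 2) - (A + B + C + d) ^ 2 = (A - B) ^ 2 +
      (A - C) ^ 2 + (A - d) ^ 2 + (B - C) ^ 2 + (B - d) ^ 2 + (C - d) ^ 2 := by ring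
    have : 0 ≤ (A - B) ^ 2 +
      (A - C) ^ 2 + (A - d) ^ 2 + (B - C) ^ 2 + (B - d) ^ 2 + (C - d) ^ 2 := by positivity
    linarith
  linarith

/-- The measure with density `1 + w / √n`. -/
def tilt (Q : Measure Ω) (w : Ω → ℝ) (n : ℕ) : Measure Ω :=
  Q.withDensity fun x => ENNReal.ofReal (1 + w x / Real.sqrt n)

lemma abs_div_sqrt_le {w K : ℝ} (h : |w| ≤ K) (n : ℕ) : |w / Real.sqrt n| ≤ K / Real.sqrt n := by
  rw [abs_div, abs_of_nonneg (Real.sqrt_nonneg _)]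
  exact div_le_div_of_nonneg_right h (Real.sqrt_nonneg _)

lemma tilt_isProbabilityMeasure {Q : Measure Ω} [IsProbabilityMeasure Q] {w : Ω → ℝ}
    (hw : Measurable w) {n : ℕ} (hb : ∀ x, |w x / Real.sqrt n| ≤ 1) (h0 : ∫ x, w x ∂Q = 0) :
    IsProbabilityMeasure (tilt Q w n) := by
  have hm : Measurable fun x => w x / Real.sqrt n := hw.div_const _
  have hi : Integrable (fun x => w x / Real.sqrt n) Q :=
    Integrable.of_bound hm.aestronglyMeasurable 1 (ae_of_all _ hb)
  have hi1 : Integrable (fun x => 1 + w x / Real.sqrt n) Q := (integrable_const _).add hi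
  constructor
  rw [tilt, withDensity_apply _ MeasurableSet.univ, Measure.restrict_univ,
    ← ofReal_integral_eq_lintegral_ofReal hi1
      (ae_of_all _ fun x => by have := (abs_le.1 (hb x)).1; simp only [Pi.zero_apply]; linarith),
    integral_add (integrable_const _) hi, integral_div, h0]
  simp

lemma integral_tilt {Q : Measure Ω} {w : Ω → ℝ}
    (hw : Measurable w) {n : ℕ} (hb : ∀ x, |w x / Real.sqrt n| ≤ 1) (f : Ω → ℝ) :
    ∫ x, f x ∂(tilt Q w n) = ∫ x, (1 + w x / Real.sqrt n) * f x ∂Q :=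
  integral_withDensity_ofReal (f := fun x => 1 + w x / Real.sqrt n)
    (measurable_const.add (hw.div_const _)) (fun x => by linarith [(abs_le.1 (hb x)).1]) f

/-- Multiplying roots adds tangents up to second order terms. The bounds `K n` may grow as long as
they are `o(√n)`; this allows an unbounded `w₀` to be approached by truncations. -/
lemma IsQMD.tilt {P : Measure Ω} [IsProbabilityMeasure P] {Q : ℕ → Measure Ω} {h : Ω → ℝ}
    {ξ : ℕ → Ω → ℝ} (hQ : IsQMD P Q h ξ) {w : ℕ → Ω → ℝ} {w₀ : Ω → ℝ}
    (hw : ∀ n, Measurable (w n)) {K : ℕ → ℝ} (hK : ∀ᶠ n in atTop, ∀ x, |w n x| ≤ K n)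
    (hK0 : Tendsto (fun n : ℕ => K n / Real.sqrt n) atTop (𝓝 0)) (hw₀ : MemLp w₀ 2 P)
    (hlim : Tendsto (fun n => ∫ x, (w n x - w₀ x) ^ 2 ∂P) atTop (𝓝 0))
    (hint : ∀ᶠ n in atTop, ∫ x, w n x ∂(Q n) = 0) :
    IsQMD P (fun n => RobustTest.tilt (Q n) (w n) n) (fun x => h x + w₀ x)
      (fun n x => ξ n x * Real.sqrt (1 + w n x / Real.sqrt n)) := by
  have hsmall : ∀ᶠ n : ℕ in atTop, ∀ x, |w n x / Real.sqrt n| ≤ 1 / 2 := by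
    filter_upwards [hK, hK0.eventually_le_const (by norm_num : (0 : ℝ) < 1 / 2)] with n h1 h2 x
    exact (abs_div_sqrt_le (h1 x) n).trans h2
  have hroot : ∀ᶠ n : ℕ in atTop, IsRoot P (RobustTest.tilt (Q n) (w n) n)
      (fun x => ξ n x * Real.sqrt (1 + w n x / Real.sqrt n)) := by
    filter_upwards [hQ.root, hsmall] with n hr hs
    have hm : Measurable fun x => 1 + w n x / Real.sqrt n :=
      measurable_const.add ((hw n).div_const _)
    refine ⟨hr.1.mul hm.sqrt, fun x => mul_nonneg (hr.2.1 x) (Real.sqrt_nonneg _), ?_⟩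
    have : P.withDensity (fun x => ENNReal.ofReal
        ((ξ n x * Real.sqrt (1 + w n x / Real.sqrt n)) ^ 2)) =
        (P.withDensity fun x => ENNReal.ofReal (ξ n x ^ 2)).withDensity
          fun x => ENNReal.ofReal (1 + w n x / Real.sqrt n) := by
      rw [← withDensity_mul _ (hr.1.pow_const 2).ennreal_ofReal hm.ennreal_ofReal]
      congr 1; ext x
      rw [Pi.mul_apply, ← ENNReal.ofReal_mul (sq_nonneg _), mul_pow, Real.sq_sqrt]
      linarith [(abs_le.1 (hs x)).1]
    rw [this]
    refine Measure.le_iff.2 fun s hs => ?_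
    rw [RobustTest.tilt, withDensity_apply _ hs, withDensity_apply _ hs]
    exact lintegral_mono' (Measure.restrict_mono le_rfl hr.2.2) le_rfl
  have hprob : ∀ᶠ n : ℕ in atTop, IsProbabilityMeasure (RobustTest.tilt (Q n) (w n) n) := by
    filter_upwards [hQ.prob, hsmall, hint] with n hp hs hi
    exact tilt_isProbabilityMeasure (hw n) (fun x => (hs x).trans (by norm_num)) hi
  have hwL : ∀ᶠ n in atTop, MemLp (w n) 2 P := by
    filter_upwards [hK] with n hn
    exact MemLp.of_bound (hw n).aestronglyMeasurable (K n) (ae_of_all _ hn)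
  refine ⟨hprob, hroot, hQ.memLp.add hw₀, ?_, ?_⟩
  · set E : ℕ → ℝ := fun n => (n : ℝ) * ∫ x, (ξ n x - 1 - h x / (2 * Real.sqrt n)) ^ 2 ∂P with hE
    set ε : ℕ → ℝ := fun n => K n / Real.sqrt n with hε
    set D : ℕ → ℝ := fun n => ∫ x, (w n x - w₀ x) ^ 2 ∂P with hD
    set W := ∫ x, w₀ x ^ 2 ∂P
    set H := ∫ x, h x ^ 2 ∂P
    have hlim : Tendsto (fun n => 8 * E n + 2 * ε n ^ 2 * (2 * D n + 2 * W) + ε n ^ 2 * H + D n)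
        atTop (𝓝 0) := by
      have h1 := (((hQ.err.const_mul 8).add (((hK0.pow 2).const_mul 2).mul
        ((hlim.const_mul 2).add_const (2 * W)))).add ((hK0.pow 2).mul_const H)).add hlim
      simpa using h1
    refine squeeze_zero' (Eventually.of_forall fun n => mul_nonneg n.cast_nonneg
      (integral_nonneg fun x => sq_nonneg _)) ?_ hlim
    filter_upwards [hQ.prob, hQ.root, hK, eventually_natCast_pos, hwL, hroot, hprob,
      hK0.eventually_le_const (by norm_num : (0 : ℝ) < 1 / 2)] with n hp hr hKn hn hwn hrt hpt hKs
    have hs : Real.sqrt n ^ 2 = n := Real.sq_sqrt hn.le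
    have hs0 : 0 < Real.sqrt n := Real.sqrt_pos.2 hn
    have i1 := (hQ.memLp_err hr).integrable_sq
    have i2 := (hwn.sub hw₀).integrable_sq
    simp only [Pi.sub_apply] at i2
    have i3 := hw₀.integrable_sq
    have i4 := hQ.memLp.integrable_sq
    have i0 : Integrable (fun x => (ξ n x * Real.sqrt (1 + w n x / Real.sqrt n) - 1 -
        (h x + w₀ x) / (2 * Real.sqrt n)) ^ 2) P :=
      ((hrt.memLp.sub (memLp_const 1)).sub (memLp_div_const (hQ.memLp.add hw₀) _)).integrable_sq
    have hle : ∫ x, (n : ℝ) * (ξ n x * Real.sqrt (1 + w n x / Real.sqrt n) - 1 -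
        (h x + w₀ x) / (2 * Real.sqrt n)) ^ 2 ∂P ≤
        ∫ x, (8 * ((n : ℝ) * (ξ n x - 1 - h x / (2 * Real.sqrt n)) ^ 2) +
          2 * ε n ^ 2 * (2 * (w n x - w₀ x) ^ 2 + 2 * w₀ x ^ 2) + ε n ^ 2 * h x ^ 2 +
          (w n x - w₀ x) ^ 2) ∂P := by
      refine integral_mono (i0.const_mul _) (((((i1.const_mul _).const_mul _).add
        (((i2.const_mul _).add (i3.const_mul _)).const_mul _)).add (i4.const_mul _)).add i2)
        fun x => ?_
      have hpt := tilt_err_pointwise (ξ := ξ n x) (k := h x / (2 * Real.sqrt n))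
        (d := (w n x - w₀ x) / (2 * Real.sqrt n)) (abs_div_sqrt_le (hKn x) n) hKs
      have e1 : h x / (2 * Real.sqrt n) + (w n x / Real.sqrt n / 2 -
          (w n x - w₀ x) / (2 * Real.sqrt n)) = (h x + w₀ x) / (2 * Real.sqrt n) := by
        field_simp; ring
      rw [e1] at hpt
      have e2 : (n : ℝ) * (w n x / Real.sqrt n) ^ 2 = w n x ^ 2 := by
        rw [div_pow, hs]; field_simp
      have e3 : (n : ℝ) * (h x / (2 * Real.sqrt n)) ^ 2 = h x ^ 2 / 4 := by
        rw [div_pow, mul_pow, hs]; field_simp; norm_num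
      have e4 : (n : ℝ) * ((w n x - w₀ x) / (2 * Real.sqrt n)) ^ 2 = (w n x - w₀ x) ^ 2 / 4 := by
        rw [div_pow, mul_pow, hs]; field_simp; norm_num
      have hpt' := mul_le_mul_of_nonneg_left hpt hn.le
      dsimp only
      refine hpt'.trans ?_
      have e5 : (n : ℝ) * (8 * (ξ n x - 1 - h x / (2 * Real.sqrt n)) ^ 2 +
          2 * (K n / Real.sqrt n) ^ 2 * (w n x / Real.sqrt n) ^ 2 +
          3 * (K n / Real.sqrt n) ^ 2 * (h x / (2 * Real.sqrt n)) ^ 2 +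
          4 * ((w n x - w₀ x) / (2 * Real.sqrt n)) ^ 2) =
          8 * ((n : ℝ) * (ξ n x - 1 - h x / (2 * Real.sqrt n)) ^ 2) +
          2 * ε n ^ 2 * w n x ^ 2 + 3 * ε n ^ 2 * (h x ^ 2 / 4) + (w n x - w₀ x) ^ 2 := by
        rw [← e2, ← e3]
        have : (w n x - w₀ x) ^ 2 = 4 * ((n : ℝ) * ((w n x - w₀ x) / (2 * Real.sqrt n)) ^ 2) := by
          rw [e4]; ring
        rw [this]; simp only [hε]; ring
      rw [e5]
      have e6 : w n x ^ 2 ≤ 2 * (w n x - w₀ x) ^ 2 + 2 * w₀ x ^ 2 := by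
        nlinarith [sq_nonneg (w n x - w₀ x - w₀ x)]
      have e7 : 2 * ε n ^ 2 * w n x ^ 2 ≤ 2 * ε n ^ 2 * (2 * (w n x - w₀ x) ^ 2 + 2 * w₀ x ^ 2) :=
        mul_le_mul_of_nonneg_left e6 (by positivity)
      have e8 : 0 ≤ ε n ^ 2 * h x ^ 2 := by positivity
      linarith
    rw [integral_const_mul, integral_add ((((i1.const_mul _).const_mul _).fun_add
        (((i2.const_mul _).fun_add (i3.const_mul _)).const_mul _)).fun_add (i4.const_mul _)) i2,
      integral_add (((i1.const_mul _).const_mul _).fun_add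
        (((i2.const_mul _).fun_add (i3.const_mul _)).const_mul _)) (i4.const_mul _),
      integral_add ((i1.const_mul _).const_mul _)
        (((i2.const_mul _).fun_add (i3.const_mul _)).const_mul _),
      integral_const_mul, integral_const_mul, integral_const_mul,
      integral_add (i2.const_mul _) (i3.const_mul _), integral_const_mul, integral_const_mul,
      integral_const_mul] at hle
    exact hle
  · have h2 := hQ.mass.const_mul 2
    rw [mul_zero] at h2
    refine tendsto_of_tendsto_of_tendsto_of_le_of_le' tendsto_const_nhds h2 ?_ ?_
    · filter_upwards [hroot, hprob] with n hr hp
      exact mul_nonneg n.cast_nonneg (sub_nonneg.2 hr.integral_sq_le_one)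
    · filter_upwards [hQ.prob, hQ.root, hsmall, hprob] with n hp hr hs hpt
      have hm : Measurable fun x => 1 + w n x / Real.sqrt n :=
        measurable_const.add ((hw n).div_const _)
      -- Half the tilting density is a test; hence the mass orthogonal to `P` at most doubles.
      have ht : IsTest fun x => (1 + w n x / Real.sqrt n) / 2 :=
        ⟨hm.div_const 2, fun x => by
          have := abs_le.1 (hs x); constructor <;> linarith [this.1, this.2]⟩
      have h3 := (hr.integral_sub ht).2
      have e1 : ∫ x, (1 + w n x / Real.sqrt n) / 2 ∂(Q n) = 1 / 2 := by
        have := integral_tilt (Q := Q n) (hw n) (fun x => (hs x).trans (by norm_num)) 1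
        simp only [Pi.one_apply, mul_one, integral_const, probReal_univ, smul_eq_mul] at this
        rw [integral_div, ← this]
      have e2 : ∫ x, ξ n x ^ 2 * ((1 + w n x / Real.sqrt n) / 2) ∂P =
          (∫ x, (ξ n x * Real.sqrt (1 + w n x / Real.sqrt n)) ^ 2 ∂P) / 2 := by
        rw [← integral_div]
        refine integral_congr_ae (ae_of_all _ fun x => ?_)
        dsimp only
        rw [mul_pow, Real.sq_sqrt (by linarith [(abs_le.1 (hs x)).1]), mul_div_assoc]
      rw [e1, e2] at h3
      nlinarith [n.cast_nonneg (α := ℝ)]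

/-! ### The standard normal distribution function -/

lemma Phi_eq (x : ℝ) : Phi x = (gaussianReal 0 1).real (Set.Iic x) := cdf_eq_real _ x

lemma gaussianReal_singleton (x : ℝ) : gaussianReal 0 1 {x} = 0 := by
  have := nullSingletonClass_gaussianReal (μ := 0) (v := 1) one_ne_zero
  exact measure_singleton x

lemma Phi_continuous : Continuous Phi := by
  refine continuous_iff_continuousAt.2 fun x => ?_
  have hm : Monotone (cdf (gaussianReal 0 1)) := monotone_cdf _
  refine (hm.continuousAt_iff_leftLim_eq_rightLim (x := x)).2 ?_
  have h1 := (cdf (gaussianReal 0 1)).measure_singleton x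
  rw [measure_cdf, gaussianReal_singleton] at h1
  have h2 := ENNReal.ofReal_eq_zero.1 h1.symm
  have h3 := hm.leftLim_le (le_refl x)
  rw [(cdf (gaussianReal 0 1)).rightLim_eq x]
  linarith

lemma Phi_strictMono : StrictMono Phi := by
  intro a b hab
  have h1 := (cdf (gaussianReal 0 1)).measure_Ioc a b
  rw [measure_cdf] at h1
  by_contra hle
  have h2 : gaussianReal 0 1 (Set.Ioc a b) = 0 := by
    rw [h1, ENNReal.ofReal_eq_zero]
    simp only [Phi] at hle
    linarith
  have h3 := gaussianReal_absolutelyContinuous' 0 (v := 1) one_ne_zero h2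
  simp at h3
  linarith

lemma gaussianReal_Ioi {s : ℝ} (hs : 0 < s) (a : ℝ) :
    (gaussianReal 0 (s ^ 2).toNNReal).real (Set.Ioi a) = Phi (-a / s) := by
  have h := gaussianReal_map_const_mul (μ := 0) (v := 1) (-s)
  have h1 : (NNReal.mk ((-s) ^ 2) (sq_nonneg _) * 1 : ℝ≥0) = (s ^ 2).toNNReal := by
    ext; simp [Real.coe_toNNReal _ (sq_nonneg s)]
  rw [h1, mul_zero] at h
  rw [← h, map_measureReal_apply (by fun_prop) measurableSet_Ioi, Phi_eq]
  have h2 : (fun x => -s * x) ⁻¹' Set.Ioi a = Set.Iio (-a / s) := by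
    ext x
    simp only [Set.mem_preimage, Set.mem_Ioi, Set.mem_Iio]
    rw [lt_div_iff₀ hs]
    constructor <;> intro h <;> linarith
  rw [h2, ← Set.Iio_union_right, measureReal_union (by simp) (measurableSet_singleton _)]
  simp [measureReal_def, gaussianReal_singleton]

/-! ### Central limit theorem for triangular arrays of bounded summands -/

/-- The standardized sum `n^{-1/2} ∑ f(xᵢ)`. -/
def normSum (f : Ω → ℝ) (n : ℕ) (x : Fin n → Ω) : ℝ := 1 / Real.sqrt n * ∑ i, f (x i)

lemma measurable_normSum {f : Ω → ℝ} (hf : Measurable f) (n : ℕ) : Measurable (normSum f n) :=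
  (Finset.measurable_fun_sum _ fun i _ => hf.comp (measurable_pi_apply i)).const_mul _

lemma charFun_normSum (Q : Measure Ω) [IsProbabilityMeasure Q] {f : Ω → ℝ} (hf : Measurable f)
    (n : ℕ) (t : ℝ) :
    charFun ((iid Q n).map (normSum f n)) t =
      (∫ x, Complex.exp ((t * f x / Real.sqrt n : ℝ) * Complex.I) ∂Q) ^ n := by
  rw [charFun_apply_real, integral_map (measurable_normSum hf n).aemeasurable
    (by fun_prop)]
  have h := integral_fintype_prod_eq_pow (ι := Fin n) (μ := Q)
    (fun x => Complex.exp ((t * f x / Real.sqrt n : ℝ) * Complex.I))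
  rw [Fintype.card_fin] at h
  rw [← h]
  refine integral_congr_ae (ae_of_all _ fun x => ?_)
  dsimp only
  rw [← Complex.exp_sum]
  congr 1
  rw [normSum, ← Finset.sum_mul, ← Complex.ofReal_sum, ← Complex.ofReal_mul]
  congr 2
  rw [Finset.mul_sum, Finset.mul_sum]
  exact Finset.sum_congr rfl fun i _ => by ring

lemma norm_exp_I_sub_le {y : ℝ} (hy : |y| ≤ 1) :
    ‖Complex.exp (y * Complex.I) - (1 + y * Complex.I - y ^ 2 / 2)‖ ≤ |y| ^ 3 := by
  have hn : ‖(y : ℂ) * Complex.I‖ = |y| := by simp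
  have h := Complex.exp_bound (x := y * Complex.I) (by rw [hn]; exact hy) (n := 3) (by norm_num)
  have e : ∑ m ∈ Finset.range 3, ((y : ℂ) * Complex.I) ^ m / (m.factorial : ℂ) =
      1 + y * Complex.I - y ^ 2 / 2 := by
    simp [Finset.sum_range_succ, mul_pow, Complex.I_sq]
    ring
  rw [e, hn] at h
  refine h.trans ?_
  have : 0 ≤ |y| ^ 3 := by positivity
  norm_num [Nat.factorial]
  linarith

/-- The law of the summands changes with `n`, so this is a triangular array. One factor of the
characteristic function is `1 + g n` with `n g n → -v t² / 2`: the mean vanishes, and boundedness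
makes the cubic remainder `O(1 / √n)` even after multiplication by `n`. -/
lemma tendsto_charFun_normSum {Q : ℕ → Measure Ω} [∀ n, IsProbabilityMeasure (Q n)]
    {f : ℕ → Ω → ℝ} (hf : ∀ n, Measurable (f n)) {C : ℝ} (hC : ∀ n x, |f n x| ≤ C)
    (h0 : ∀ n, ∫ x, f n x ∂(Q n) = 0) {v : ℝ}
    (hv : Tendsto (fun n => ∫ x, f n x ^ 2 ∂(Q n)) atTop (𝓝 v)) (t : ℝ) :
    Tendsto (fun n => charFun ((iid (Q n) n).map (normSum (f n) n)) t) atTop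
      (𝓝 (Complex.exp (-(v * t ^ 2 / 2 : ℝ)))) := by
  simp_rw [charFun_normSum _ (hf _)]
  set g : ℕ → ℂ := fun n =>
    ∫ x, Complex.exp ((t * f n x / Real.sqrt n : ℝ) * Complex.I) ∂(Q n) - 1 with hg
  have hgn : ∀ n, ∫ x, Complex.exp ((t * f n x / Real.sqrt n : ℝ) * Complex.I) ∂(Q n) =
      1 + g n := fun n => by simp [hg]
  simp_rw [hgn]
  refine Complex.tendsto_one_add_pow_exp_of_tendsto ?_
  have hC0 : ∀ x : Ω, 0 ≤ C := fun x => (abs_nonneg _).trans (hC 0 x)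
  have hbound : ∀ᶠ n : ℕ in atTop,
      ‖n * g n - ((-(t ^ 2 * ∫ x, f n x ^ 2 ∂(Q n)) / 2 : ℝ) : ℂ)‖ ≤
        (|t| * |C|) ^ 3 / Real.sqrt n := by
    have hs := tendsto_sqrt_natCast.eventually_ge_atTop (|t| * |C|)
    filter_upwards [hs, eventually_natCast_pos] with n hn1 hn
    have hs : Real.sqrt n ^ 2 = n := Real.sq_sqrt hn.le
    have hs0 : 0 < Real.sqrt n := Real.sqrt_pos.2 hn
    set y : Ω → ℝ := fun x => t * f n x / Real.sqrt n with hy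
    have hym : Measurable y := ((hf n).const_mul t).div_const _
    have hyb : ∀ x, |y x| ≤ |t| * |C| / Real.sqrt n := fun x => by
      rw [hy]; dsimp only
      rw [abs_div, abs_of_pos hs0, abs_mul]
      exact div_le_div_of_nonneg_right (mul_le_mul_of_nonneg_left
        ((hC n x).trans (le_abs_self C)) (abs_nonneg t)) hs0.le
    have hy1 : ∀ x, |y x| ≤ 1 := fun x => (hyb x).trans ((div_le_one hs0).2 hn1)
    have iy : Integrable y (Q n) := Integrable.of_bound hym.aestronglyMeasurable 1 (ae_of_all _ hy1)
    have iy2 : Integrable (fun x => y x ^ 2) (Q n) :=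
      Integrable.of_bound (hym.pow_const 2).aestronglyMeasurable 1 (ae_of_all _ fun x => by
        rw [norm_pow, Real.norm_eq_abs]; exact pow_le_one₀ (abs_nonneg _) (hy1 x))
    have iE : Integrable (fun x => Complex.exp (y x * Complex.I)) (Q n) :=
      Integrable.of_bound (by fun_prop) 1
        (ae_of_all _ fun x => by rw [Complex.norm_exp_ofReal_mul_I])
    have ey : ∫ x, y x ∂(Q n) = 0 := by
      simp only [hy]
      rw [integral_div, integral_const_mul, h0]; simp
    have ey2 : n * ∫ x, y x ^ 2 ∂(Q n) = t ^ 2 * ∫ x, f n x ^ 2 ∂(Q n) := by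
      rw [← integral_const_mul, ← integral_const_mul]
      refine integral_congr_ae (ae_of_all _ fun x => ?_)
      simp only [hy, div_pow, mul_pow, hs]
      field_simp
    have iyc : Integrable (fun x => (y x : ℂ)) (Q n) := iy.ofReal
    have iyc2 : Integrable (fun x => (y x : ℂ) ^ 2) (Q n) := by
      simpa using (iy2.ofReal (𝕜 := ℂ))
    have iA : Integrable (fun x => (1 + y x * Complex.I - (y x : ℂ) ^ 2 / 2)) (Q n) :=
      ((integrable_const _).add (iyc.mul_const _)).sub (iyc2.div_const _)
    have eA : ∫ x, (1 + y x * Complex.I - (y x : ℂ) ^ 2 / 2) ∂(Q n) =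
        1 - ((∫ x, y x ^ 2 ∂(Q n) : ℝ) : ℂ) / 2 := by
      rw [integral_sub (by exact (integrable_const _).add (iyc.mul_const _)) (iyc2.div_const _),
        integral_add (integrable_const _) (iyc.mul_const _), integral_mul_const, integral_complex_ofReal,
        ey, integral_div]
      have : ∫ x, (y x : ℂ) ^ 2 ∂(Q n) = ((∫ x, y x ^ 2 ∂(Q n) : ℝ) : ℂ) := by
        rw [← integral_complex_ofReal]; simp
      rw [this]
      simp
    have e1 : n * g n - ((-(t ^ 2 * ∫ x, f n x ^ 2 ∂(Q n)) / 2 : ℝ) : ℂ) =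
        n * ∫ x, (Complex.exp (y x * Complex.I) -
          (1 + y x * Complex.I - (y x : ℂ) ^ 2 / 2)) ∂(Q n) := by
      rw [integral_sub iE iA, eA, ← ey2]
      simp only [hg, hy]
      push_cast
      ring
    rw [e1, norm_mul]
    have e2 : ‖∫ x, (Complex.exp (y x * Complex.I) -
          (1 + y x * Complex.I - (y x : ℂ) ^ 2 / 2)) ∂(Q n)‖ ≤ (|t| * |C| / Real.sqrt n) ^ 3 := by
      refine (norm_integral_le_of_norm_le_const (C := (|t| * |C| / Real.sqrt n) ^ 3)
        (ae_of_all _ fun x => ?_)).trans (by simp)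
      exact (norm_exp_I_sub_le (hy1 x)).trans (pow_le_pow_left₀ (abs_nonneg _) (hyb x) 3)
    calc ‖(n : ℂ)‖ * _ ≤ n * (|t| * |C| / Real.sqrt n) ^ 3 := by
          rw [Complex.norm_natCast]; gcongr
      _ = (|t| * |C|) ^ 3 / Real.sqrt n := by
          rw [div_pow, pow_succ (Real.sqrt n), hs]; field_simp
  have hlim : Tendsto (fun n : ℕ => ((-(t ^ 2 * ∫ x, f n x ^ 2 ∂(Q n)) / 2 : ℝ) : ℂ)) atTop
      (𝓝 (-(v * t ^ 2 / 2 : ℝ))) := by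
    have := ((hv.const_mul (t ^ 2)).neg.div_const 2)
    have h2 := (Complex.continuous_ofReal.tendsto _).comp this
    have h3 : ((-(t ^ 2 * v) / 2 : ℝ) : ℂ) = -(v * t ^ 2 / 2 : ℝ) := by push_cast; ring
    rw [h3] at h2
    exact h2
  have hz : Tendsto (fun n : ℕ => n * g n - ((-(t ^ 2 * ∫ x, f n x ^ 2 ∂(Q n)) / 2 : ℝ) : ℂ))
      atTop (𝓝 0) :=
    squeeze_zero_norm' hbound (tendsto_sqrt_natCast.const_div_atTop _)
  simpa using hz.add hlim

lemma tendsto_real_normSum_of_centered {Q : ℕ → Measure Ω} [∀ n, IsProbabilityMeasure (Q n)]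
    {f : ℕ → Ω → ℝ} (hf : ∀ n, Measurable (f n)) {C : ℝ} (hC : ∀ n x, |f n x| ≤ C)
    (h0 : ∀ n, ∫ x, f n x ∂(Q n) = 0) {s : ℝ} (hs : 0 < s)
    (hv : Tendsto (fun n => ∫ x, f n x ^ 2 ∂(Q n)) atTop (𝓝 (s ^ 2))) (a : ℝ) :
    Tendsto (fun n => (iid (Q n) n).real {x | a < normSum (f n) n x}) atTop
      (𝓝 (Phi (-a / s))) := by
  have hp : ∀ n, IsProbabilityMeasure ((iid (Q n) n).map (normSum (f n) n)) := fun n =>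
    Measure.isProbabilityMeasure_map (measurable_normSum (hf n) n).aemeasurable
  set μ : ℕ → ProbabilityMeasure ℝ := fun n => ⟨(iid (Q n) n).map (normSum (f n) n), hp n⟩
  set v : ℝ≥0 := (s ^ 2).toNNReal with hv_def
  have hv0 : v ≠ 0 := by
    simp [hv_def, hs.ne']
  set ν : ProbabilityMeasure ℝ := ⟨gaussianReal 0 v, inferInstance⟩
  have hlim : Tendsto μ atTop (𝓝 ν) := by
    refine ProbabilityMeasure.tendsto_of_tendsto_charFun fun t => ?_
    have h1 := tendsto_charFun_normSum hf hC h0 hv t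
    have h2 : charFun (ν : Measure ℝ) t = Complex.exp (-(s ^ 2 * t ^ 2 / 2 : ℝ)) := by
      change charFun (gaussianReal 0 v) t = _
      rw [charFun_gaussianReal]
      simp [hv_def, Real.coe_toNNReal _ (sq_nonneg s)]
    rw [h2]
    exact h1
  have hfr : (ν : Measure ℝ) (frontier (Set.Ioi a)) = 0 := by
    have := nullSingletonClass_gaussianReal (μ := 0) hv0
    rw [frontier_Ioi]
    exact measure_singleton (μ := gaussianReal 0 v) a
  have h3 := ProbabilityMeasure.tendsto_measure_of_null_frontier_of_tendsto' hlim hfr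
  have h4 := (ENNReal.tendsto_toReal (measure_ne_top _ _)).comp h3
  have h5 : ((ν : Measure ℝ) (Set.Ioi a)).toReal = Phi (-a / s) := gaussianReal_Ioi hs a
  rw [h5] at h4
  refine h4.congr fun n => ?_
  change ((iid (Q n) n).map (normSum (f n) n)).real (Set.Ioi a) = _
  rw [map_measureReal_apply (measurable_normSum (hf n) n) measurableSet_Ioi]
  rfl

/-! ### Upper and lower limits of bounded sequences -/

/-- Real limits superior and inferior are meaningful only for bounded sequences; this and the
following lemmas exchange them for statements with `ε`, using that probabilities lie in `[0, 1]`. -/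
lemma limsup_le_of_forall {x : ℕ → ℝ} {a : ℝ} (h0 : ∀ᶠ n in atTop, 0 ≤ x n)
    (h : ∀ ε > 0, ∀ᶠ n in atTop, x n ≤ a + ε) : limsup x atTop ≤ a :=
  le_of_forall_pos_le_add fun ε hε =>
    limsup_le_of_le (isCoboundedUnder_le_of_eventually_le atTop h0) (h ε hε)

lemma eventually_le_of_limsup_le {x : ℕ → ℝ} {a : ℝ} (h1 : ∀ᶠ n in atTop, x n ≤ 1)
    (h : limsup x atTop ≤ a) {ε : ℝ} (hε : 0 < ε) : ∀ᶠ n in atTop, x n ≤ a + ε := by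
  have := eventually_lt_of_limsup_lt (lt_of_le_of_lt h (by linarith : a < a + ε))
    (isBoundedUnder_of_eventually_le h1)
  filter_upwards [this] with n hn using hn.le

lemma le_liminf_of_forall {x : ℕ → ℝ} {a : ℝ} (h1 : ∀ᶠ n in atTop, x n ≤ 1)
    (h : ∀ ε > 0, ∀ᶠ n in atTop, a - ε ≤ x n) : a ≤ liminf x atTop :=
  le_of_forall_pos_sub_le fun ε hε =>
    le_liminf_of_le (isCoboundedUnder_ge_of_eventually_le atTop h1) (h ε hε)

lemma eventually_ge_of_le_liminf {x : ℕ → ℝ} {a : ℝ} (h0 : ∀ᶠ n in atTop, 0 ≤ x n)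
    (h : a ≤ liminf x atTop) {ε : ℝ} (hε : 0 < ε) : ∀ᶠ n in atTop, a - ε ≤ x n := by
  have := eventually_lt_of_lt_liminf (lt_of_lt_of_le (by linarith : a - ε < a) h)
    (isBoundedUnder_of_eventually_ge h0)
  filter_upwards [this] with n hn using hn.le

lemma liminf_le_of_forall {x : ℕ → ℝ} {a : ℝ} (h0 : ∀ᶠ n in atTop, 0 ≤ x n)
    (h : ∀ ε > 0, ∀ᶠ n in atTop, x n ≤ a + ε) : liminf x atTop ≤ a := by
  refine le_of_forall_pos_le_add fun ε hε => ?_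
  by_contra hlt
  push Not at hlt
  have h1 := eventually_lt_of_lt_liminf hlt (isBoundedUnder_of_eventually_ge h0)
  obtain ⟨n, hn1, hn2⟩ := (h1.and (h ε hε)).exists
  linarith

/-! ### Tests based on standardized sums -/

open Classical in
/-- The test rejecting for large values of `n^{-1/2} ∑ f(xᵢ)`. -/
def sumTest (f : Ω → ℝ) (c : ℝ) (n : ℕ) (x : Fin n → Ω) : ℝ := if c < normSum f n x then 1 else 0

lemma measurableSet_normSum_gt {f : Ω → ℝ} (hf : Measurable f) (c : ℝ) (n : ℕ) :
    MeasurableSet {x | c < normSum f n x} := measurable_normSum hf n measurableSet_Ioi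

lemma sumTest_eq_indicator (f : Ω → ℝ) (c : ℝ) (n : ℕ) :
    sumTest f c n = {x | c < normSum f n x}.indicator 1 := by
  ext x
  by_cases hx : c < normSum f n x <;> simp [sumTest, hx]

lemma isTest_sumTest {f : Ω → ℝ} (hf : Measurable f) (c : ℝ) (n : ℕ) :
    IsTest (sumTest f c n) := by
  constructor
  · rw [sumTest_eq_indicator]
    exact measurable_one.indicator (measurableSet_normSum_gt hf c n)
  · intro x
    unfold sumTest
    split_ifs <;> norm_num

lemma isTestSeq_sumTest {f : Ω → ℝ} (hf : Measurable f) (c : ℝ) : IsTestSeq (sumTest f c) :=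
  fun n => isTest_sumTest hf c n

lemma integral_sumTest {f : Ω → ℝ} (hf : Measurable f) (c : ℝ) (n : ℕ)
    (μ : Measure (Fin n → Ω)) :
    ∫ x, sumTest f c n x ∂μ = μ.real {x | c < normSum f n x} := by
  rw [sumTest_eq_indicator, integral_indicator_one (measurableSet_normSum_gt hf c n)]

/-- `Q n → P` on bounded measurable functions. -/
def ConvergesTo (Q : ℕ → Measure Ω) (P : Measure Ω) : Prop :=
  (∀ᶠ n in atTop, IsProbabilityMeasure (Q n)) ∧ ∀ f : Ω → ℝ, Measurable f → ∀ C, (∀ x, |f x| ≤ C) →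
    Tendsto (fun n => ∫ x, f x ∂(Q n)) atTop (𝓝 (∫ x, f x ∂P))

lemma normSum_sub_const (f : Ω → ℝ) (m : ℝ) {n : ℕ} (hn : 0 < (n : ℝ)) (x : Fin n → Ω) :
    normSum (fun y => f y - m) n x = normSum f n x - Real.sqrt n * m := by
  have hs : Real.sqrt n ^ 2 = n := Real.sq_sqrt hn.le
  have hs0 : 0 < Real.sqrt n := Real.sqrt_pos.2 hn
  simp only [normSum, Finset.sum_sub_distrib, Finset.sum_const, Finset.card_univ, Fintype.card_fin,
    nsmul_eq_mul]
  rw [mul_sub]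
  congr 1
  field_simp
  rw [hs]

lemma nrm_sq (P : Measure Ω) (f : Ω → ℝ) : nrm P f ^ 2 = ∫ x, f x ^ 2 ∂P :=
  Real.sq_sqrt (integral_nonneg fun x => sq_nonneg _)

lemma nrm_nonneg (P : Measure Ω) (f : Ω → ℝ) : 0 ≤ nrm P f := Real.sqrt_nonneg _

section

variable {P : Measure Ω} [IsProbabilityMeasure P] {Q : ℕ → Measure Ω} {f : Ω → ℝ} {C : ℝ}

/-- The drift `√n ∫ f dQ n` is moved into the threshold instead of being assumed convergent. Inside
a shrinking ball only bounds on the drift are available. -/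
lemma tendsto_real_normSum (hQ : ConvergesTo Q P) (hf : Measurable f) (hC : ∀ x, |f x| ≤ C)
    (hf0 : ∫ x, f x ∂P = 0) (hs : 0 < nrm P f) (a : ℝ) :
    Tendsto (fun n => (iid (Q n) n).real
      {x | Real.sqrt n * ∫ y, f y ∂(Q n) + a < normSum f n x}) atTop (𝓝 (Phi (-a / nrm P f))) := by
  classical
  -- The finitely many members that are not probabilities are replaced by `P`, since the central
  -- limit theorem above asks for probabilities at every index.
  set Q' : ℕ → Measure Ω := fun n => if IsProbabilityMeasure (Q n) then Q n else P with hQ'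
  have hprob : ∀ n, IsProbabilityMeasure (Q' n) := fun n => by
    simp only [hQ']; split_ifs with h
    · exact h
    · infer_instance
  have hev : ∀ᶠ n in atTop, Q' n = Q n := by
    filter_upwards [hQ.1] with n hn
    simp [hQ', hn]
  have hfi : ∀ μ : Measure Ω, IsProbabilityMeasure μ → Integrable f μ := fun μ _ =>
    Integrable.of_bound hf.aestronglyMeasurable C (ae_of_all _ hC)
  have hf2 : ∀ x, |f x ^ 2| ≤ C ^ 2 := fun x => by
    rw [abs_pow]; exact pow_le_pow_left₀ (abs_nonneg _) (hC x) 2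
  have hf2i : ∀ μ : Measure Ω, IsProbabilityMeasure μ → Integrable (fun x => f x ^ 2) μ :=
    fun μ _ => Integrable.of_bound (hf.pow_const 2).aestronglyMeasurable (C ^ 2) (ae_of_all _ hf2)
  set g : ℕ → Ω → ℝ := fun n x => f x - ∫ y, f y ∂(Q' n) with hg
  have hmb : ∀ n, |∫ y, f y ∂(Q' n)| ≤ C := fun n => by
    have hp := hprob n
    have := norm_integral_le_of_norm_le_const (μ := Q' n) (f := f) (C := C) (ae_of_all _ hC)
    rwa [probReal_univ, mul_one] at this
  have key := tendsto_real_normSum_of_centered (Q := Q') (f := g) (fun n => hf.sub_const _)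
    (C := C + C) (fun n x => (abs_sub _ _).trans (add_le_add (hC x) (hmb n)))
    (fun n => by
      simp only [hg]
      rw [integral_sub (hfi _ inferInstance) (integrable_const _)]; simp) hs ?_ a
  · refine key.congr' ?_
    filter_upwards [hev, eventually_natCast_pos] with n hn hpos
    rw [hn]
    congr 1
    ext x
    simp only [hg, Set.mem_ofPred_eq]
    rw [normSum_sub_const f _ hpos, hn]
    constructor <;> intro h <;> linarith
  · have h1 : Tendsto (fun n => ∫ x, f x ^ 2 ∂(Q n) - (∫ x, f x ∂(Q n)) ^ 2) atTop
        (𝓝 (nrm P f ^ 2)) := by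
      have := (hQ.2 _ (hf.pow_const 2) (C ^ 2) hf2).sub ((hQ.2 f hf C hC).pow 2)
      rw [hf0] at this
      rw [nrm_sq]
      simpa using this
    refine h1.congr' ?_
    filter_upwards [hev] with n hn
    have hp := hprob n
    have e : ∀ x, g n x ^ 2 = f x ^ 2 - (2 * ∫ y, f y ∂(Q' n)) * f x + (∫ y, f y ∂(Q' n)) ^ 2 :=
      fun x => by simp only [hg]; ring
    simp_rw [e]
    rw [integral_add (integrable_fun_sub (hf2i _ hp) ((hfi _ hp).const_mul _)) (integrable_const _),
      integral_sub (hf2i _ hp) ((hfi _ hp).const_mul _), integral_const_mul]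
    have hp' : IsProbabilityMeasure (Q n) := hn ▸ hp
    simp [hn]
    ring

lemma exists_Phi_le {y ε : ℝ} (hε : 0 < ε) (s : ℝ) :
    ∃ η > 0, Phi (y + η / s) ≤ Phi y + ε ∧ Phi y - ε ≤ Phi (y - η / s) := by
  have h1 : Tendsto (fun η : ℝ => Phi (y + η / s)) (𝓝[>] 0) (𝓝 (Phi (y + 0 / s))) :=
    ((Phi_continuous.comp (by fun_prop)).tendsto 0).mono_left nhdsWithin_le_nhds
  have h2 : Tendsto (fun η : ℝ => Phi (y - η / s)) (𝓝[>] 0) (𝓝 (Phi (y - 0 / s))) :=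
    ((Phi_continuous.comp (by fun_prop)).tendsto 0).mono_left nhdsWithin_le_nhds
  rw [zero_div, add_zero] at h1
  rw [zero_div, sub_zero] at h2
  obtain ⟨η, ⟨ha, hb⟩, hc⟩ := ((h1.eventually_le_const (by linarith : Phi y < Phi y + ε)).and
    (h2.eventually_const_le (by linarith : Phi y - ε < Phi y))).and self_mem_nhdsWithin |>.exists
  exact ⟨η, hc, ha, hb⟩

lemma eventually_integral_sumTest_le (hQ : ConvergesTo Q P) (hf : Measurable f)
    (hC : ∀ x, |f x| ≤ C) (hf0 : ∫ x, f x ∂P = 0) (hs : 0 < nrm P f) {b c : ℝ}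
    (hm : ∀ η > 0, ∀ᶠ n : ℕ in atTop, Real.sqrt n * ∫ y, f y ∂(Q n) ≤ b + η) :
    ∀ ε > 0, ∀ᶠ n in atTop,
      ∫ x, sumTest f c n x ∂(iid (Q n) n) ≤ Phi ((b - c) / nrm P f) + ε := by
  intro ε hε
  obtain ⟨η, hη, h1, -⟩ := exists_Phi_le (y := (b - c) / nrm P f) (half_pos hε) (nrm P f)
  have h2 := tendsto_real_normSum hQ hf hC hf0 hs (c - b - η)
  have e : -(c - b - η) / nrm P f = (b - c) / nrm P f + η / nrm P f := by ring
  rw [e] at h2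
  filter_upwards [hm η hη, hQ.1, h2.eventually_le_const
    (by linarith : _ < Phi ((b - c) / nrm P f + η / nrm P f) + ε / 2)] with n hn hp hle
  rw [integral_sumTest hf]
  refine (measureReal_mono fun x hx => ?_).trans (hle.trans (by linarith))
  simp only [Set.mem_ofPred_eq] at hx ⊢
  linarith

lemma eventually_le_integral_sumTest (hQ : ConvergesTo Q P) (hf : Measurable f)
    (hC : ∀ x, |f x| ≤ C) (hf0 : ∫ x, f x ∂P = 0) (hs : 0 < nrm P f) {b c : ℝ}
    (hm : ∀ η > 0, ∀ᶠ n : ℕ in atTop, b - η ≤ Real.sqrt n * ∫ y, f y ∂(Q n)) :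
    ∀ ε > 0, ∀ᶠ n in atTop,
      Phi ((b - c) / nrm P f) - ε ≤ ∫ x, sumTest f c n x ∂(iid (Q n) n) := by
  intro ε hε
  obtain ⟨η, hη, -, h1⟩ := exists_Phi_le (y := (b - c) / nrm P f) (half_pos hε) (nrm P f)
  have h2 := tendsto_real_normSum hQ hf hC hf0 hs (c - b + η)
  have e : -(c - b + η) / nrm P f = (b - c) / nrm P f - η / nrm P f := by ring
  rw [e] at h2
  filter_upwards [hm η hη, hQ.1, h2.eventually_const_le
    (by linarith : Phi ((b - c) / nrm P f - η / nrm P f) - ε / 2 < _)] with n hn hp hle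
  rw [integral_sumTest hf]
  refine le_trans (by linarith) (hle.trans (measureReal_mono fun x hx => ?_))
  simp only [Set.mem_ofPred_eq] at hx ⊢
  linarith

lemma tendsto_integral_sumTest (hQ : ConvergesTo Q P) (hf : Measurable f)
    (hC : ∀ x, |f x| ≤ C) (hf0 : ∫ x, f x ∂P = 0) (hs : 0 < nrm P f) {b : ℝ} (c : ℝ)
    (hm : Tendsto (fun n : ℕ => Real.sqrt n * ∫ y, f y ∂(Q n)) atTop (𝓝 b)) :
    Tendsto (fun n => ∫ x, sumTest f c n x ∂(iid (Q n) n)) atTop (𝓝 (Phi ((b - c) / nrm P f))) := by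
  have h1 := eventually_integral_sumTest_le (c := c) hQ hf hC hf0 hs (b := b) fun η hη =>
    hm.eventually_le_const (by linarith)
  have h2 := eventually_le_integral_sumTest (c := c) hQ hf hC hf0 hs (b := b) fun η hη =>
    hm.eventually_const_le (by linarith)
  rw [Metric.tendsto_atTop']
  intro ε hε
  obtain ⟨N, hN⟩ := eventually_atTop.1 ((h1 (ε / 2) (half_pos hε)).and (h2 (ε / 2) (half_pos hε)))
  refine ⟨N, fun n hn => ?_⟩
  have := hN n hn.le
  rw [Real.dist_eq, abs_lt]
  constructor <;> linarith [this.1, this.2]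

lemma IsQMD.tendsto_sqrt_mul_integral {h : Ω → ℝ} {ξ : ℕ → Ω → ℝ} (hQ : IsQMD P Q h ξ)
    (hf : Measurable f) (hC : ∀ x, |f x| ≤ C) :
    Tendsto (fun n : ℕ => Real.sqrt n * (∫ x, f x ∂(Q n) - ∫ x, f x ∂P)) atTop
      (𝓝 (∫ x, f x * h x ∂P)) := by
  obtain ⟨e, he, hb⟩ := hQ.exists_integral_bound
  have hC' : ∀ x, |f x| ≤ |C| := fun x => (hC x).trans (le_abs_self C)
  have h1 : Tendsto (fun n => |C| * e n) atTop (𝓝 0) := by simpa using he.const_mul |C|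
  have h2 := squeeze_zero_norm' (a := fun n => |C| * e n)
    (f := fun n : ℕ => Real.sqrt n * (∫ x, f x ∂(Q n) - ∫ x, f x ∂P) - ∫ x, f x * h x ∂P)
    (by filter_upwards [hb] with n hn using hn f hf |C| (abs_nonneg C) hC') h1
  simpa using h2.add_const (∫ x, f x * h x ∂P)

lemma IsQMD.convergesTo {h : Ω → ℝ} {ξ : ℕ → Ω → ℝ} (hQ : IsQMD P Q h ξ) : ConvergesTo Q P := by
  refine ⟨hQ.prob, fun f hf C hC => ?_⟩
  have h1 := (hQ.tendsto_sqrt_mul_integral hf hC).mul tendsto_sqrt_natCast.inv_tendsto_atTop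
  rw [mul_zero] at h1
  have h2 := h1.add_const (∫ x, f x ∂P)
  rw [zero_add] at h2
  refine h2.congr' ?_
  filter_upwards [eventually_natCast_pos] with n hn
  have hs0 : 0 < Real.sqrt n := Real.sqrt_pos.2 hn
  simp only [Pi.inv_apply]
  field_simp
  ring

lemma IsQMD.tendsto_sumTest {h : Ω → ℝ} {ξ : ℕ → Ω → ℝ} (hQ : IsQMD P Q h ξ)
    (hf : Measurable f) (hC : ∀ x, |f x| ≤ C) (hf0 : ∫ x, f x ∂P = 0) (hs : 0 < nrm P f) (c : ℝ) :
    Tendsto (fun n => ∫ x, sumTest f c n x ∂(iid (Q n) n)) atTop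
      (𝓝 (Phi ((inn P f h - c) / nrm P f))) := by
  have h1 := hQ.tendsto_sqrt_mul_integral hf hC
  rw [hf0] at h1
  simp only [sub_zero] at h1
  exact tendsto_integral_sumTest hQ.convergesTo hf hC hf0 hs c h1

end

/-! ### Exponential tilting -/

section ExpTilt

variable {P : Measure Ω} [IsProbabilityMeasure P] {B : ℕ → Measure Ω} {b f : Ω → ℝ}
  {ξ : ℕ → Ω → ℝ} {C : ℝ}

/-- The normalizing constant of the exponential tilt. -/
def expMass (Q : Measure Ω) (f : Ω → ℝ) (n : ℕ) : ℝ := ∫ x, Real.exp (f x / Real.sqrt n) ∂Q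

lemma abs_div_sqrt_le_one (hC : ∀ x, |f x| ≤ C) :
    ∀ᶠ n : ℕ in atTop, ∀ x, |f x / Real.sqrt n| ≤ 1 := by
  filter_upwards [tendsto_sqrt_natCast.eventually_ge_atTop C, eventually_natCast_pos] with n h1 h2 x
  have hs0 : 0 < Real.sqrt n := Real.sqrt_pos.2 h2
  exact (abs_div_sqrt_le (hC x) n).trans ((div_le_one hs0).2 h1)

lemma integrable_exp_of_bounded {S : Type*} [MeasurableSpace S] {μ : Measure S}
    [IsFiniteMeasure μ] {g : S → ℝ} (hg : Measurable g) {K : ℝ} (hK : ∀ x, |g x| ≤ K) :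
    Integrable (fun x => Real.exp (g x)) μ :=
  Integrable.of_bound hg.exp.aestronglyMeasurable (Real.exp K) (ae_of_all _ fun x => by
    rw [Real.norm_eq_abs, abs_of_pos (Real.exp_pos _)]
    exact Real.exp_le_exp.2 ((le_abs_self _).trans (hK x)))

lemma abs_exp_sub_quadratic_le {y : ℝ} (hy : |y| ≤ 1) :
    |Real.exp y - (1 + y + y ^ 2 / 2)| ≤ |y| ^ 3 := by
  have h := Real.exp_bound hy (n := 3) (by norm_num)
  simp only [Finset.sum_range_succ, Finset.sum_range_zero] at h
  norm_num [Nat.factorial] at h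
  refine h.trans ?_
  have : 0 ≤ |y| ^ 3 := by positivity
  linarith

/-- Asymptotics of the normalizing constant. -/
lemma IsQMD.tendsto_expMass (hB : IsQMD P B b ξ) (hf : Measurable f) (hC : ∀ x, |f x| ≤ C)
    (hf0 : ∫ x, f x ∂P = 0) :
    Tendsto (fun n : ℕ => (n : ℝ) * (expMass (B n) f n - 1)) atTop
      (𝓝 (inn P f b + (∫ x, f x ^ 2 ∂P) / 2)) := by
  have h1 := hB.tendsto_sqrt_mul_integral hf hC
  rw [hf0] at h1
  simp only [sub_zero] at h1
  have h2 := (hB.convergesTo.2 _ (hf.pow_const 2) (C ^ 2) fun x => by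
    rw [abs_pow]; exact pow_le_pow_left₀ (abs_nonneg _) (hC x) 2).div_const 2
  have h3 : Tendsto (fun n : ℕ => |C| ^ 3 / Real.sqrt n) atTop (𝓝 0) :=
    tendsto_sqrt_natCast.const_div_atTop _
  have h4 : Tendsto (fun n : ℕ => (n : ℝ) * (expMass (B n) f n - 1) -
      (Real.sqrt n * ∫ x, f x ∂(B n) + (∫ x, f x ^ 2 ∂(B n)) / 2)) atTop (𝓝 0) := by
    refine squeeze_zero_norm' ?_ h3
    filter_upwards [abs_div_sqrt_le_one hC, hB.prob, eventually_natCast_pos] with n hy hp hn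
    have hs : Real.sqrt n ^ 2 = n := Real.sq_sqrt hn.le
    have hs0 : 0 < Real.sqrt n := Real.sqrt_pos.2 hn
    set y : Ω → ℝ := fun x => f x / Real.sqrt n with hyd
    have hym : Measurable y := hf.div_const _
    have iy : Integrable y (B n) := Integrable.of_bound hym.aestronglyMeasurable 1 (ae_of_all _ hy)
    have iy2 : Integrable (fun x => y x ^ 2) (B n) :=
      Integrable.of_bound (hym.pow_const 2).aestronglyMeasurable 1 (ae_of_all _ fun x => by
        rw [norm_pow, Real.norm_eq_abs]; exact pow_le_one₀ (abs_nonneg _) (hy x))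
    have iE := integrable_exp_of_bounded (μ := B n) hym hy
    have e1 : Real.sqrt n * ∫ x, f x ∂(B n) = n * ∫ x, y x ∂(B n) := by
      simp only [hyd]
      rw [integral_div]
      nth_rewrite 2 [← hs]
      field_simp
    have e2 : ∫ x, f x ^ 2 ∂(B n) = n * ∫ x, y x ^ 2 ∂(B n) := by
      simp only [hyd, div_pow, hs]
      rw [integral_div]
      field_simp
    have iA : Integrable (fun x => 1 + y x + y x ^ 2 / 2) (B n) :=
      ((integrable_const _).add iy).add (iy2.div_const 2)
    have e3 : ∫ x, (1 + y x + y x ^ 2 / 2) ∂(B n) =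
        1 + ∫ x, y x ∂(B n) + (∫ x, y x ^ 2 ∂(B n)) / 2 := by
      rw [integral_add (by exact (integrable_const _).add iy) (iy2.div_const 2),
        integral_add (integrable_const _) iy]
      simp [integral_div]
    have e4 : (n : ℝ) * (expMass (B n) f n - 1) -
        (Real.sqrt n * ∫ x, f x ∂(B n) + (∫ x, f x ^ 2 ∂(B n)) / 2) =
        n * ∫ x, (Real.exp (y x) - (1 + y x + y x ^ 2 / 2)) ∂(B n) := by
      rw [integral_sub iE iA, e3, e1, e2, expMass]; ring
    rw [e4, norm_mul, Real.norm_natCast]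
    have e5 : ‖∫ x, (Real.exp (y x) - (1 + y x + y x ^ 2 / 2)) ∂(B n)‖ ≤
        (|C| / Real.sqrt n) ^ 3 := by
      have := norm_integral_le_of_norm_le_const (μ := B n)
        (f := fun x => Real.exp (y x) - (1 + y x + y x ^ 2 / 2)) (C := (|C| / Real.sqrt n) ^ 3)
        (ae_of_all _ fun x => (abs_exp_sub_quadratic_le (hy x)).trans
          (pow_le_pow_left₀ (abs_nonneg _) (abs_div_sqrt_le ((hC x).trans (le_abs_self C)) n) 3))
      rwa [probReal_univ, mul_one] at this
    calc (n : ℝ) * _ ≤ n * (|C| / Real.sqrt n) ^ 3 := by gcongr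
      _ = |C| ^ 3 / Real.sqrt n := by
          rw [div_pow, pow_succ (Real.sqrt n), hs]; field_simp
  have h5 := h4.add (h1.add h2)
  rw [zero_add] at h5
  refine h5.congr fun n => by ring

lemma IsQMD.tendsto_expMass_pow (hB : IsQMD P B b ξ) (hf : Measurable f) (hC : ∀ x, |f x| ≤ C)
    (hf0 : ∫ x, f x ∂P = 0) :
    Tendsto (fun n : ℕ => expMass (B n) f n ^ n) atTop
      (𝓝 (Real.exp (inn P f b + (∫ x, f x ^ 2 ∂P) / 2))) := by
  have := Real.tendsto_one_add_pow_exp_of_tendsto (hB.tendsto_expMass hf hC hf0)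
  simpa using this

lemma expMass_pos {Q : Measure Ω} [IsProbabilityMeasure Q] (hf : Measurable f)
    (hC : ∀ x, |f x| ≤ C) (n : ℕ) : 0 < expMass Q f n :=
  integral_exp_pos (integrable_exp_of_bounded (hf.div_const _) fun x => abs_div_sqrt_le (hC x) n)

lemma integral_exp_normSum (Q : Measure Ω) [IsProbabilityMeasure Q] (n : ℕ) :
    ∫ x, Real.exp (normSum f n x) ∂(iid Q n) = expMass Q f n ^ n := by
  have h := integral_fintype_prod_eq_pow (ι := Fin n) (μ := Q)
    (fun x => Real.exp (f x / Real.sqrt n))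
  rw [Fintype.card_fin] at h
  rw [expMass, ← h]
  refine integral_congr_ae (ae_of_all _ fun x => ?_)
  dsimp only
  rw [← Real.exp_sum, normSum, Finset.mul_sum]
  congr 1
  exact Finset.sum_congr rfl fun i _ => by ring

/-- Exponential tilts by a bounded centered function add this function to the tangent, and the
likelihood ratios of the product measures are functions of the standardized sum. -/
lemma IsQMD.exists_expTilt (hB : IsQMD P B b ξ) (hf : Measurable f) (hC : ∀ x, |f x| ≤ C)
    (hf0 : ∫ x, f x ∂P = 0) :
    ∃ (B' : ℕ → Measure Ω) (ξ' : ℕ → Ω → ℝ), IsQMD P B' (fun x => b x + f x) ξ' ∧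
      ∀ᶠ n in atTop, ∀ φ : (Fin n → Ω) → ℝ,
        ∫ x, φ x ∂(iid (B' n) n) =
          ∫ x, (Real.exp (normSum f n x) / expMass (B n) f n ^ n) * φ x ∂(iid (B n) n) := by
  set Z : ℕ → ℝ := fun n => expMass (B n) f n with hZ
  -- Chosen so that `1 + w / √n` is exactly `exp(f / √n) / Z`. The additive form is what
  -- `IsQMD.tilt` needs, the exponential form gives the exact likelihood ratio of the products.
  set w : ℕ → Ω → ℝ := fun n x => Real.sqrt n * (Real.exp (f x / Real.sqrt n) / Z n - 1) with hw
  have hwm : ∀ n, Measurable (w n) := fun n =>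
    (((hf.div_const _).exp.div_const _).sub_const _).const_mul _
  have hZ1 := hB.tendsto_expMass hf hC hf0
  have hsinv : Tendsto (fun n : ℕ => (Real.sqrt n)⁻¹) atTop (𝓝 0) :=
    tendsto_sqrt_natCast.inv_tendsto_atTop
  -- the normalizing constant is `1 + o(1 / √n)`
  have hZ2 : Tendsto (fun n : ℕ => Real.sqrt n * (Z n - 1)) atTop (𝓝 0) := by
    have := hZ1.mul hsinv
    rw [mul_zero] at this
    refine this.congr' ?_
    filter_upwards [eventually_natCast_pos] with n hn
    have hs : Real.sqrt n ^ 2 = n := Real.sq_sqrt hn.le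
    have hs0 : 0 < Real.sqrt n := Real.sqrt_pos.2 hn
    nth_rewrite 1 [← hs]
    field_simp
    simp [hZ]
  have hZlim : Tendsto Z atTop (𝓝 1) := by
    have := (hZ2.mul hsinv).add_const 1
    rw [mul_zero, zero_add] at this
    refine this.congr' ?_
    filter_upwards [eventually_natCast_pos] with n hn
    have hs0 : 0 < Real.sqrt n := Real.sqrt_pos.2 hn
    field_simp
    ring
  -- uniform convergence of the tilting functions
  set ρ : ℕ → ℝ := fun n => 2 * (|C| ^ 2 / Real.sqrt n + |Real.sqrt n * (Z n - 1)| +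
    |C| * |Z n - 1|) with hρ
  have hρ0 : Tendsto ρ atTop (𝓝 0) := by
    have h1 : Tendsto (fun n : ℕ => |C| ^ 2 / Real.sqrt n) atTop (𝓝 0) :=
      tendsto_sqrt_natCast.const_div_atTop _
    have h2 : Tendsto (fun n => |C| * |Z n - 1|) atTop (𝓝 0) := by
      have := (hZlim.sub_const 1).abs.const_mul |C|
      simpa using this
    have := ((h1.add hZ2.abs).add h2).const_mul 2
    simp only [abs_zero, add_zero, mul_zero] at this
    exact this
  have hwf : ∀ᶠ n in atTop, ∀ x, |w n x - f x| ≤ ρ n := by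
    filter_upwards [abs_div_sqrt_le_one hC, eventually_natCast_pos,
      hZlim.eventually_const_le (by norm_num : (1 / 2 : ℝ) < 1)] with n hy hn hZn x
    have hs0 : 0 < Real.sqrt n := Real.sqrt_pos.2 hn
    have hs : Real.sqrt n ^ 2 = n := Real.sq_sqrt hn.le
    have hZ0 : 0 < Z n := by linarith
    have e1 : w n x - f x = (Real.sqrt n * (Real.exp (f x / Real.sqrt n) - 1 - f x / Real.sqrt n) -
        Real.sqrt n * (Z n - 1) - f x * (Z n - 1)) / Z n := by
      simp only [hw]; field_simp; ring
    have e2 : |Real.sqrt n * (Real.exp (f x / Real.sqrt n) - 1 - f x / Real.sqrt n)| ≤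
        |C| ^ 2 / Real.sqrt n := by
      rw [abs_mul, abs_of_pos hs0]
      calc Real.sqrt n * _ ≤ Real.sqrt n * (|C| / Real.sqrt n) ^ 2 := by
            refine mul_le_mul_of_nonneg_left ?_ hs0.le
            refine (Real.abs_exp_sub_one_sub_id_le (hy x)).trans ?_
            rw [← sq_abs]
            exact pow_le_pow_left₀ (abs_nonneg _)
              (abs_div_sqrt_le ((hC x).trans (le_abs_self C)) n) 2
        _ = |C| ^ 2 / Real.sqrt n := by field_simp
    have e3 : |f x * (Z n - 1)| ≤ |C| * |Z n - 1| := by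
      rw [abs_mul]
      exact mul_le_mul_of_nonneg_right ((hC x).trans (le_abs_self C)) (abs_nonneg _)
    rw [e1, abs_div, abs_of_pos hZ0, div_le_iff₀ hZ0]
    have e4 := (abs_sub (Real.sqrt n * (Real.exp (f x / Real.sqrt n) - 1 - f x / Real.sqrt n) -
        Real.sqrt n * (Z n - 1)) (f x * (Z n - 1)))
    have e5 := (abs_sub (Real.sqrt n * (Real.exp (f x / Real.sqrt n) - 1 - f x / Real.sqrt n))
        (Real.sqrt n * (Z n - 1)))
    have e6 : 0 ≤ ρ n := by simp only [hρ]; positivity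
    have e7 : ρ n / 2 ≤ ρ n * Z n := by nlinarith
    have e8 : ρ n / 2 = |C| ^ 2 / Real.sqrt n + |Real.sqrt n * (Z n - 1)| +
      |C| * |Z n - 1| := by simp only [hρ]; ring
    linarith
  have hlim : Tendsto (fun n => ∫ x, (w n x - f x) ^ 2 ∂P) atTop (𝓝 0) := by
    have h1 : Tendsto (fun n => ρ n ^ 2) atTop (𝓝 0) := by simpa using hρ0.pow 2
    refine squeeze_zero_norm' ?_ h1
    filter_upwards [hwf] with n hn
    have := norm_integral_le_of_norm_le_const (μ := P) (f := fun x => (w n x - f x) ^ 2)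
      (C := ρ n ^ 2) (ae_of_all _ fun x => by
        rw [norm_pow, Real.norm_eq_abs]; exact pow_le_pow_left₀ (abs_nonneg _) (hn x) 2)
    rwa [probReal_univ, mul_one] at this
  have hK : ∀ᶠ n in atTop, ∀ x, |w n x| ≤ |C| + 1 := by
    filter_upwards [hwf, hρ0.eventually_le_const one_pos] with n h1 h2 x
    have h3 := abs_add_le (w n x - f x) (f x)
    rw [sub_add_cancel] at h3
    linarith [h1 x, (hC x).trans (le_abs_self C)]
  have hint : ∀ᶠ n in atTop, ∫ x, w n x ∂(B n) = 0 := by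
    filter_upwards [hB.prob] with n hp
    have hpos : 0 < Z n := expMass_pos hf hC n
    have i1 := integrable_exp_of_bounded (μ := B n) (hf.div_const (Real.sqrt n))
      fun x => abs_div_sqrt_le (hC x) n
    simp only [hw]
    rw [integral_const_mul, integral_sub (i1.div_const _) (integrable_const _), integral_div]
    change _ * (Z n / Z n - _) = 0
    rw [div_self hpos.ne']
    simp
  have hfL : MemLp f 2 P := MemLp.of_bound hf.aestronglyMeasurable C (ae_of_all _ hC)
  refine ⟨_, _, hB.tilt hwm hK (tendsto_sqrt_natCast.const_div_atTop _) hfL hlim hint, ?_⟩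
  filter_upwards [hB.prob, eventually_natCast_pos] with n hp hn φ
  have hs0 : 0 < Real.sqrt n := Real.sqrt_pos.2 hn
  have hpos : 0 < Z n := expMass_pos hf hC n
  have e1 : ∀ x, 1 + w n x / Real.sqrt n = Real.exp (f x / Real.sqrt n) / Z n := fun x => by
    simp only [hw]; field_simp; ring
  have hm : Measurable fun x => Real.exp (f x / Real.sqrt n) / Z n :=
    (hf.div_const _).exp.div_const _
  have hfin : IsFiniteMeasure ((B n).withDensity
      fun x => ENNReal.ofReal (Real.exp (f x / Real.sqrt n) / Z n)) := by
    refine isFiniteMeasure_withDensity_ofReal ?_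
    exact ((integrable_exp_of_bounded (μ := B n) (hf.div_const (Real.sqrt n))
      fun x => abs_div_sqrt_le (hC x) n).div_const _).2
  have e2 : iid (RobustTest.tilt (B n) (w n) n) n = (iid (B n) n).withDensity
      fun x => ENNReal.ofReal (Real.exp (normSum f n x) / Z n ^ n) := by
    rw [RobustTest.tilt]
    simp_rw [e1]
    rw [iid_withDensity _ hm.ennreal_ofReal]
    congr 1; ext x
    rw [← ENNReal.ofReal_prod_of_nonneg fun i _ => by positivity]
    congr 1
    rw [Finset.prod_div_distrib, ← Real.exp_sum, Finset.prod_const, Finset.card_univ,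
      Fintype.card_fin, normSum, Finset.mul_sum]
    congr 2
    exact Finset.sum_congr rfl fun i _ => by ring
  rw [e2, integral_withDensity_ofReal ((measurable_normSum hf n).exp.div_const _)
    fun x => by positivity]

end ExpTilt

/-! ### Contiguity -/

section Contiguity

variable {P : Measure Ω} [IsProbabilityMeasure P]

lemma isQMD_const (P : Measure Ω) [IsProbabilityMeasure P] :
    IsQMD P (fun _ => P) (fun _ => 0) (fun _ _ => 1) := by
  refine ⟨Eventually.of_forall fun _ => inferInstance, Eventually.of_forall fun _ =>
    ⟨measurable_const, fun x => zero_le_one, ?_⟩, memLp_const 0, ?_, ?_⟩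
  · simp
  · simp
  · simp

/-- Truncate at a high level and recentre; the mean of the truncation tends to that of `g`, which is
zero. -/
lemma exists_bounded_approx {g : Ω → ℝ} (hg : IsTangent P g) {ε : ℝ} (hε : 0 < ε) :
    ∃ (f : Ω → ℝ) (C : ℝ), Measurable f ∧ (∀ x, |f x| ≤ C) ∧ ∫ x, f x ∂P = 0 ∧
      ∫ x, (f x - g x) ^ 2 ∂P < ε := by
  obtain ⟨hgm, hgL, hg0⟩ := hg
  set t : ℕ → Ω → ℝ := fun M x => max (-(M : ℝ)) (min (g x) M) with ht
  have htm : ∀ M, Measurable (t M) := fun M => measurable_const.max (hgm.min measurable_const)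
  have htb : ∀ M x, |t M x| ≤ M := fun M x => by
    have h0 : (0 : ℝ) ≤ M := M.cast_nonneg
    rw [abs_le]
    exact ⟨le_max_left _ _, max_le (by linarith) (min_le_right _ _)⟩
  have htg : ∀ M x, |t M x| ≤ |g x| := fun M x => by
    have h0 : (0 : ℝ) ≤ M := M.cast_nonneg
    have h1 := neg_abs_le (g x)
    have h2 := le_abs_self (g x)
    rw [abs_le]
    constructor
    · rcases le_total (g x) M with h | h
      · exact h1.trans (by simp [ht, h])
      · refine le_trans (by linarith [abs_nonneg (g x)]) (le_max_right _ _) |>.trans' ?_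
        rw [min_eq_right h]; linarith [abs_nonneg (g x)]
    · refine max_le (by linarith [abs_nonneg (g x)]) ((min_le_left _ _).trans h2)
  have hte : ∀ x, Tendsto (fun M => t M x) atTop (𝓝 (g x)) := fun x => by
    refine tendsto_const_nhds.congr' ?_
    filter_upwards [tendsto_natCast_atTop_atTop.eventually_ge_atTop |g x|] with M hM
    have h1 := abs_le.1 hM
    simp only [ht]
    rw [min_eq_left h1.2, max_eq_right (by linarith [h1.1])]
  have hti : ∀ M, Integrable (t M) P := fun M =>
    Integrable.of_bound (htm M).aestronglyMeasurable M (ae_of_all _ (htb M))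
  have hm : Tendsto (fun M => ∫ x, t M x ∂P) atTop (𝓝 0) := by
    rw [← hg0]
    exact tendsto_integral_of_dominated_convergence (fun x => |g x|)
      (fun M => (htm M).aestronglyMeasurable) (hgL.integrable one_le_two).abs
      (fun M => ae_of_all _ fun x => htg M x) (ae_of_all _ hte)
  have hlim : Tendsto (fun M => ∫ x, (t M x - ∫ y, t M y ∂P - g x) ^ 2 ∂P) atTop (𝓝 0) := by
    have h0 : (0 : ℝ) = ∫ x, (g x - 0 - g x) ^ 2 ∂P := by simp
    rw [h0]
    refine tendsto_integral_of_dominated_convergence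
      (fun x => 8 * g x ^ 2 + 2 * (∫ y, |g y| ∂P) ^ 2)
      (fun M => ((((htm M).sub_const _).sub hgm).pow_const 2).aestronglyMeasurable)
      ((hgL.integrable_sq.const_mul 8).add (integrable_const _))
      (fun M => ae_of_all _ fun x => ?_)
      (ae_of_all _ fun x => (((hte x).sub hm).sub_const _).pow 2)
    have h1 : |∫ y, t M y ∂P| ≤ ∫ y, |g y| ∂P :=
      abs_integral_le_integral_abs.trans (integral_mono (hti M).abs
        (hgL.integrable one_le_two).abs (htg M))
    rw [norm_pow, Real.norm_eq_abs]
    have h2 : |t M x - ∫ y, t M y ∂P - g x| ≤ 2 * |g x| + ∫ y, |g y| ∂P := by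
      have a1 := abs_sub (t M x - ∫ y, t M y ∂P) (g x)
      have a2 := abs_sub (t M x) (∫ y, t M y ∂P)
      linarith [htg M x]
    refine (pow_le_pow_left₀ (abs_nonneg _) h2 2).trans ?_
    rw [← sq_abs (g x)]
    nlinarith [sq_nonneg (2 * |g x| - ∫ y, |g y| ∂P)]
  obtain ⟨M, hM⟩ := (hlim.eventually_lt_const hε).exists
  refine ⟨fun x => t M x - ∫ y, t M y ∂P, M + M, (htm M).sub_const _, fun x => ?_, ?_, hM⟩
  · refine (abs_sub _ _).trans (add_le_add (htb M x) ?_)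
    have := norm_integral_le_of_norm_le_const (μ := P) (f := t M) (C := M) (ae_of_all _ (htb M))
    rwa [probReal_univ, mul_one] at this
  · rw [integral_sub (hti M) (integrable_const _)]; simp

/-- `P^n` is contiguous to `B_n^n`. -/
lemma IsQMD.contiguous {B : ℕ → Measure Ω} {b : Ω → ℝ} {ξ : ℕ → Ω → ℝ} (hB : IsQMD P B b ξ)
    (hb : IsTangent P b) {A : (n : ℕ) → Set (Fin n → Ω)} (hA : ∀ n, MeasurableSet (A n))
    (hlim : Tendsto (fun n => (iid (B n) n).real (A n)) atTop (𝓝 0)) :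
    Tendsto (fun n => (iid P n).real (A n)) atTop (𝓝 0) := by
  have key : ∀ ε > 0, ∀ᶠ n in atTop, (iid P n).real (A n) ≤ ε := by
    intro ε hε
    have hδ : 0 < (ε / 6) ^ 2 := by positivity
    -- Tilting `B n` back by a bounded approximation of `-b` leaves the small tangent `b - f`, so
    -- that the tilted product is within `ε / 2` of `P^n` for large `n`. Its likelihood ratio with
    -- respect to `B_n^n` has bounded second moment, and Cauchy-Schwarz makes the tilted probability
    -- of `A n` vanish.
    obtain ⟨f, C, hf, hC, hf0, hfb⟩ := exists_bounded_approx hb hδ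
    set g : Ω → ℝ := fun x => -f x with hg
    have hgm : Measurable g := hf.neg
    have hgC : ∀ x, |g x| ≤ C := fun x => by simp only [hg, abs_neg]; exact hC x
    have hg0 : ∫ x, g x ∂P = 0 := by simp only [hg]; rw [integral_neg, hf0, neg_zero]
    obtain ⟨B', ξ', hB', hLR⟩ := hB.exists_expTilt hgm hgC hg0
    obtain ⟨e, he, hbd⟩ := hB'.exists_iid_bound (isQMD_const P)
    have hsmall : 2 * Real.sqrt (∫ x, (b x + g x - 0) ^ 2 ∂P) < ε / 2 := by
      have : ∫ x, (b x + g x - 0) ^ 2 ∂P = ∫ x, (f x - b x) ^ 2 ∂P := by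
        refine integral_congr_ae (ae_of_all _ fun x => ?_)
        simp only [hg]; ring
      rw [this]
      have h1 : Real.sqrt (∫ x, (f x - b x) ^ 2 ∂P) ≤ ε / 6 := by
        rw [Real.sqrt_le_left (by positivity)]; exact hfb.le
      linarith
    -- the tilted probability of `A n` tends to zero
    have h2m : Measurable fun x => 2 * g x := hgm.const_mul 2
    have hZ := hB.tendsto_expMass_pow hgm hgC hg0
    have hZ2 := hB.tendsto_expMass_pow (f := fun x => 2 * g x) h2m (C := 2 * C)
      (fun x => by rw [abs_mul, abs_two]; linarith [hgC x])
      (by rw [integral_const_mul, hg0, mul_zero])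
    have hbound : Tendsto (fun n : ℕ => Real.sqrt ((iid (B n) n).real (A n)) *
        Real.sqrt (expMass (B n) (fun x => 2 * g x) n ^ n) / expMass (B n) g n ^ n)
        atTop (𝓝 0) := by
      have := (hlim.sqrt.mul hZ2.sqrt).div hZ (Real.exp_pos _).ne'
      rw [Real.sqrt_zero, zero_mul, zero_div] at this
      exact this
    filter_upwards [hLR, hbd, he.eventually_le_const hsmall, hB.prob, hB'.prob,
      hbound.eventually_le_const (half_pos hε)] with n h1 h2 h3 hp hp' h4
    have hAt : IsTest ((A n).indicator (1 : (Fin n → Ω) → ℝ)) :=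
      ⟨measurable_one.indicator (hA n), fun x => by by_cases hx : x ∈ A n <;> simp [hx]⟩
    have h5 := h2 _ hAt
    rw [integral_indicator_one (hA n)] at h5
    rw [integral_indicator_one (hA n)] at h5
    have h6 := h1 ((A n).indicator 1)
    rw [integral_indicator_one (hA n)] at h6
    have hZ0 : 0 < expMass (B n) g n := expMass_pos hgm hgC n
    have hSm := measurable_normSum hgm n
    have hSb : ∀ x : Fin n → Ω, |normSum g n x| ≤ 1 / Real.sqrt n * (n * C) := fun x => by
      rw [normSum, abs_mul, abs_of_nonneg (by positivity : 0 ≤ 1 / Real.sqrt n)]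
      refine mul_le_mul_of_nonneg_left ?_ (by positivity)
      refine (Finset.abs_sum_le_sum_abs _ _).trans ((Finset.sum_le_sum fun i _ => hgC (x i)).trans ?_)
      simp
    have hEL : MemLp (fun x : Fin n → Ω => Real.exp (normSum g n x)) 2 (iid (B n) n) :=
      MemLp.of_bound hSm.exp.aestronglyMeasurable _ (ae_of_all _ fun x => by
        rw [Real.norm_eq_abs, abs_of_pos (Real.exp_pos _)]
        exact Real.exp_le_exp.2 ((le_abs_self _).trans (hSb x)))
    have hAL : MemLp ((A n).indicator (1 : (Fin n → Ω) → ℝ)) 2 (iid (B n) n) :=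
      MemLp.of_bound hAt.1.aestronglyMeasurable 1 (ae_of_all _ fun x => by
        rw [Real.norm_eq_abs, abs_of_nonneg (hAt.2 x).1]; exact (hAt.2 x).2)
    have h7 := abs_integral_mul_le_sqrt hAL hEL
    have e1 : ∫ x, (A n).indicator (1 : (Fin n → Ω) → ℝ) x ^ 2 ∂(iid (B n) n) =
        (iid (B n) n).real (A n) := by
      rw [← integral_indicator_one (hA n)]
      refine integral_congr_ae (ae_of_all _ fun x => ?_)
      by_cases hx : x ∈ A n <;> simp [hx]
    -- The second moment for `g` is the first for `2 g`, whose limit is known.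
    have e2 : ∫ x, Real.exp (normSum g n x) ^ 2 ∂(iid (B n) n) =
        expMass (B n) (fun x => 2 * g x) n ^ n := by
      rw [← integral_exp_normSum]
      refine integral_congr_ae (ae_of_all _ fun x => ?_)
      dsimp only
      rw [← Real.exp_nat_mul, normSum, normSum, ← Finset.mul_sum]
      congr 1
      push_cast; ring
    rw [e1, e2] at h7
    have h8 : (iid (B' n) n).real (A n) ≤ ε / 2 := by
      refine le_trans ?_ h4
      rw [h6, le_div_iff₀ (pow_pos hZ0 n), ← integral_mul_const]
      refine le_trans (le_of_eq ?_) h7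
      refine integral_congr_ae (ae_of_all _ fun x => ?_)
      dsimp only
      rw [abs_of_nonneg (mul_nonneg (hAt.2 x).1 (Real.exp_pos _).le)]
      field_simp
    linarith [(abs_le.1 h5).1]
  rw [Metric.tendsto_atTop']
  intro ε hε
  obtain ⟨N, hN⟩ := eventually_atTop.1 (key (ε / 2) (half_pos hε))
  refine ⟨N, fun n hn => ?_⟩
  rw [Real.dist_eq, sub_zero, abs_of_nonneg measureReal_nonneg]
  linarith [hN n hn.le]

end Contiguity

/-! ### Asymptotic Neyman-Pearson lemma -/

/-- `exp T - exp κ` and `δ - φ` never have opposite signs, so their product is the product of the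
absolute values. The factor `k` is meant to normalize `exp T` to a likelihood ratio; the right side
is then the power lost by `φ` plus its gain in size weighted by the critical value. -/
lemma integral_abs_neymanPearson {S : Type*} [MeasurableSpace S] {μ : Measure S}
    [IsFiniteMeasure μ] {T : S → ℝ} (hT : Measurable T) {K : ℝ} (hK : ∀ x, |T x| ≤ K)
    {δ φ : S → ℝ} (hδ : IsTest δ) (hφ : IsTest φ) {κ k : ℝ}
    (h1 : ∀ x, κ < T x → δ x = 1) (h0 : ∀ x, ¬ κ < T x → δ x = 0) :
    Integrable (fun x => k * |Real.exp (T x) - Real.exp κ| * |δ x - φ x|) μ ∧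
    ∫ x, k * |Real.exp (T x) - Real.exp κ| * |δ x - φ x| ∂μ =
      (∫ x, Real.exp (T x) * k * δ x ∂μ - ∫ x, Real.exp (T x) * k * φ x ∂μ) +
        k * Real.exp κ * (∫ x, φ x ∂μ - ∫ x, δ x ∂μ) := by
  have iE : Integrable (fun x => Real.exp (T x) * k) μ :=
    (integrable_exp_of_bounded hT hK).mul_const k
  have hb : ∀ ψ : S → ℝ, IsTest ψ → ∀ x, ‖ψ x‖ ≤ 1 := fun ψ hψ x => by
    rw [Real.norm_eq_abs, abs_of_nonneg (hψ.2 x).1]; exact (hψ.2 x).2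
  have iδ : Integrable (fun x => Real.exp (T x) * k * δ x) μ :=
    iE.mul_bdd (c := 1) hδ.1.aestronglyMeasurable (ae_of_all _ (hb δ hδ))
  have iφ : Integrable (fun x => Real.exp (T x) * k * φ x) μ :=
    iE.mul_bdd (c := 1) hφ.1.aestronglyMeasurable (ae_of_all _ (hb φ hφ))
  have e : ∀ x, k * |Real.exp (T x) - Real.exp κ| * |δ x - φ x| =
      (Real.exp (T x) * k * δ x - Real.exp (T x) * k * φ x) +
        k * Real.exp κ * (φ x - δ x) := fun x => by
    by_cases hx : κ < T x
    · rw [h1 x hx, abs_of_pos (sub_pos.2 (Real.exp_lt_exp.2 hx)),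
        abs_of_nonneg (by linarith [hφ.2 x])]
      ring
    · rw [h0 x hx, abs_of_nonpos (sub_nonpos.2 (Real.exp_le_exp.2 (not_lt.1 hx))),
        abs_of_nonpos (by linarith [hφ.2 x])]
      ring
  simp_rw [e]
  refine ⟨(integrable_fun_sub iδ iφ).add
    ((integrable_fun_sub (hφ.integrable μ) (hδ.integrable μ)).const_mul _), ?_⟩
  rw [integral_add (integrable_fun_sub iδ iφ)
    ((integrable_fun_sub (hφ.integrable μ) (hδ.integrable μ)).const_mul _),
    integral_sub iδ iφ, integral_const_mul, integral_sub (hφ.integrable μ) (hδ.integrable μ)]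

section NeymanPearson

variable {P : Measure Ω} [IsProbabilityMeasure P] {B D : ℕ → Measure Ω} {b d f : Ω → ℝ}
  {ξ η : ℕ → Ω → ℝ} {C u : ℝ}

lemma abs_normSum_le (hC : ∀ x, |f x| ≤ C) (n : ℕ) (x : Fin n → Ω) :
    |normSum f n x| ≤ 1 / Real.sqrt n * (n * C) := by
  rw [normSum, abs_mul, abs_of_nonneg (by positivity : 0 ≤ 1 / Real.sqrt n)]
  refine mul_le_mul_of_nonneg_left ?_ (by positivity)
  refine (Finset.abs_sum_le_sum_abs _ _).trans ((Finset.sum_le_sum fun i _ => hC (x i)).trans ?_)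
  simp

lemma tendsto_size (hB : IsQMD P B b ξ) (hf : Measurable f) (hC : ∀ x, |f x| ≤ C)
    (hf0 : ∫ x, f x ∂P = 0) (hs : 0 < nrm P f) :
    Tendsto (fun n => ∫ x, sumTest f (nrm P f * u + inn P f b) n x ∂(iid (B n) n)) atTop
      (𝓝 (Phi (-u))) := by
  have h := hB.tendsto_sumTest hf hC hf0 hs (nrm P f * u + inn P f b)
  have e : (inn P f b - (nrm P f * u + inn P f b)) / nrm P f = -u := by field_simp; ring
  rwa [e] at h

lemma inn_add_self (hf : Measurable f) (hC : ∀ x, |f x| ≤ C) (hb : MemLp b 2 P)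
    (hd : d =ᵐ[P] fun x => b x + f x) : inn P f d = inn P f b + nrm P f ^ 2 := by
  have hfL : MemLp f 2 P := MemLp.of_bound hf.aestronglyMeasurable C (ae_of_all _ hC)
  have i1 : Integrable (fun x => f x * b x) P := hfL.integrable_mul hb
  rw [nrm_sq, inn, inn, ← integral_add i1 hfL.integrable_sq]
  refine integral_congr_ae ?_
  filter_upwards [hd] with x hx
  rw [hx]; ring

lemma tendsto_power (hB : IsQMD P B b ξ) (hD : IsQMD P D d η) (hf : Measurable f)
    (hC : ∀ x, |f x| ≤ C) (hf0 : ∫ x, f x ∂P = 0) (hs : 0 < nrm P f)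
    (hd : d =ᵐ[P] fun x => b x + f x) :
    Tendsto (fun n => ∫ x, sumTest f (nrm P f * u + inn P f b) n x ∂(iid (D n) n)) atTop
      (𝓝 (Phi (-u + nrm P f))) := by
  have h := hD.tendsto_sumTest hf hC hf0 hs (nrm P f * u + inn P f b)
  have e : (inn P f d - (nrm P f * u + inn P f b)) / nrm P f = -u + nrm P f := by
    rw [inn_add_self hf hC hB.memLp hd]; field_simp; ring
  rwa [e] at h

/-- The weighted distance of a test from the optimal one is asymptotically bounded by its losses
in power and size. -/
lemma exists_neymanPearson_bound (hB : IsQMD P B b ξ) (hD : IsQMD P D d η) (hf : Measurable f)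
    (hC : ∀ x, |f x| ≤ C) (hf0 : ∫ x, f x ∂P = 0) (hs : 0 < nrm P f)
    (hd : d =ᵐ[P] fun x => b x + f x) {δ : (n : ℕ) → (Fin n → Ω) → ℝ} (hδ : IsTestSeq δ) :
    ∃ k e : ℕ → ℝ, ∃ k₀ > 0, Tendsto k atTop (𝓝 k₀) ∧ Tendsto e atTop (𝓝 0) ∧
      ∀ᶠ n in atTop, 0 < k n ∧
        Integrable (fun x => k n * |Real.exp (normSum f n x) - Real.exp (nrm P f * u + inn P f b)| *
          |sumTest f (nrm P f * u + inn P f b) n x - δ n x|) (iid (B n) n) ∧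
        ∫ x, k n * |Real.exp (normSum f n x) - Real.exp (nrm P f * u + inn P f b)| *
          |sumTest f (nrm P f * u + inn P f b) n x - δ n x| ∂(iid (B n) n) ≤
        (Phi (-u + nrm P f) - ∫ x, δ n x ∂(iid (D n) n)) +
          k n * Real.exp (nrm P f * u + inn P f b) *
            (∫ x, δ n x ∂(iid (B n) n) - Phi (-u)) + e n := by
  set κ := nrm P f * u + inn P f b with hκ
  obtain ⟨B', ξ', hB', hLR⟩ := hB.exists_expTilt hf hC hf0
  -- The tilt `B'` has the tangent of `D`, so the products are asymptotically indistinguishable, and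
  -- integrals under the tilt are integrals of an explicit function of the sum under `B`.
  obtain ⟨e₁, he₁, hb₁⟩ := hD.exists_iid_bound_of_ae_eq hB' hd
  have hZ := hB.tendsto_expMass_pow hf hC hf0
  set k₀ := (Real.exp (inn P f b + (∫ x, f x ^ 2 ∂P) / 2))⁻¹
  have hk₀ : 0 < k₀ := inv_pos.2 (Real.exp_pos _)
  set k : ℕ → ℝ := fun n => (expMass (B n) f n ^ n)⁻¹ with hk
  have hklim : Tendsto k atTop (𝓝 k₀) := hZ.inv₀ (Real.exp_pos _).ne'
  have hsz := tendsto_size (u := u) hB hf hC hf0 hs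
  have hpw := tendsto_power (u := u) hB hB' hf hC hf0 hs (ae_of_all _ fun x => rfl)
  rw [← hκ] at hsz hpw
  refine ⟨k, fun n => (∫ x, sumTest f κ n x ∂(iid (B' n) n) - Phi (-u + nrm P f)) + e₁ n +
    k n * Real.exp κ * (Phi (-u) - ∫ x, sumTest f κ n x ∂(iid (B n) n)), k₀, hk₀, hklim, ?_, ?_⟩
  · have := ((hpw.sub_const (Phi (-u + nrm P f))).add he₁).add
      ((hklim.mul_const (Real.exp κ)).mul (hsz.const_sub (Phi (-u))))
    simpa using this
  · filter_upwards [hB.prob, hLR, hb₁, hD.prob, hB'.prob] with n hp h1 h2 hpD hpB'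
    have hkn : 0 < k n := inv_pos.2 (pow_pos (expMass_pos hf hC n) n)
    obtain ⟨hi, he⟩ := integral_abs_neymanPearson (μ := iid (B n) n) (measurable_normSum hf n)
      (abs_normSum_le hC n) (isTest_sumTest hf κ n) (hδ n) (κ := κ) (k := k n)
      (fun x hx => by simp [sumTest, hx]) (fun x hx => by simp [sumTest, hx])
    refine ⟨hkn, hi, ?_⟩
    rw [he]
    have e1 : ∀ φ : (Fin n → Ω) → ℝ, ∫ x, Real.exp (normSum f n x) * k n * φ x ∂(iid (B n) n) =
        ∫ x, φ x ∂(iid (B' n) n) := fun φ => by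
      rw [h1 φ]
      simp only [hk, div_eq_mul_inv]
    rw [e1, e1]
    have h3 := (abs_le.1 (h2 _ (hδ n))).2
    linarith

/-- Upper bound for the asymptotic power of tests of a simple null tangent versus a simple
alternative. -/
theorem eventually_power_le (hB : IsQMD P B b ξ) (hD : IsQMD P D d η) (hf : Measurable f)
    (hC : ∀ x, |f x| ≤ C) (hf0 : ∫ x, f x ∂P = 0) (hs : 0 < nrm P f)
    (hd : d =ᵐ[P] fun x => b x + f x) {δ : (n : ℕ) → (Fin n → Ω) → ℝ} (hδ : IsTestSeq δ)
    (hsize : ∀ ε > 0, ∀ᶠ n in atTop, ∫ x, δ n x ∂(iid (B n) n) ≤ Phi (-u) + ε) :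
    ∀ ε > 0, ∀ᶠ n in atTop, ∫ x, δ n x ∂(iid (D n) n) ≤ Phi (-u + nrm P f) + ε := by
  intro ε hε
  obtain ⟨k, e, k₀, hk₀, hk, he, hb⟩ := exists_neymanPearson_bound (u := u) hB hD hf hC hf0 hs hd hδ
  set κ := nrm P f * u + inn P f b with hκ
  have hpos : 0 < 2 * k₀ * Real.exp κ := by positivity
  filter_upwards [hb, hk.eventually_le_const (by linarith : k₀ < 2 * k₀),
    he.eventually_le_const (half_pos hε), hsize (ε / 2 / (2 * k₀ * Real.exp κ))
    (by positivity)] with n h1 h2 h3 h4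
  obtain ⟨hkn, -, hle⟩ := h1
  have h0 : 0 ≤ ∫ x, k n * |Real.exp (normSum f n x) - Real.exp κ| *
      |sumTest f κ n x - δ n x| ∂(iid (B n) n) :=
    integral_nonneg fun x => by positivity
  have h5 : k n * Real.exp κ * (∫ x, δ n x ∂(iid (B n) n) - Phi (-u)) ≤ ε / 2 := by
    have h6 : ∫ x, δ n x ∂(iid (B n) n) - Phi (-u) ≤ ε / 2 / (2 * k₀ * Real.exp κ) := by linarith
    calc _ ≤ k n * Real.exp κ * (ε / 2 / (2 * k₀ * Real.exp κ)) :=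
          mul_le_mul_of_nonneg_left h6 (by positivity)
      _ ≤ (2 * k₀) * Real.exp κ * (ε / 2 / (2 * k₀ * Real.exp κ)) := by gcongr
      _ = ε / 2 := by field_simp
  linarith

/-- Asymptotic uniqueness of optimal tests. -/
theorem asyEquiv_of_power (hB : IsQMD P B b ξ) (hD : IsQMD P D d η) (hbt : IsTangent P b)
    (hf : Measurable f)
    (hC : ∀ x, |f x| ≤ C) (hf0 : ∫ x, f x ∂P = 0) (hs : 0 < nrm P f)
    (hd : d =ᵐ[P] fun x => b x + f x) {δ : (n : ℕ) → (Fin n → Ω) → ℝ} (hδ : IsTestSeq δ)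
    (hsize : ∀ ε > 0, ∀ᶠ n in atTop, ∫ x, δ n x ∂(iid (B n) n) ≤ Phi (-u) + ε)
    (hpower : ∀ ε > 0, ∀ᶠ n in atTop, Phi (-u + nrm P f) - ε ≤ ∫ x, δ n x ∂(iid (D n) n)) :
    AsyEquiv P δ (sumTest f (nrm P f * u + inn P f b)) := by
  intro ε hε
  obtain ⟨k, e, k₀, hk₀, hk, he, hbd⟩ :=
    exists_neymanPearson_bound (u := u) hB hD hf hC hf0 hs hd hδ
  set κ := nrm P f * u + inn P f b with hκ
  have hAm : ∀ n, MeasurableSet {x : Fin n → Ω | ε < |δ n x - sumTest f κ n x|} := fun n =>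
    (((hδ n).1.sub (isTest_sumTest hf κ n).1).norm) measurableSet_Ioi
  -- the weighted distance tends to zero
  set W : ℕ → ℝ := fun n => ∫ x, k n * |Real.exp (normSum f n x) - Real.exp κ| *
      |sumTest f κ n x - δ n x| ∂(iid (B n) n) with hW
  have hpos : 0 < 2 * k₀ * Real.exp κ := by positivity
  have hWle : ∀ ε > 0, ∀ᶠ n in atTop, W n ≤ ε := by
    intro ε hε
    have h3 : 0 < ε / 3 := by positivity
    filter_upwards [hbd, hk.eventually_le_const (by linarith : k₀ < 2 * k₀),
      he.eventually_le_const h3, hsize (ε / 3 / (2 * k₀ * Real.exp κ))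
      (by positivity), hpower (ε / 3) h3] with n h1 h2 h3 h4 h7
    obtain ⟨hkn, -, hle⟩ := h1
    have h5 : k n * Real.exp κ * (∫ x, δ n x ∂(iid (B n) n) - Phi (-u)) ≤ ε / 3 := by
      have h6 : ∫ x, δ n x ∂(iid (B n) n) - Phi (-u) ≤ ε / 3 / (2 * k₀ * Real.exp κ) := by linarith
      calc _ ≤ k n * Real.exp κ * (ε / 3 / (2 * k₀ * Real.exp κ)) :=
            mul_le_mul_of_nonneg_left h6 (by positivity)
        _ ≤ (2 * k₀) * Real.exp κ * (ε / 3 / (2 * k₀ * Real.exp κ)) := by gcongr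
        _ = ε / 3 := by field_simp
    simp only [hW]
    linarith
  have hBlim : Tendsto (fun n => (iid (B n) n).real {x | ε < |δ n x - sumTest f κ n x|}) atTop
      (𝓝 0) := by
    have key : ∀ ε' > 0, ∀ᶠ n in atTop,
        (iid (B n) n).real {x | ε < |δ n x - sumTest f κ n x|} ≤ ε' := by
      intro ε' hε'
      -- a small neighbourhood of the critical value has small probability
      set y := (inn P f b - κ) / nrm P f
      obtain ⟨ζ, hζ, hζ1, hζ2⟩ := exists_Phi_le (y := y) (by positivity : 0 < ε' / 8) (nrm P f)
      have t1 := hB.tendsto_sumTest hf hC hf0 hs (κ - ζ)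
      have t2 := hB.tendsto_sumTest hf hC hf0 hs (κ + ζ)
      have a1 : (inn P f b - (κ - ζ)) / nrm P f = y + ζ / nrm P f := by simp only [y]; ring
      have a2 : (inn P f b - (κ + ζ)) / nrm P f = y - ζ / nrm P f := by simp only [y]; ring
      rw [a1] at t1
      rw [a2] at t2
      set θ := k₀ / 2 * (Real.exp κ * (1 - Real.exp (-ζ))) * ε with hθ
      have hexp : 0 < 1 - Real.exp (-ζ) := by
        rw [sub_pos, ← Real.exp_zero]; exact Real.exp_lt_exp.2 (by linarith)
      have hθ0 : 0 < θ := by positivity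
      filter_upwards [hbd, hB.prob, hk.eventually_const_le (by linarith : k₀ / 2 < k₀),
        hWle (θ * (ε' / 2)) (by positivity),
        t1.eventually_le_const (by linarith : _ < Phi (y + ζ / nrm P f) + ε' / 8),
        t2.eventually_const_le (by linarith : Phi (y - ζ / nrm P f) - ε' / 8 < _)] with
        n h1 hp h2 h3 h4 h5
      obtain ⟨hkn, hi, -⟩ := h1
      rw [integral_sumTest hf] at h4 h5
      set E := {x : Fin n → Ω | ε < |δ n x - sumTest f κ n x|}
      set N := {x : Fin n → Ω | κ - ζ < normSum f n x} \ {x | κ + ζ < normSum f n x}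
      set G := {x : Fin n → Ω | θ ≤ k n * |Real.exp (normSum f n x) - Real.exp κ| *
        |sumTest f κ n x - δ n x|}
      -- Away from the critical value the weight `|exp T - exp κ|` is bounded below, so a deviation
      -- of the tests forces a large weighted difference. The central limit theorem bounds `N`,
      -- Markov's inequality bounds `G`.
      have hsub : E ⊆ N ∪ G := by
        intro x hx
        by_cases hN : x ∈ N
        · exact Or.inl hN
        right
        simp only [N, Set.mem_sdiff, Set.mem_ofPred_eq, not_and, not_not] at hN
        have hx' : ε < |sumTest f κ n x - δ n x| := by rw [abs_sub_comm]; exact hx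
        have hgap : Real.exp κ * (1 - Real.exp (-ζ)) ≤ |Real.exp (normSum f n x) - Real.exp κ| := by
          by_cases hlow : κ - ζ < normSum f n x
          · have hup := hN hlow
            have g1 : Real.exp κ * Real.exp ζ ≤ Real.exp (normSum f n x) := by
              rw [← Real.exp_add]; exact Real.exp_le_exp.2 hup.le
            -- Hence the gap above the critical value, `exp ζ - 1`, is at least the gap below, `1 -
            -- exp (-ζ)`.
            have g2 : 2 ≤ Real.exp ζ + Real.exp (-ζ) := by
              linarith [Real.add_one_le_exp ζ, Real.add_one_le_exp (-ζ)]
            refine le_trans ?_ (le_abs_self _)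
            nlinarith [Real.exp_pos κ]
          · have g1 : Real.exp (normSum f n x) ≤ Real.exp κ * Real.exp (-ζ) := by
              rw [← Real.exp_add]; exact Real.exp_le_exp.2 (by linarith [not_lt.1 hlow])
            rw [abs_sub_comm]
            refine le_trans ?_ (le_abs_self _)
            linarith
        change θ ≤ _
        simp only [hθ]
        gcongr
      have hG : (iid (B n) n).real G ≤ ε' / 2 := by
        have hmk := mul_meas_ge_le_integral_of_nonneg (μ := iid (B n) n)
          (ae_of_all _ fun x => by positivity) hi θ
        have : θ * (iid (B n) n).real G ≤ θ * (ε' / 2) := hmk.trans h3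
        exact le_of_mul_le_mul_left this hθ0
      have hN : (iid (B n) n).real N ≤ ε' / 2 := by
        have hss : {x : Fin n → Ω | κ + ζ < normSum f n x} ⊆ {x | κ - ζ < normSum f n x} := by
          intro x hx
          simp only [Set.mem_ofPred_eq] at hx ⊢
          linarith
        rw [measureReal_sdiff hss (measurableSet_normSum_gt hf _ n)]
        linarith
      calc (iid (B n) n).real E ≤ (iid (B n) n).real (N ∪ G) := measureReal_mono hsub
        _ ≤ (iid (B n) n).real N + (iid (B n) n).real G := measureReal_union_le _ _
        _ ≤ ε' := by linarith
    rw [Metric.tendsto_atTop']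
    intro ε' hε'
    obtain ⟨N, hN⟩ := eventually_atTop.1 (key (ε' / 2) (half_pos hε'))
    refine ⟨N, fun n hn => ?_⟩
    rw [Real.dist_eq, sub_zero, abs_of_nonneg measureReal_nonneg]
    linarith [hN n hn.le]
  have hP := hB.contiguous hbt hAm hBlim
  have := ENNReal.tendsto_ofReal hP
  rw [ENNReal.ofReal_zero] at this
  refine this.congr fun n => ?_
  rw [measureReal_def, ENNReal.ofReal_toReal (measure_ne_top _ _)]

end NeymanPearson

/-! ### Clipping -/

section Clipping

variable {P : Measure Ω} [IsProbabilityMeasure P]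

lemma integrable_pos_part_sub {X : Ω → ℝ} (hX : Integrable X P) (w : ℝ) :
    Integrable (fun x => max (X x - w) 0) P := (hX.sub (integrable_const w)).pos_part

/-- The function `w ↦ E (X - w)₊` is 1-Lipschitz, exceeds `c` at zero and tends to zero, so an
intermediate value exists. If it took the value `c` at `a < b`, then `(X - a)₊ = (X - b)₊` almost
everywhere, which forces `X ≤ a` and `c = 0`. -/
lemma exists_unique_clip {X : Ω → ℝ} (hX : Integrable X P) {c : ℝ} (hc : 0 < c)
    (hcX : c < ∫ x, max (X x) 0 ∂P) :
    ∃ w, 0 < w ∧ ∫ x, max (X x - w) 0 ∂P = c ∧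
      ∀ w', ∫ x, max (X x - w') 0 ∂P = c → w' = w := by
  set U : ℝ → ℝ := fun w => ∫ x, max (X x - w) 0 ∂P with hU
  have hlip : ∀ w w', |U w - U w'| ≤ |w - w'| := fun w w' => by
    simp only [hU]
    rw [← integral_sub (integrable_pos_part_sub hX w) (integrable_pos_part_sub hX w')]
    have := norm_integral_le_of_norm_le_const (μ := P)
      (f := fun x => max (X x - w) 0 - max (X x - w') 0) (C := |w - w'|) (ae_of_all _ fun x => by
        rw [Real.norm_eq_abs]
        refine (abs_max_sub_max_le_abs _ _ _).trans (le_of_eq ?_)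
        rw [abs_sub_comm w w']; congr 1; ring)
    rwa [probReal_univ, mul_one] at this
  have hcont : Continuous U := by
    refine (LipschitzWith.of_dist_le_mul (K := 1) fun w w' => ?_).continuous
    rw [Real.dist_eq, Real.dist_eq, NNReal.coe_one, one_mul]
    exact hlip w w'
  have hlim : Tendsto (fun k : ℕ => U k) atTop (𝓝 0) := by
    have h0 : (0 : ℝ) = ∫ _, (0 : ℝ) ∂P := by simp
    rw [h0]
    refine tendsto_integral_of_dominated_convergence (fun x => |X x|)
      (fun k => (integrable_pos_part_sub hX k).1) hX.abs (fun k => ae_of_all _ fun x => ?_)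
      (ae_of_all _ fun x => ?_)
    · rw [Real.norm_eq_abs, abs_of_nonneg (le_max_right _ _)]
      exact max_le (by linarith [le_abs_self (X x), k.cast_nonneg (α := ℝ)]) (abs_nonneg _)
    · refine tendsto_const_nhds.congr' ?_
      filter_upwards [tendsto_natCast_atTop_atTop.eventually_ge_atTop (X x)] with k hk
      rw [max_eq_right (by linarith)]
  obtain ⟨k, hk⟩ := (hlim.eventually_lt_const hc).exists
  have hU0 : c < U 0 := by simpa [hU] using hcX
  obtain ⟨w, hw, hwc⟩ := intermediate_value_Icc' (k.cast_nonneg (α := ℝ)) hcont.continuousOn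
    ⟨hk.le, hU0.le⟩
  have hw0 : 0 < w := lt_of_le_of_ne hw.1 fun h => by rw [← h] at hwc; linarith
  have huniq : ∀ a b, a < b → U a = c → U b = c → False := by
    intro a b hab ha hb
    have hle : ∀ x, 0 ≤ max (X x - a) 0 - max (X x - b) 0 := fun x =>
      sub_nonneg.2 (max_le_max (by linarith) le_rfl)
    have hz : ∫ x, (max (X x - a) 0 - max (X x - b) 0) ∂P = 0 := by
      rw [integral_sub (integrable_pos_part_sub hX a) (integrable_pos_part_sub hX b)]
      simp only [hU] at ha hb
      rw [ha, hb, sub_self]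
    have hae := (integral_eq_zero_iff_of_nonneg hle
      ((integrable_pos_part_sub hX a).sub (integrable_pos_part_sub hX b))).1 hz
    have : U a = 0 := by
      refine integral_eq_zero_of_ae ?_
      filter_upwards [hae] with x hx
      simp only [Pi.zero_apply] at hx ⊢
      by_contra hne
      have hpos : 0 < X x - a := by
        by_contra hn
        exact hne (max_eq_right (not_lt.1 hn))
      rw [max_eq_left hpos.le] at hx
      rcases le_total (X x - b) 0 with h | h
      · rw [max_eq_right h] at hx; linarith
      · rw [max_eq_left h] at hx; linarith
    linarith
  refine ⟨w, hw0, hwc, fun w' hw' => ?_⟩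
  rcases lt_trichotomy w' w with h | h | h
  · exact (huniq _ _ h hw' hwc).elim
  · exact h
  · exact (huniq _ _ h hwc hw').elim

lemma integral_pos_part_of_tangent {g : Ω → ℝ} (hg : IsTangent P g) :
    ∫ x, max (g x) 0 ∂P = (∫ x, |g x| ∂P) / 2 ∧ ∫ x, max (-g x) 0 ∂P = (∫ x, |g x| ∂P) / 2 := by
  have hi : Integrable g P := hg.2.1.integrable one_le_two
  have e1 : ∀ x, max (g x) 0 = |g x| / 2 + g x / 2 := fun x => by
    rcases le_total 0 (g x) with h | h
    · rw [max_eq_left h, abs_of_nonneg h]; ring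
    · rw [max_eq_right h, abs_of_nonpos h]; ring
  have e2 : ∀ x, max (-g x) 0 = |g x| / 2 - g x / 2 := fun x => by
    rcases le_total 0 (g x) with h | h
    · rw [max_eq_right (by linarith), abs_of_nonneg h]; ring
    · rw [max_eq_left (by linarith), abs_of_nonpos h]; ring
  simp_rw [e1, e2]
  rw [integral_add (hi.abs.div_const 2) (hi.div_const 2),
    integral_sub (hi.abs.div_const 2) (hi.div_const 2), integral_div, integral_div, hg.2.2]
  constructor <;> ring

/-- The situation of the theorem: `Λ` are scores, the radii are small, and `v', v''` solve the
clipping equations. -/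
structure ClipData (P : Measure Ω) (Λ : Ω → ℝ) (τ r v' v'' : ℝ) : Prop where
  tangent : IsTangent P Λ
  tau_pos : 0 < τ
  r_pos : 0 < r
  neg : v' < 0
  pos : 0 < v''
  lower : τ * ∫ x, max (v' - Λ x) 0 ∂P = r
  upper : τ * ∫ x, max (Λ x - v'') 0 ∂P = r

/-- As `E Λ = 0`, both parts of `Λ` have mass `E|Λ| / 2`; the smallness condition says that the
required `r / τ` lies strictly below it. The lower equation is the upper one for `-Λ`. -/
lemma exists_clipData {Λ : Ω → ℝ} (hΛ : IsTangent P Λ) {τ r : ℝ} (hr : 0 < r)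
    (hsmall : 2 * r < τ * ∫ x, |Λ x| ∂P) :
    ∃ v' v'', ClipData P Λ τ r v' v'' ∧ ∀ w' w'',
      (τ * ∫ x, max (w' - Λ x) 0 ∂P = r ∧ τ * ∫ x, max (Λ x - w'') 0 ∂P = r) ↔
        w' = v' ∧ w'' = v'' := by
  have hτ : 0 < τ := by
    by_contra h
    have : 0 ≤ ∫ x, |Λ x| ∂P := integral_nonneg fun x => abs_nonneg _
    nlinarith
  have hi : Integrable Λ P := hΛ.2.1.integrable one_le_two
  obtain ⟨h1, h2⟩ := integral_pos_part_of_tangent hΛ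
  have hc : r / τ < (∫ x, |Λ x| ∂P) / 2 := by rw [div_lt_iff₀ hτ]; linarith
  have hc0 : 0 < r / τ := div_pos hr hτ
  obtain ⟨v, hv, hvc, hvu⟩ := exists_unique_clip hi hc0 (by rw [h1]; exact hc)
  obtain ⟨w, hw, hwc, hwu⟩ := exists_unique_clip (X := fun x => -Λ x) hi.neg hc0
    (by rw [h2]; exact hc)
  have hiff : ∀ I : ℝ, τ * I = r ↔ I = r / τ := fun I => by
    rw [eq_div_iff hτ.ne', mul_comm]
  have hlow : ∀ a x, max (a - Λ x) 0 = max (-Λ x - -a) 0 := fun a x => by congr 1; ring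
  refine ⟨-w, v, ⟨hΛ, hτ, hr, by linarith, hv, ?_, ?_⟩, fun w' w'' => ?_⟩
  · rw [hiff]; simp_rw [hlow, neg_neg]; exact hwc
  · rw [hiff]; exact hvc
  · rw [hiff, hiff]
    simp_rw [hlow]
    constructor
    · rintro ⟨ha, hb⟩
      have := hwu _ ha
      exact ⟨by linarith, hvu _ hb⟩
    · rintro ⟨rfl, rfl⟩
      exact ⟨by simpa using hwc, hvc⟩

/-- The tangent `g̃_v`. -/
def extremeTangent (Λ : Ω → ℝ) (τ r v' v'' : ℝ) (x : Ω) : ℝ :=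
  (τ * max (Λ x - v'') 0 - τ * max (v' - Λ x) 0) / r

namespace ClipData

variable {Λ : Ω → ℝ} {τ r v' v'' : ℝ}

lemma mul_extremeTangent (h : ClipData P Λ τ r v' v'') (x : Ω) :
    r * extremeTangent Λ τ r v' v'' x = τ * max (Λ x - v'') 0 - τ * max (v' - Λ x) 0 := by
  rw [extremeTangent, mul_div_cancel₀ _ h.r_pos.ne']

lemma clip_eq (h : ClipData P Λ τ r v' v'') (x : Ω) :
    clip Λ v' v'' x = Λ x + max (v' - Λ x) 0 - max (Λ x - v'') 0 := by
  have h1 := h.neg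
  have h2 := h.pos
  unfold clip
  rcases le_total (Λ x) v'' with ha | ha
  · rw [min_eq_left ha, max_eq_right (by linarith : Λ x - v'' ≤ 0)]
    rcases le_total (Λ x) v' with hb | hb
    · rw [max_eq_left hb, max_eq_left (by linarith)]; ring
    · rw [max_eq_right hb, max_eq_right (by linarith)]; ring
  · rw [min_eq_right ha, max_eq_right (by linarith : v' ≤ v''), max_eq_right (by linarith),
      max_eq_left (by linarith)]
    ring

/-- This explains the form of `extremeTangent`: it carries just the part of the score beyond the
clipping levels. What is left is bounded, as tilting and the tests require. -/
lemma score_sub (h : ClipData P Λ τ r v' v'') (x : Ω) :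
    τ * Λ x - r * extremeTangent Λ τ r v' v'' x = τ * clip Λ v' v'' x := by
  rw [h.mul_extremeTangent, h.clip_eq]; ring

lemma measurable_clip (h : ClipData P Λ τ r v' v'') : Measurable (clip Λ v' v'') :=
  measurable_const.max (h.tangent.1.min measurable_const)

lemma clip_le (h : ClipData P Λ τ r v' v'') (x : Ω) : clip Λ v' v'' x ≤ v'' :=
  max_le (by linarith [h.neg, h.pos]) (min_le_right _ _)

lemma le_clip (x : Ω) : v' ≤ clip Λ v' v'' x := le_max_left _ _

lemma abs_clip_le (h : ClipData P Λ τ r v' v'') (x : Ω) : |clip Λ v' v'' x| ≤ v'' - v' := by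
  rw [abs_le]
  constructor <;> linarith [h.neg, h.pos, h.clip_le x, le_clip (Λ := Λ) (v' := v') (v'' := v'') x]

lemma memLp_clip (h : ClipData P Λ τ r v' v'') : MemLp (clip Λ v' v'') 2 P :=
  MemLp.of_bound h.measurable_clip.aestronglyMeasurable _ (ae_of_all _ h.abs_clip_le)

lemma integrable_score (h : ClipData P Λ τ r v' v'') : Integrable Λ P :=
  h.tangent.2.1.integrable one_le_two

lemma integrable_upper (h : ClipData P Λ τ r v' v'') :
    Integrable (fun x => max (Λ x - v'') 0) P := integrable_pos_part_sub h.integrable_score _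

lemma integrable_lower (h : ClipData P Λ τ r v' v'') :
    Integrable (fun x => max (v' - Λ x) 0) P :=
  ((integrable_const v').sub h.integrable_score).pos_part

lemma measurable_extremeTangent (h : ClipData P Λ τ r v' v'') :
    Measurable (extremeTangent Λ τ r v' v'') := by
  have := h.tangent.1
  unfold extremeTangent
  fun_prop

lemma extremeTangent_eq (h : ClipData P Λ τ r v' v'') (x : Ω) :
    extremeTangent Λ τ r v' v'' x = (τ / r) * (Λ x - clip Λ v' v'' x) := by
  rw [extremeTangent, h.clip_eq]; ring

lemma memLp_extremeTangent (h : ClipData P Λ τ r v' v'') :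
    MemLp (extremeTangent Λ τ r v' v'') 2 P := by
  have : extremeTangent Λ τ r v' v'' = fun x => (τ / r) * (Λ x - clip Λ v' v'' x) :=
    funext h.extremeTangent_eq
  rw [this]
  exact (h.tangent.2.1.sub h.memLp_clip).const_mul _

lemma isTangent_extremeTangent (h : ClipData P Λ τ r v' v'') :
    IsTangent P (extremeTangent Λ τ r v' v'') := by
  refine ⟨h.measurable_extremeTangent, h.memLp_extremeTangent, ?_⟩
  unfold extremeTangent
  rw [integral_div, integral_sub (h.integrable_upper.const_mul _) (h.integrable_lower.const_mul _),
    integral_const_mul, integral_const_mul, h.upper, h.lower, sub_self, zero_div]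

lemma extremeTangent_mem (h : ClipData P Λ τ r v' v'') :
    extremeTangent Λ τ r v' v'' ∈ tangentBall P := by
  refine ⟨h.isTangent_extremeTangent, ?_⟩
  have hle : ∀ x, |extremeTangent Λ τ r v' v'' x| ≤
      (τ * max (Λ x - v'') 0 + τ * max (v' - Λ x) 0) / r := fun x => by
    have h1 : 0 ≤ τ * max (Λ x - v'') 0 := mul_nonneg h.tau_pos.le (le_max_right _ _)
    have h2 : 0 ≤ τ * max (v' - Λ x) 0 := mul_nonneg h.tau_pos.le (le_max_right _ _)
    rw [extremeTangent, abs_div, abs_of_pos h.r_pos]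
    refine div_le_div_of_nonneg_right ?_ h.r_pos.le
    rw [abs_le]; constructor <;> linarith
  calc ∫ x, |extremeTangent Λ τ r v' v'' x| ∂P
      ≤ ∫ x, (τ * max (Λ x - v'') 0 + τ * max (v' - Λ x) 0) / r ∂P :=
        integral_mono (h.memLp_extremeTangent.integrable one_le_two).abs
          (((h.integrable_upper.const_mul _).add (h.integrable_lower.const_mul _)).div_const _) hle
    _ = 2 := by
        rw [integral_div, integral_add (h.integrable_upper.const_mul _)
          (h.integrable_lower.const_mul _), integral_const_mul, integral_const_mul, h.upper,
          h.lower, div_eq_iff h.r_pos.ne']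
        ring

lemma integral_clip (h : ClipData P Λ τ r v' v'') : ∫ x, clip Λ v' v'' x ∂P = 0 := by
  have h1 := h.upper
  have h2 := h.lower
  simp_rw [h.clip_eq]
  rw [integral_sub (h.integrable_score.fun_add h.integrable_lower) h.integrable_upper,
    integral_add h.integrable_score h.integrable_lower, h.tangent.2.2, zero_add]
  have : τ * (∫ x, max (v' - Λ x) 0 ∂P - ∫ x, max (Λ x - v'') 0 ∂P) = 0 := by
    rw [mul_sub, h1, h2, sub_self]
  exact (mul_eq_zero.1 this).resolve_left h.tau_pos.ne'

lemma integrable_clip_mul (h : ClipData P Λ τ r v' v'') {g : Ω → ℝ} (hg : MemLp g 2 P) :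
    Integrable (fun x => clip Λ v' v'' x * g x) P := h.memLp_clip.integrable_mul hg

/-- The positive and negative parts of `g` each have mass at most one; the clipped function is at
most `v''` on the first and at least `v'` on the second. -/
lemma inn_clip_le (h : ClipData P Λ τ r v' v'') {g : Ω → ℝ} (hg : g ∈ tangentBall P) :
    inn P (clip Λ v' v'') g ≤ v'' - v' := by
  obtain ⟨h1, h2⟩ := integral_pos_part_of_tangent hg.1
  have hi : Integrable g P := hg.1.2.1.integrable one_le_two
  have hle : ∀ x, clip Λ v' v'' x * g x ≤ v'' * max (g x) 0 - v' * max (-g x) 0 := fun x => by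
    have a1 := h.clip_le x
    have a2 := le_clip (Λ := Λ) (v' := v') (v'' := v'') x
    rcases le_total 0 (g x) with hx | hx
    · rw [max_eq_left hx, max_eq_right (by linarith : -g x ≤ 0)]; nlinarith
    · rw [max_eq_right hx, max_eq_left (by linarith : 0 ≤ -g x)]; nlinarith
  have hneg : Integrable (fun x => max (-g x) 0) P := hi.neg.pos_part
  calc inn P (clip Λ v' v'') g ≤ ∫ x, (v'' * max (g x) 0 - v' * max (-g x) 0) ∂P :=
        integral_mono (h.integrable_clip_mul hg.1.2.1)
          ((hi.pos_part.const_mul _).sub (hneg.const_mul _)) hle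
    _ = (v'' - v') * ((∫ x, |g x| ∂P) / 2) := by
        rw [integral_sub (hi.pos_part.const_mul _) (hneg.const_mul _), integral_const_mul,
          integral_const_mul, h1, h2]; ring
    _ ≤ v'' - v' := by
        have := hg.2
        nlinarith [h.neg, h.pos]

lemma neg_le_inn_clip (h : ClipData P Λ τ r v' v'') {g : Ω → ℝ} (hg : g ∈ tangentBall P) :
    -(v'' - v') ≤ inn P (clip Λ v' v'') g := by
  have hn : (fun x => -g x) ∈ tangentBall P :=
    ⟨⟨hg.1.1.neg, hg.1.2.1.neg, by rw [integral_neg, hg.1.2.2, neg_zero]⟩, by simpa using hg.2⟩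
  have h1 := h.inn_clip_le hn
  have e : inn P (clip Λ v' v'') (fun x => -g x) = -inn P (clip Λ v' v'') g := by
    simp only [inn, mul_neg, integral_neg]
  linarith

/-- The case of equality in `inn_clip_le`: the clipped function equals `v''` where the tangent is
positive and `v'` where it is negative, and both parts have mass one. -/
lemma inn_clip_extremeTangent (h : ClipData P Λ τ r v' v'') :
    inn P (clip Λ v' v'') (extremeTangent Λ τ r v' v'') = v'' - v' := by
  have e : ∀ x, clip Λ v' v'' x * extremeTangent Λ τ r v' v'' x =
      (v'' * (τ * max (Λ x - v'') 0) - v' * (τ * max (v' - Λ x) 0)) / r := fun x => by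
    have h1 := h.neg
    have h2 := h.pos
    unfold clip extremeTangent
    rcases le_total (Λ x) v'' with ha | ha
    · rw [min_eq_left ha, max_eq_right (by linarith : Λ x - v'' ≤ 0)]
      rcases le_total (Λ x) v' with hb | hb
      · rw [max_eq_left hb]; ring
      · rw [max_eq_right (by linarith : v' - Λ x ≤ 0)]; ring
    · rw [min_eq_right ha, max_eq_right (by linarith : v' ≤ v''),
        max_eq_right (by linarith : v' - Λ x ≤ 0)]
      ring
  simp only [inn, e]
  rw [integral_div, integral_sub ((h.integrable_upper.const_mul _).const_mul _)
    ((h.integrable_lower.const_mul _).const_mul _), integral_const_mul, integral_const_mul,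
    integral_const_mul, integral_const_mul, h.upper, h.lower, div_eq_iff h.r_pos.ne']
  ring

lemma inn_clip_score (h : ClipData P Λ τ r v' v'') :
    inn P (clip Λ v' v'') (fun x => τ * Λ x) =
      τ * nrm P (clip Λ v' v'') ^ 2 + r * (v'' - v') := by
  rw [← h.inn_clip_extremeTangent, nrm_sq, inn, inn, ← integral_const_mul, ← integral_const_mul,
    ← integral_add (h.memLp_clip.integrable_sq.const_mul _)
      ((h.integrable_clip_mul h.memLp_extremeTangent).const_mul _)]
  refine integral_congr_ae (ae_of_all _ fun x => ?_)
  have := h.score_sub x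
  dsimp only
  have e : τ * Λ x = τ * clip Λ v' v'' x + r * extremeTangent Λ τ r v' v'' x := by linarith
  rw [e]; ring

/-- If the clipped function vanished, `Λ` could not exceed `v'' > 0`, and the upper clipping
equation would read `0 = r`. -/
lemma nrm_clip_pos (h : ClipData P Λ τ r v' v'') : 0 < nrm P (clip Λ v' v'') := by
  refine lt_of_le_of_ne (nrm_nonneg _ _) fun h0 => ?_
  have h1 : ∫ x, clip Λ v' v'' x ^ 2 ∂P = 0 := by rw [← nrm_sq, ← h0]; ring
  have h2 := (integral_eq_zero_iff_of_nonneg (fun x => sq_nonneg _)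
    h.memLp_clip.integrable_sq).1 h1
  have h3 : ∫ x, max (Λ x - v'') 0 ∂P = 0 := by
    refine integral_eq_zero_of_ae ?_
    filter_upwards [h2] with x hx
    have hx0 : clip Λ v' v'' x = 0 := pow_eq_zero_iff two_ne_zero |>.1 hx
    have : Λ x ≤ v'' := by
      by_contra hlt
      have : clip Λ v' v'' x = v'' := by
        unfold clip
        rw [min_eq_right (not_le.1 hlt).le, max_eq_right (by linarith [h.neg, h.pos])]
      linarith [h.pos]
    exact max_eq_right (by linarith)
  have h4 := h.upper
  rw [h3, mul_zero] at h4
  linarith [h.r_pos]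

end ClipData

end Clipping

/-! ### Local alternatives -/

lemma integral_mul_add_of_memLp {P : Measure Ω} {f g h : Ω → ℝ} (hf : MemLp f 2 P)
    (hg : MemLp g 2 P) (hh : MemLp h 2 P) : inn P f (fun x => g x + h x) = inn P f g + inn P f h := by
  have i1 : Integrable (fun x => f x * g x) P := hf.integrable_mul hg
  have i2 : Integrable (fun x => f x * h x) P := hf.integrable_mul hh
  simp only [inn, mul_add]
  exact integral_add i1 i2

lemma inn_const_mul_right (P : Measure Ω) (f g : Ω → ℝ) (c : ℝ) :
    inn P f (fun x => c * g x) = c * inn P f g := by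
  simp only [inn]
  rw [← integral_const_mul]
  exact integral_congr_ae (ae_of_all _ fun x => by dsimp only; ring)

lemma inn_const_mul_left (P : Measure Ω) (f g : Ω → ℝ) (c : ℝ) :
    inn P (fun x => c * f x) g = c * inn P f g := by
  simp only [inn]
  rw [← integral_const_mul]
  exact integral_congr_ae (ae_of_all _ fun x => by dsimp only; ring)

lemma nrm_const_mul (P : Measure Ω) (f : Ω → ℝ) {c : ℝ} (hc : 0 ≤ c) :
    nrm P (fun x => c * f x) = c * nrm P f := by
  simp only [nrm, mul_pow]
  rw [integral_const_mul, Real.sqrt_mul (sq_nonneg c), Real.sqrt_sq hc]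

lemma normSum_const_mul (f : Ω → ℝ) (c : ℝ) (n : ℕ) (x : Fin n → Ω) :
    normSum (fun y => c * f y) n x = c * normSum f n x := by
  simp only [normSum, ← Finset.mul_sum]; ring

lemma IsTangent.const_mul {P : Measure Ω} {g : Ω → ℝ} (hg : IsTangent P g) (c : ℝ) :
    IsTangent P fun x => c * g x :=
  ⟨hg.1.const_mul c, hg.2.1.const_mul c, by rw [integral_const_mul, hg.2.2, mul_zero]⟩

section LocalAlternatives

variable {P : Measure Ω} [IsProbabilityMeasure P]

lemma IsTangent.add {g h : Ω → ℝ} (hg : IsTangent P g) (hh : IsTangent P h) :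
    IsTangent P fun x => g x + h x :=
  ⟨hg.1.add hh.1, hg.2.1.add hh.2.1, by
    rw [integral_add (hg.2.1.integrable one_le_two) (hh.2.1.integrable one_le_two), hg.2.2, hh.2.2,
      add_zero]⟩

lemma neg_mem_tangentBall {g : Ω → ℝ} (hg : g ∈ tangentBall P) :
    (fun x => -g x) ∈ tangentBall P :=
  ⟨⟨hg.1.1.neg, hg.1.2.1.neg, by rw [integral_neg, hg.1.2.2, neg_zero]⟩, by simpa using hg.2⟩

lemma isTangent_of_mem_nullTangents {r₀ : ℝ} {g : Ω → ℝ} (hg : g ∈ nullTangents P r₀) :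
    IsTangent P g := by
  obtain ⟨k, hk, rfl⟩ := hg
  exact hk.1.const_mul r₀

lemma isTangent_of_mem_altTangents {Λ : Ω → ℝ} (hΛ : IsTangent P Λ) {τ r₁ : ℝ} {g : Ω → ℝ}
    (hg : g ∈ altTangents P Λ τ r₁) : IsTangent P g := by
  obtain ⟨k, hk, rfl⟩ := hg
  exact (hΛ.const_mul τ).add (hk.1.const_mul r₁)

variable {A : (Ω → ℝ) → ℕ → Measure Ω}

lemma IsLocalAlternatives.isQMD (hA : IsLocalAlternatives P A) {g : Ω → ℝ} (hg : IsTangent P g) :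
    IsQMD P (A g) g (fun n => densRoot P (A g n)) := by
  obtain ⟨h1, h2⟩ := hA g hg
  refine isQMD_of_remainder hg.2.1 h1 ?_
  have h3 := h2.tendsto_div_nhds_zero
  refine h3.congr fun n => ?_
  rw [div_div_eq_mul_div, div_one, mul_comm]

lemma eventually_integral_mem (hA : IsLocalAlternatives P A) {g : Ω → ℝ} (hg : IsTangent P g)
    {δ : (n : ℕ) → (Fin n → Ω) → ℝ} (hδ : IsTestSeq δ) :
    (∀ᶠ n in atTop, 0 ≤ ∫ x, δ n x ∂(iid (A g n) n)) ∧
      ∀ᶠ n in atTop, ∫ x, δ n x ∂(iid (A g n) n) ≤ 1 := by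
  constructor
  · filter_upwards with n
    exact IsTest.integral_nonneg (hδ n) _
  · filter_upwards [(hA g hg).1] with n hn
    exact IsTest.integral_le_one (hδ n) _

lemma asyPower_nonneg (hA : IsLocalAlternatives P A) {g : Ω → ℝ} (hg : IsTangent P g)
    {δ : (n : ℕ) → (Fin n → Ω) → ℝ} (hδ : IsTestSeq δ) : 0 ≤ asyPower A δ g := by
  obtain ⟨h0, h1⟩ := eventually_integral_mem hA hg hδ
  refine le_liminf_of_forall h1 fun ε hε => ?_
  filter_upwards [h0] with n hn
  linarith

lemma tendsto_sumTest_alternatives (hA : IsLocalAlternatives P A) {g : Ω → ℝ}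
    (hg : IsTangent P g) {f : Ω → ℝ} {C : ℝ} (hf : Measurable f) (hC : ∀ x, |f x| ≤ C)
    (hf0 : ∫ x, f x ∂P = 0) (hs : 0 < nrm P f) (c : ℝ) :
    asySize A (sumTest f c) g = Phi ((inn P f g - c) / nrm P f) ∧
      asyPower A (sumTest f c) g = Phi ((inn P f g - c) / nrm P f) :=
  ⟨((hA.isQMD hg).tendsto_sumTest hf hC hf0 hs c).limsup_eq,
    ((hA.isQMD hg).tendsto_sumTest hf hC hf0 hs c).liminf_eq⟩

lemma asyPower_le (hA : IsLocalAlternatives P A) {a d f : Ω → ℝ} {C u : ℝ} (ha : IsTangent P a)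
    (hd : IsTangent P d) (hf : Measurable f) (hC : ∀ x, |f x| ≤ C)
    (hf0 : ∫ x, f x ∂P = 0) (hs : 0 < nrm P f) (hda : d =ᵐ[P] fun x => a x + f x)
    {δ : (n : ℕ) → (Fin n → Ω) → ℝ} (hδ : IsTestSeq δ) (hsize : asySize A δ a ≤ Phi (-u)) :
    asyPower A δ d ≤ Phi (-u + nrm P f) := by
  refine liminf_le_of_forall (eventually_integral_mem hA hd hδ).1 ?_
  exact eventually_power_le (hA.isQMD ha) (hA.isQMD hd) hf hC hf0 hs hda hδ fun ε hε =>
    eventually_le_of_limsup_le (eventually_integral_mem hA ha hδ).2 hsize hε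

/-- A test of level `α` for the simple problem `a` vs. `d` with power exceeding `Φ(-u + t)`, when
`t < ‖d - a‖`. -/
lemma exists_test_of_lt_nrm (hA : IsLocalAlternatives P A) {a d : Ω → ℝ} {t u : ℝ}
    (ha : IsTangent P a) (hd : IsTangent P d) (ht : 0 ≤ t) (htn : t < nrm P fun x => d x - a x) :
    ∃ δ : (n : ℕ) → (Fin n → Ω) → ℝ, IsTestSeq δ ∧ asySize A δ a ≤ Phi (-u) ∧
      Phi (-u + t) < asyPower A δ d := by
  set h : Ω → ℝ := fun x => d x - a x with hh
  have hht : IsTangent P h := ⟨hd.1.sub ha.1, hd.2.1.sub ha.2.1, by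
    simp only [hh]
    rw [integral_sub (hd.2.1.integrable one_le_two) (ha.2.1.integrable one_le_two), hd.2.2, ha.2.2,
      sub_zero]⟩
  set N := nrm P h with hN
  -- a bounded approximation of the difference
  have hε : 0 < ((N - t) / 3) ^ 2 := by have : 0 < N - t := by linarith
                                        positivity
  obtain ⟨f, C, hf, hC, hf0, hfh⟩ := exists_bounded_approx hht hε
  have hfL : MemLp f 2 P := MemLp.of_bound hf.aestronglyMeasurable C (ae_of_all _ hC)
  set e := Real.sqrt (∫ x, (f x - h x) ^ 2 ∂P) with he
  have he1 : e < (N - t) / 3 := by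
    rw [he, Real.sqrt_lt' (by linarith)]; exact hfh
  have he2 : e ^ 2 = ∫ x, (f x - h x) ^ 2 ∂P := Real.sq_sqrt (integral_nonneg fun x => sq_nonneg _)
  have he0 : 0 ≤ e := Real.sqrt_nonneg _
  set s := nrm P f with hs
  have ifh : Integrable (fun x => f x * h x) P := hfL.integrable_mul hht.2.1
  have hexp : e ^ 2 = s ^ 2 - 2 * inn P f h + N ^ 2 := by
    rw [he2, hs, hN, nrm_sq, nrm_sq, inn, ← integral_const_mul,
      ← integral_sub hfL.integrable_sq (ifh.const_mul 2),
      ← integral_add (integrable_fun_sub hfL.integrable_sq (ifh.const_mul 2)) hht.2.1.integrable_sq]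
    exact integral_congr_ae (ae_of_all _ fun x => by dsimp only; ring)
  have hcs : inn P f h ≤ s * N := by
    have := abs_integral_mul_le_sqrt hfL hht.2.1
    exact (integral_mono ifh ifh.abs fun x => le_abs_self _).trans this
  have hs0 : 0 ≤ s := nrm_nonneg _ _
  have hN0 : 0 ≤ N := nrm_nonneg _ _
  -- The reverse triangle inequality, from the expansion of `e ^ 2` and Cauchy-Schwarz.
  have hsN : (s - N) ^ 2 ≤ e ^ 2 := by nlinarith
  have hsN' := abs_le.1 (abs_le_of_sq_le_sq hsN he0)
  have hspos : 0 < s := by nlinarith [hsN'.1]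
  -- the correlation is nearly one
  have hcorr : t * s < inn P f h := by nlinarith [hsN'.1, hsN'.2]
  refine ⟨sumTest f (s * u + inn P f a), isTestSeq_sumTest hf _, ?_, ?_⟩
  · rw [(tendsto_sumTest_alternatives hA ha hf hC hf0 hspos _).1]
    refine le_of_eq ?_
    congr 1
    rw [← hs, div_eq_iff hspos.ne']
    ring
  · rw [(tendsto_sumTest_alternatives hA hd hf hC hf0 hspos _).2]
    refine Phi_strictMono ?_
    have e1 : inn P f d = inn P f a + inn P f h := by
      rw [← integral_mul_add_of_memLp hfL ha.2.1 hht.2.1]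
      congr 1; ext x; simp only [hh]; ring
    rw [e1, lt_div_iff₀ hspos]
    linarith

end LocalAlternatives

/-! ### The maxmin problem for total variation tangent balls -/

namespace ClipData

variable {P : Measure Ω} [IsProbabilityMeasure P] {Λ : Ω → ℝ} {τ r₀ r₁ v' v'' u : ℝ}
  {A : (Ω → ℝ) → ℕ → Measure Ω}

/-- The critical value of the test based on `τ Λ^{(v)}`. -/
def crit (P : Measure Ω) (Λ : Ω → ℝ) (τ r₀ v' v'' u : ℝ) : ℝ :=
  τ * (nrm P (clip Λ v' v'') * u + r₀ * (v'' - v'))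

/-- The optimal test. -/
def optTest (P : Measure Ω) (Λ : Ω → ℝ) (τ r₀ v' v'' u : ℝ) : (n : ℕ) → (Fin n → Ω) → ℝ :=
  sumTest (fun x => τ * clip Λ v' v'' x) (crit P Λ τ r₀ v' v'' u)

lemma measurable_diff (h : ClipData P Λ τ (r₀ + r₁) v' v'') : Measurable fun x => τ * clip Λ v' v'' x := h.measurable_clip.const_mul τ

lemma abs_diff_le (h : ClipData P Λ τ (r₀ + r₁) v' v'') (x : Ω) : |τ * clip Λ v' v'' x| ≤ τ * (v'' - v') := by
  rw [abs_mul, abs_of_pos h.tau_pos]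
  exact mul_le_mul_of_nonneg_left (h.abs_clip_le x) h.tau_pos.le

lemma integral_diff (h : ClipData P Λ τ (r₀ + r₁) v' v'') : ∫ x, τ * clip Λ v' v'' x ∂P = 0 := by
  rw [integral_const_mul, h.integral_clip, mul_zero]

lemma nrm_diff (h : ClipData P Λ τ (r₀ + r₁) v' v'') : nrm P (fun x => τ * clip Λ v' v'' x) = τ * nrm P (clip Λ v' v'') :=
  nrm_const_mul P _ h.tau_pos.le

lemma nrm_diff_pos (h : ClipData P Λ τ (r₀ + r₁) v' v'') : 0 < nrm P (fun x => τ * clip Λ v' v'' x) := by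
  rw [h.nrm_diff]; exact mul_pos h.tau_pos h.nrm_clip_pos

lemma isTestSeq_optTest (h : ClipData P Λ τ (r₀ + r₁) v' v'') : IsTestSeq (optTest P Λ τ r₀ v' v'' u) := isTestSeq_sumTest h.measurable_diff _

lemma inn_diff_le (h : ClipData P Λ τ (r₀ + r₁) v' v'') {g : Ω → ℝ} (hr₀ : 0 ≤ r₀) (hg : g ∈ nullTangents P r₀) :
    inn P (fun x => τ * clip Λ v' v'' x) g ≤ τ * (r₀ * (v'' - v')) := by
  obtain ⟨k, hk, rfl⟩ := hg
  rw [inn_const_mul_left, inn_const_mul_right]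
  exact mul_le_mul_of_nonneg_left (mul_le_mul_of_nonneg_left (h.inn_clip_le hk) hr₀) h.tau_pos.le

/-- Together with `inn_diff_le`: over the null tangents the asymptotic drift of the sum is at most,
over the alternatives at least, its value at the least favorable pair. The two values are separated
by the squared norm of the difference, so the standardized separation is that norm. -/
lemma le_inn_diff (h : ClipData P Λ τ (r₀ + r₁) v' v'') {g : Ω → ℝ} (hr₁ : 0 ≤ r₁) (hg : g ∈ altTangents P Λ τ r₁) :
    (τ * nrm P (clip Λ v' v'')) ^ 2 + τ * (r₀ * (v'' - v')) ≤
      inn P (fun x => τ * clip Λ v' v'' x) g := by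
  obtain ⟨k, hk, rfl⟩ := hg
  rw [inn_const_mul_left, integral_mul_add_of_memLp h.memLp_clip (h.tangent.2.1.const_mul τ)
    (hk.1.2.1.const_mul r₁), h.inn_clip_score, inn_const_mul_right]
  have h1 := mul_le_mul_of_nonneg_left (h.neg_le_inn_clip hk) hr₁
  have h2 := mul_le_mul_of_nonneg_left h1 h.tau_pos.le
  nlinarith

lemma hasAsyLevel_optTest (h : ClipData P Λ τ (r₀ + r₁) v' v'') (hA : IsLocalAlternatives P A) (hr₀ : 0 ≤ r₀) :
    HasAsyLevel A (Phi (-u)) (nullTangents P r₀) (optTest P Λ τ r₀ v' v'' u) := by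
  intro g hg
  rw [optTest, (tendsto_sumTest_alternatives hA (isTangent_of_mem_nullTangents hg) h.measurable_diff
    h.abs_diff_le h.integral_diff h.nrm_diff_pos _).1]
  refine Phi_strictMono.monotone ?_
  rw [div_le_iff₀ h.nrm_diff_pos, h.nrm_diff, crit]
  have := h.inn_diff_le hr₀ hg
  nlinarith

lemma le_asyPower_optTest (h : ClipData P Λ τ (r₀ + r₁) v' v'') (hA : IsLocalAlternatives P A) (hr₁ : 0 ≤ r₁) {g : Ω → ℝ}
    (hg : g ∈ altTangents P Λ τ r₁) :
    Phi (-u + τ * nrm P (clip Λ v' v'')) ≤ asyPower A (optTest P Λ τ r₀ v' v'' u) g := by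
  rw [optTest, (tendsto_sumTest_alternatives hA (isTangent_of_mem_altTangents h.tangent hg)
    h.measurable_diff h.abs_diff_le h.integral_diff h.nrm_diff_pos _).2]
  refine Phi_strictMono.monotone ?_
  rw [le_div_iff₀ h.nrm_diff_pos, h.nrm_diff, crit]
  have := h.le_inn_diff hr₁ hg
  nlinarith

lemma asyPower_le_of_diff (h : ClipData P Λ τ (r₀ + r₁) v' v'') (hA : IsLocalAlternatives P A) {a d : Ω → ℝ} (ha : a ∈ nullTangents P r₀)
    (hd : d ∈ altTangents P Λ τ r₁) (hda : d =ᵐ[P] fun x => a x + τ * clip Λ v' v'' x)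
    {δ : (n : ℕ) → (Fin n → Ω) → ℝ} (hδ : IsTestSeq δ) (hsize : asySize A δ a ≤ Phi (-u)) :
    asyPower A δ d ≤ Phi (-u + τ * nrm P (clip Λ v' v'')) := by
  rw [← h.nrm_diff]
  exact asyPower_le hA (isTangent_of_mem_nullTangents ha)
    (isTangent_of_mem_altTangents h.tangent hd) h.measurable_diff h.abs_diff_le h.integral_diff
    h.nrm_diff_pos hda hδ hsize

/-- Pairs with difference `τ Λ^{(v)}` form saddle points with the optimal test. -/
lemma isSaddlePoint_of_diff (h : ClipData P Λ τ (r₀ + r₁) v' v'') (hA : IsLocalAlternatives P A) (hr₀ : 0 ≤ r₀) (hr₁ : 0 ≤ r₁)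
    {a d : Ω → ℝ} (ha : a ∈ nullTangents P r₀)
    (hd : d ∈ altTangents P Λ τ r₁) (hda : d =ᵐ[P] fun x => a x + τ * clip Λ v' v'' x) :
    IsSaddlePoint A (Phi (-u)) (nullTangents P r₀) (altTangents P Λ τ r₁) a d
      (optTest P Λ τ r₀ v' v'' u) := by
  have hlev := h.hasAsyLevel_optTest (u := u) hA hr₀
  refine ⟨ha, hd, h.isTestSeq_optTest, hlev, fun δ hδ hsize => ?_, fun g hg => ?_⟩
  · exact (h.asyPower_le_of_diff hA ha hd hda hδ hsize).trans (h.le_asyPower_optTest hA hr₁ hd)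
  · exact (h.asyPower_le_of_diff hA ha hd hda h.isTestSeq_optTest (hlev a ha)).trans
      (h.le_asyPower_optTest hA hr₁ hg)

lemma null_mem (h : ClipData P Λ τ (r₀ + r₁) v' v'') : (fun x => r₀ * extremeTangent Λ τ (r₀ + r₁) v' v'' x) ∈ nullTangents P r₀ :=
  ⟨_, h.extremeTangent_mem, rfl⟩

lemma alt_mem_of_ball {g : Ω → ℝ} (hg : g ∈ tangentBall P) :
    (fun x => τ * Λ x - r₁ * g x) ∈ altTangents P Λ τ r₁ :=
  ⟨_, neg_mem_tangentBall hg, funext fun x => by ring⟩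

lemma diff_eq (h : ClipData P Λ τ (r₀ + r₁) v' v'') (x : Ω) : τ * Λ x - r₁ * extremeTangent Λ τ (r₀ + r₁) v' v'' x =
    r₀ * extremeTangent Λ τ (r₀ + r₁) v' v'' x + τ * clip Λ v' v'' x := by
  rw [← h.score_sub]; ring

lemma bddBelow_asyPower (h : ClipData P Λ τ (r₀ + r₁) v' v'') (hA : IsLocalAlternatives P A) {δ : (n : ℕ) → (Fin n → Ω) → ℝ}
    (hδ : IsTestSeq δ) :
    BddBelow (Set.range fun g : altTangents P Λ τ r₁ => asyPower A δ g) := by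
  refine ⟨0, ?_⟩
  rintro _ ⟨g, rfl⟩
  exact asyPower_nonneg hA (isTangent_of_mem_altTangents h.tangent g.2) hδ

lemma minAsyPower_optTest (h : ClipData P Λ τ (r₀ + r₁) v' v'') (hA : IsLocalAlternatives P A) (hr₀ : 0 ≤ r₀) (hr₁ : 0 ≤ r₁) :
    minAsyPower A (altTangents P Λ τ r₁) (optTest P Λ τ r₀ v' v'' u) =
      Phi (-u + τ * nrm P (clip Λ v' v'')) := by
  have hq := alt_mem_of_ball (Λ := Λ) (τ := τ) (r₁ := r₁) h.extremeTangent_mem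
  refine le_antisymm ?_ ?_
  · refine (ciInf_le (h.bddBelow_asyPower hA h.isTestSeq_optTest) ⟨_, hq⟩).trans ?_
    exact h.asyPower_le_of_diff hA h.null_mem hq (ae_of_all _ h.diff_eq) h.isTestSeq_optTest
      (h.hasAsyLevel_optTest hA hr₀ _ h.null_mem)
  · have : Nonempty (altTangents P Λ τ r₁) := ⟨⟨_, hq⟩⟩
    exact le_ciInf fun g => h.le_asyPower_optTest hA hr₁ g.2

lemma isMaxminTest_optTest (h : ClipData P Λ τ (r₀ + r₁) v' v'') (hA : IsLocalAlternatives P A) (hr₀ : 0 ≤ r₀) (hr₁ : 0 ≤ r₁) :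
    IsMaxminTest A (Phi (-u)) (nullTangents P r₀) (altTangents P Λ τ r₁)
      (optTest P Λ τ r₀ v' v'' u) := by
  refine ⟨h.isTestSeq_optTest, h.hasAsyLevel_optTest hA hr₀, fun δ hδ hlev => ?_⟩
  rw [h.minAsyPower_optTest hA hr₀ hr₁]
  have hq := alt_mem_of_ball (Λ := Λ) (τ := τ) (r₁ := r₁) h.extremeTangent_mem
  refine (ciInf_le (h.bddBelow_asyPower hA hδ) ⟨_, hq⟩).trans ?_
  exact h.asyPower_le_of_diff hA h.null_mem hq (ae_of_all _ h.diff_eq) hδ (hlev _ h.null_mem)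

lemma crit_eq (h : ClipData P Λ τ (r₀ + r₁) v' v'') : crit P Λ τ r₀ v' v'' u = nrm P (fun x => τ * clip Λ v' v'' x) * u +
    inn P (fun x => τ * clip Λ v' v'' x)
      (fun x => r₀ * extremeTangent Λ τ (r₀ + r₁) v' v'' x) := by
  rw [h.nrm_diff, inn_const_mul_left, inn_const_mul_right, h.inn_clip_extremeTangent, crit]
  ring

/-- A maxmin test attains in particular the power bound of the simple problem at the least favorable
pair, where optimal tests are asymptotically unique. -/
lemma asyEquiv_of_isMaxminTest (h : ClipData P Λ τ (r₀ + r₁) v' v'') (hA : IsLocalAlternatives P A) (hr₀ : 0 ≤ r₀) (hr₁ : 0 ≤ r₁)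
    {δ : (n : ℕ) → (Fin n → Ω) → ℝ}
    (hδ : IsMaxminTest A (Phi (-u)) (nullTangents P r₀) (altTangents P Λ τ r₁) δ) :
    AsyEquiv P δ (optTest P Λ τ r₀ v' v'' u) := by
  obtain ⟨hδt, hδl, hδm⟩ := hδ
  have hq := alt_mem_of_ball (Λ := Λ) (τ := τ) (r₁ := r₁) h.extremeTangent_mem
  have hq0 := isTangent_of_mem_nullTangents h.null_mem
  have hq1 := isTangent_of_mem_altTangents h.tangent hq
  have hpow : Phi (-u + τ * nrm P (clip Λ v' v'')) ≤
      asyPower A δ fun x => τ * Λ x - r₁ * extremeTangent Λ τ (r₀ + r₁) v' v'' x := by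
    rw [← h.minAsyPower_optTest (u := u) hA hr₀ hr₁]
    exact (hδm _ h.isTestSeq_optTest (h.hasAsyLevel_optTest hA hr₀)).trans
      (ciInf_le (h.bddBelow_asyPower hA hδt) ⟨_, hq⟩)
  rw [optTest, h.crit_eq]
  refine asyEquiv_of_power (hA.isQMD hq0) (hA.isQMD hq1) hq0 h.measurable_diff h.abs_diff_le
    h.integral_diff h.nrm_diff_pos (ae_of_all _ h.diff_eq) hδt (fun ε hε => ?_) fun ε hε => ?_
  · exact eventually_le_of_limsup_le (eventually_integral_mem hA hq0 hδt).2 (hδl _ h.null_mem) hε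
  · rw [h.nrm_diff]
    exact eventually_ge_of_le_liminf (eventually_integral_mem hA hq1 hδt).1 hpow hε

/-- The difference of a least favorable pair is `τ Λ^{(v)}`. -/
lemma diff_eq_of_isLeastFavorable (h : ClipData P Λ τ (r₀ + r₁) v' v'') (hA : IsLocalAlternatives P A) (hr₀ : 0 ≤ r₀) (hr₁ : 0 ≤ r₁)
    {g₀ g₁ : Ω → ℝ} (hg₀ : g₀ ∈ tangentBall P) (hg₁ : g₁ ∈ tangentBall P)
    (hlf : IsLeastFavorable A (Phi (-u)) (nullTangents P r₀) (altTangents P Λ τ r₁)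
      (fun x => r₀ * g₀ x) (fun x => τ * Λ x - r₁ * g₁ x)) :
    ∀ᵐ x ∂P, τ * Λ x - r₁ * g₁ x - r₀ * g₀ x = τ * clip Λ v' v'' x := by
  obtain ⟨δ, ha, hd, hδ, hlev, hopt, hmin⟩ := hlf
  have hat := isTangent_of_mem_nullTangents ha
  have hdt := isTangent_of_mem_altTangents h.tangent hd
  have hq := alt_mem_of_ball (Λ := Λ) (τ := τ) (r₁ := r₁) h.extremeTangent_mem
  set k : Ω → ℝ := fun x => τ * Λ x - r₁ * g₁ x - r₀ * g₀ x with hk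
  set s := nrm P (clip Λ v' v'') with hs
  have hτ := h.tau_pos
  have hs0 : 0 < s := h.nrm_clip_pos
  have hkL : MemLp k 2 P := hdt.2.1.sub hat.2.1
  -- the norm of the difference is minimal
  have hnorm : nrm P k ≤ τ * s := by
    by_contra hlt
    obtain ⟨δ', hδ', hsz, hpw⟩ := exists_test_of_lt_nrm (u := u) hA hat hdt
      (mul_nonneg hτ.le hs0.le) (not_le.1 hlt)
    have h1 := hopt δ' hδ' hsz
    have h2 := hmin _ hq
    have h3 := h.asyPower_le_of_diff hA h.null_mem hq (ae_of_all _ h.diff_eq) hδ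
      (hlev _ h.null_mem)
    linarith
  -- The variational inequality of the projection. With `hnorm` it gives `‖k - τ clip‖² ≤ τ² s² - 2
  -- τ² s² + τ² s² = 0`.
  have hinn : τ * s ^ 2 ≤ inn P (clip Λ v' v'') k := by
    have e : inn P (clip Λ v' v'') k = inn P (clip Λ v' v'') (fun x => τ * Λ x) +
        inn P (clip Λ v' v'') (fun x => -r₁ * g₁ x + -r₀ * g₀ x) := by
      have hL : MemLp (fun x => -r₁ * g₁ x + -r₀ * g₀ x) 2 P :=
        (hg₁.1.2.1.const_mul _).add (hg₀.1.2.1.const_mul _)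
      rw [← integral_mul_add_of_memLp h.memLp_clip (h.tangent.2.1.const_mul τ) hL]
      congr 1; ext x; simp only [hk]; ring
    rw [e, integral_mul_add_of_memLp h.memLp_clip (hg₁.1.2.1.const_mul _) (hg₀.1.2.1.const_mul _),
      inn_const_mul_right P _ g₁, inn_const_mul_right P _ g₀, h.inn_clip_score]
    nlinarith [h.inn_clip_le hg₀, h.inn_clip_le hg₁]
  have hz : ∫ x, (k x - τ * clip Λ v' v'' x) ^ 2 ∂P = 0 := by
    refine le_antisymm ?_ (integral_nonneg fun x => sq_nonneg _)
    have i1 : Integrable (fun x => clip Λ v' v'' x * k x) P := h.integrable_clip_mul hkL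
    have e : ∫ x, (k x - τ * clip Λ v' v'' x) ^ 2 ∂P =
        nrm P k ^ 2 - 2 * τ * inn P (clip Λ v' v'') k + τ ^ 2 * s ^ 2 := by
      rw [hs, nrm_sq, nrm_sq, inn, ← integral_const_mul, ← integral_const_mul,
        ← integral_sub hkL.integrable_sq (i1.const_mul _),
        ← integral_add (integrable_fun_sub hkL.integrable_sq (i1.const_mul _))
          (h.memLp_clip.integrable_sq.const_mul _)]
      exact integral_congr_ae (ae_of_all _ fun x => by dsimp only; ring)
    rw [e]
    have h1 : nrm P k ^ 2 ≤ (τ * s) ^ 2 := pow_le_pow_left₀ (nrm_nonneg _ _) hnorm 2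
    nlinarith
  have hae := (integral_eq_zero_iff_of_nonneg (fun x => sq_nonneg _)
    (hkL.sub (h.memLp_clip.const_mul τ)).integrable_sq).1 hz
  filter_upwards [hae] with x hx
  have := pow_eq_zero_iff two_ne_zero |>.1 hx
  simp only [hk, Pi.sub_apply] at this ⊢
  linarith

lemma integral_pos_le_one {g : Ω → ℝ} (hg : g ∈ tangentBall P) :
    ∫ x, max (g x) 0 ∂P ≤ 1 ∧ ∫ x, max (-g x) 0 ∂P ≤ 1 := by
  obtain ⟨h1, h2⟩ := integral_pos_part_of_tangent hg.1
  have := hg.2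
  constructor <;> linarith

/-- Characterization of least favorable tangent pairs. -/
theorem isLeastFavorable_iff (h : ClipData P Λ τ (r₀ + r₁) v' v'') (hA : IsLocalAlternatives P A) (hr₀ : 0 ≤ r₀) (hr₁ : 0 ≤ r₁)
    {g₀ g₁ : Ω → ℝ} (hg₀ : g₀ ∈ tangentBall P) (hg₁ : g₁ ∈ tangentBall P) :
    IsLeastFavorable A (Phi (-u)) (nullTangents P r₀) (altTangents P Λ τ r₁)
      (fun x => r₀ * g₀ x) (fun x => τ * Λ x - r₁ * g₁ x) ↔
    ((∀ᵐ x ∂P, r₀ * max (g₀ x) 0 + r₁ * max (g₁ x) 0 = τ * max (Λ x - v'') 0) ∧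
      ∀ᵐ x ∂P, r₀ * max (-g₀ x) 0 + r₁ * max (-g₁ x) 0 = τ * max (v' - Λ x) 0) := by
  constructor
  · intro hlf
    have hdiff := h.diff_eq_of_isLeastFavorable hA hr₀ hr₁ hg₀ hg₁ hlf
    have hτ := h.tau_pos
    have hv' := h.neg
    have hv'' := h.pos
    have hsum : ∀ᵐ x ∂P, r₀ * g₀ x + r₁ * g₁ x =
        τ * max (Λ x - v'') 0 - τ * max (v' - Λ x) 0 := by
      filter_upwards [hdiff] with x hx
      rw [h.clip_eq] at hx
      linarith
    -- The weighted parts dominate the corresponding part of the weighted sum, yet their mass is at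
    -- most `r₀ + r₁`, which is the mass of the latter. So there is no cancellation and equality
    -- holds almost everywhere. Applied to the positive parts and, after a change of sign, to the
    -- negative parts.
    have key : ∀ {a b : Ω → ℝ} {m : Ω → ℝ}, Integrable a P → Integrable b P → Integrable m P →
        ∫ x, max (a x) 0 ∂P ≤ 1 → ∫ x, max (b x) 0 ∂P ≤ 1 → ∫ x, m x ∂P = r₀ + r₁ →
        (∀ᵐ x ∂P, m x ≤ r₀ * max (a x) 0 + r₁ * max (b x) 0) →
        ∀ᵐ x ∂P, r₀ * max (a x) 0 + r₁ * max (b x) 0 = m x := by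
      intro a b m ha hb hm ha1 hb1 hm1 hle
      have i1 : Integrable (fun x => r₀ * max (a x) 0 + r₁ * max (b x) 0) P :=
        (ha.pos_part.const_mul _).add (hb.pos_part.const_mul _)
      have hI : ∫ x, (r₀ * max (a x) 0 + r₁ * max (b x) 0 - m x) ∂P ≤ 0 := by
        rw [integral_sub i1 hm, integral_add (ha.pos_part.const_mul _) (hb.pos_part.const_mul _),
          integral_const_mul, integral_const_mul, hm1]
        nlinarith
      have hnn : ∀ᵐ x ∂P, 0 ≤ r₀ * max (a x) 0 + r₁ * max (b x) 0 - m x := by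
        filter_upwards [hle] with x hx
        linarith
      have h0 := le_antisymm hI (integral_nonneg_of_ae hnn)
      have := (integral_eq_zero_iff_of_nonneg_ae hnn (i1.sub hm)).1 h0
      filter_upwards [this] with x hx
      simp only [Pi.zero_apply] at hx
      linarith
    have i0 : Integrable g₀ P := hg₀.1.2.1.integrable one_le_two
    have i1 : Integrable g₁ P := hg₁.1.2.1.integrable one_le_two
    obtain ⟨p0, n0⟩ := integral_pos_le_one hg₀
    obtain ⟨p1, n1⟩ := integral_pos_le_one hg₁
    constructor
    · refine key i0 i1 (h.integrable_upper.const_mul τ) p0 p1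
        (by rw [integral_const_mul, h.upper]) ?_
      filter_upwards [hsum] with x hx
      rcases le_total (Λ x) v'' with hl | hl
      · rw [max_eq_right (by linarith : Λ x - v'' ≤ 0)]
        have := mul_nonneg hr₀ (le_max_right (g₀ x) 0)
        have := mul_nonneg hr₁ (le_max_right (g₁ x) 0)
        linarith
      · rw [max_eq_right (by linarith : v' - Λ x ≤ 0)] at hx
        have := mul_le_mul_of_nonneg_left (le_max_left (g₀ x) 0) hr₀
        have := mul_le_mul_of_nonneg_left (le_max_left (g₁ x) 0) hr₁
        linarith
    · refine key i0.neg i1.neg (h.integrable_lower.const_mul τ) n0 n1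
        (by rw [integral_const_mul, h.lower]) ?_
      filter_upwards [hsum] with x hx
      rcases le_total (Λ x) v' with hl | hl
      · rw [max_eq_right (by linarith : Λ x - v'' ≤ 0)] at hx
        have := mul_le_mul_of_nonneg_left (le_max_left (-g₀ x) 0) hr₀
        have := mul_le_mul_of_nonneg_left (le_max_left (-g₁ x) 0) hr₁
        linarith
      · rw [max_eq_right (by linarith : v' - Λ x ≤ 0)]
        have := mul_nonneg hr₀ (le_max_right (-g₀ x) 0)
        have := mul_nonneg hr₁ (le_max_right (-g₁ x) 0)
        linarith
  · rintro ⟨hp, hn⟩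
    refine ⟨optTest P Λ τ r₀ v' v'' u, h.isSaddlePoint_of_diff hA hr₀ hr₁ ⟨g₀, hg₀, rfl⟩
      (alt_mem_of_ball hg₁) ?_⟩
    have hsplit : ∀ y : ℝ, y = max y 0 - max (-y) 0 := fun y => by
      rcases le_total 0 y with hy | hy
      · rw [max_eq_left hy, max_eq_right (by linarith)]; ring
      · rw [max_eq_right hy, max_eq_left (by linarith)]; ring
    filter_upwards [hp, hn] with x h1 h2
    rw [h.clip_eq]
    have a0 : r₀ * g₀ x = r₀ * (max (g₀ x) 0 - max (-g₀ x) 0) := by rw [← hsplit]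
    have a1 : r₁ * g₁ x = r₁ * (max (g₁ x) 0 - max (-g₁ x) 0) := by rw [← hsplit]
    linarith

end ClipData

/-! ### Total variation balls -/

section Balls

variable {P : Measure Ω} [IsProbabilityMeasure P]

lemma isQMD_of_hasScoresAt {P : ℝ → Measure Ω} {Θ : Set ℝ} (hΘ : IsOpen Θ) {θ₀ : ℝ} (hθ₀ : θ₀ ∈ Θ)
    (hP : ∀ θ ∈ Θ, IsProbabilityMeasure (P θ)) {Λ : Ω → ℝ} (hΛ : HasScoresAt P θ₀ Λ) {τ : ℝ}
    (hτ : 0 < τ) :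
    IsQMD (P θ₀) (fun n : ℕ => P (θ₀ + τ / Real.sqrt n)) (fun x => τ * Λ x)
      (fun n : ℕ => densRoot (P θ₀) (P (θ₀ + τ / Real.sqrt n))) := by
  have := hP θ₀ hθ₀
  have ht : Tendsto (fun n : ℕ => τ / Real.sqrt n) atTop (𝓝 0) :=
    tendsto_sqrt_natCast.const_div_atTop τ
  have ht' : Tendsto (fun n : ℕ => θ₀ + τ / Real.sqrt n) atTop (𝓝 θ₀) := by
    simpa using ht.const_add θ₀
  refine isQMD_of_remainder (hΛ.1.2.1.const_mul τ) ?_ ?_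
  · filter_upwards [ht'.eventually (hΘ.mem_nhds hθ₀)] with n hn using hP _ hn
  · have h1 := (hΛ.2.comp_tendsto ht).tendsto_div_nhds_zero
    have h2 := h1.const_mul (τ ^ 2)
    rw [mul_zero] at h2
    refine h2.congr' ?_
    filter_upwards [eventually_natCast_pos] with n hn
    have hs0 : 0 < Real.sqrt n := Real.sqrt_pos.2 hn
    have hs : Real.sqrt n ^ 2 = n := Real.sq_sqrt hn.le
    have e : (fun x => τ / Real.sqrt n * Λ x) = fun x => τ * Λ x / Real.sqrt n :=
      funext fun x => by ring
    simp only [Function.comp_apply, e]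
    rw [div_pow, hs]
    field_simp

lemma integral_le_maxSize {Q : Measure Ω} {r : ℝ} {δ : (n : ℕ) → (Fin n → Ω) → ℝ}
    (hδ : IsTestSeq δ) {n : ℕ} (hQ : Q ∈ tvBall P (r / Real.sqrt n)) :
    ∫ x, δ n x ∂(iid Q n) ≤ maxSize P r δ n := by
  refine le_ciSup (f := fun Q : tvBall P (r / Real.sqrt n) => ∫ x, δ n x ∂(iid (Q : Measure Ω) n))
    ⟨1, ?_⟩ ⟨Q, hQ⟩
  rintro _ ⟨⟨Q, hQ⟩, rfl⟩
  have := hQ.1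
  have := iid_isProbabilityMeasure Q n
  exact IsTest.integral_le_one (hδ n) _

lemma minPower_le_integral {Q : Measure Ω} {D : ℕ → Measure Ω} {r : ℝ}
    {δ : (n : ℕ) → (Fin n → Ω) → ℝ} (hδ : IsTestSeq δ) {n : ℕ}
    (hQ : Q ∈ tvBall (D n) (r / Real.sqrt n)) :
    minPower D r δ n ≤ ∫ x, δ n x ∂(iid Q n) := by
  refine ciInf_le (f := fun Q : tvBall (D n) (r / Real.sqrt n) => ∫ x, δ n x ∂(iid (Q : Measure Ω) n))
    ⟨0, ?_⟩ ⟨Q, hQ⟩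
  rintro _ ⟨⟨Q, hQ⟩, rfl⟩
  exact IsTest.integral_nonneg (hδ n) _

lemma maxSize_le {r : ℝ} (hr : 0 ≤ r) {δ : (n : ℕ) → (Fin n → Ω) → ℝ} {n : ℕ} {a : ℝ}
    (h : ∀ Q ∈ tvBall P (r / Real.sqrt n), ∫ x, δ n x ∂(iid Q n) ≤ a) : maxSize P r δ n ≤ a := by
  have : Nonempty (tvBall P (r / Real.sqrt n)) :=
    ⟨⟨P, self_mem_tvBall P (div_nonneg hr (Real.sqrt_nonneg _))⟩⟩
  exact ciSup_le fun Q => h Q Q.2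

lemma le_minPower {D : ℕ → Measure Ω} {r : ℝ} (hr : 0 ≤ r) {δ : (n : ℕ) → (Fin n → Ω) → ℝ}
    {n : ℕ} [IsProbabilityMeasure (D n)] {a : ℝ}
    (h : ∀ Q ∈ tvBall (D n) (r / Real.sqrt n), a ≤ ∫ x, δ n x ∂(iid Q n)) :
    a ≤ minPower D r δ n := by
  have : Nonempty (tvBall (D n) (r / Real.sqrt n)) :=
    ⟨⟨D n, self_mem_tvBall (D n) (div_nonneg hr (Real.sqrt_nonneg _))⟩⟩
  exact le_ciInf fun Q => h Q Q.2

lemma maxSize_mem {r : ℝ} (hr : 0 ≤ r) {δ : (n : ℕ) → (Fin n → Ω) → ℝ} (hδ : IsTestSeq δ) (n : ℕ) :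
    0 ≤ maxSize P r δ n ∧ maxSize P r δ n ≤ 1 := by
  refine ⟨?_, maxSize_le hr fun Q hQ => ?_⟩
  · exact (IsTest.integral_nonneg (hδ n) _).trans (integral_le_maxSize hδ
      (self_mem_tvBall P (div_nonneg hr (Real.sqrt_nonneg _))))
  · have := hQ.1
    have := iid_isProbabilityMeasure Q n
    exact IsTest.integral_le_one (hδ n) _

lemma minPower_mem {D : ℕ → Measure Ω} {r : ℝ} (hr : 0 ≤ r) {δ : (n : ℕ) → (Fin n → Ω) → ℝ}
    (hδ : IsTestSeq δ) (n : ℕ) [IsProbabilityMeasure (D n)] :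
    0 ≤ minPower D r δ n ∧ minPower D r δ n ≤ 1 := by
  refine ⟨le_minPower hr fun Q hQ => IsTest.integral_nonneg (hδ n) _, ?_⟩
  have := iid_isProbabilityMeasure (D n) n
  exact (minPower_le_integral hδ
    (self_mem_tvBall (D n) (div_nonneg hr (Real.sqrt_nonneg _)))).trans
    (IsTest.integral_le_one (hδ n) _)

/-- Selecting a violating member of `U n` whenever there is one reduces uniformity over the sets to
statements about sequences. `D` serves at the indices without a violation. -/
lemma eventually_forall_mem {β : Type*} {U : ℕ → Set β} {p : ℕ → β → Prop} {D : ℕ → β}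
    (hD : ∀ᶠ n in atTop, D n ∈ U n)
    (h : ∀ Q : ℕ → β, (∀ᶠ n in atTop, Q n ∈ U n) → ∀ᶠ n in atTop, p n (Q n)) :
    ∀ᶠ n in atTop, ∀ Q ∈ U n, p n Q := by
  classical
  have hex : ∀ n, ∃ Q, (Q ∈ U n ∨ Q = D n) ∧ ((∃ Q ∈ U n, ¬p n Q) → ¬p n Q) := fun n => by
    by_cases hn : ∃ Q ∈ U n, ¬p n Q
    · obtain ⟨Q, hQ, hp⟩ := hn
      exact ⟨Q, Or.inl hQ, fun _ => hp⟩
    · exact ⟨D n, Or.inr rfl, fun h => absurd h hn⟩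
  choose Q hQ hp using hex
  have hmem : ∀ᶠ n in atTop, Q n ∈ U n := by
    filter_upwards [hD] with n hn
    rcases hQ n with h1 | h1
    · exact h1
    · rwa [h1]
  filter_upwards [h Q hmem] with n hn Q' hQ'
  by_contra hcon
  exact hp n ⟨Q', hQ', hcon⟩ hn

/-- Arbitrary members of the balls have no tangent. Convergence on bounded functions is enough to
identify the limiting variance; the drift is bounded separately. -/
lemma ConvergesTo.of_mem_tvBall {D Q : ℕ → Measure Ω} (hD : ConvergesTo D P) {r : ℝ}
    (hQ : ∀ᶠ n : ℕ in atTop, Q n ∈ tvBall (D n) (r / Real.sqrt n)) : ConvergesTo Q P := by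
  refine ⟨hQ.mono fun n hn => hn.1, fun f hf C hC => ?_⟩
  have h0 : Tendsto (fun n : ℕ => (C - -C) * (r / Real.sqrt n)) atTop (𝓝 0) := by
    simpa using (tendsto_sqrt_natCast.const_div_atTop r).const_mul (C - -C)
  have h1 : Tendsto (fun n => ∫ x, f x ∂(Q n) - ∫ x, f x ∂(D n)) atTop (𝓝 0) := by
    refine squeeze_zero_norm' ?_ h0
    filter_upwards [hQ, hD.1] with n hn hDn
    have := hn.1
    have hb : ∀ x, -C ≤ f x ∧ f x ≤ C := fun x => abs_le.1 (hC x)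
    refine (abs_integral_sub_le_tvDistance hf hb).trans (mul_le_mul_of_nonneg_left hn.2 ?_)
    obtain ⟨x⟩ := (D n).nonempty_of_neZero
    linarith [hb x]
  simpa using h1.add (hD.2 f hf C hC)

lemma mul_sqrt_div_cancel {n : ℕ} (hn : 0 < (n : ℝ)) (c r : ℝ) :
    Real.sqrt n * (c * (r / Real.sqrt n)) = c * r := by
  have : 0 < Real.sqrt n := Real.sqrt_pos.2 hn
  field_simp

/-- The integrand changes with `n` and its bound grows, so the uniformity in
`IsQMD.exists_integral_bound` is needed, with error `K n / √n` times `o(1)`. -/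
lemma tendsto_integral_trunc {Q : ℕ → Measure Ω} {h : Ω → ℝ} {ξ : ℕ → Ω → ℝ} (hQ : IsQMD P Q h ξ)
    {p : Ω → ℝ} (hp : Measurable p) (hp0 : ∀ x, 0 ≤ p x) (hpL : MemLp p 2 P) {K : ℕ → ℝ}
    (hK0 : ∀ n, 0 ≤ K n) (hKt : Tendsto K atTop atTop)
    (hK : Tendsto (fun n : ℕ => K n / Real.sqrt n) atTop (𝓝 0)) :
    Tendsto (fun n => ∫ x, min (p x) (K n) ∂(Q n)) atTop (𝓝 (∫ x, p x ∂P)) := by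
  have hm : ∀ n, Measurable fun x => min (p x) (K n) := fun n => hp.min measurable_const
  have hle : ∀ n x, |min (p x) (K n)| ≤ p x := fun n x => by
    rw [abs_of_nonneg (le_min (hp0 x) (hK0 n))]; exact min_le_left _ _
  have h1 : Tendsto (fun n => ∫ x, min (p x) (K n) ∂P) atTop (𝓝 (∫ x, p x ∂P)) := by
    refine tendsto_integral_of_dominated_convergence p (fun n => (hm n).aestronglyMeasurable)
      (hpL.integrable one_le_two) (fun n => ae_of_all _ (hle n)) (ae_of_all _ fun x => ?_)
    refine tendsto_const_nhds.congr' ?_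
    filter_upwards [hKt.eventually_ge_atTop (p x)] with n hn
    rw [min_eq_left hn]
  obtain ⟨e, he, hb⟩ := hQ.exists_integral_bound
  have hI : Integrable (fun x => |p x * h x|) P := (hpL.integrable_mul hQ.memLp).abs
  set M := ∫ x, |p x * h x| ∂P with hM
  have h2 : Tendsto (fun n : ℕ => K n / Real.sqrt n * e n + M / Real.sqrt n) atTop (𝓝 0) := by
    simpa using (hK.mul he).add (tendsto_sqrt_natCast.const_div_atTop M)
  have h3 : Tendsto (fun n => ∫ x, min (p x) (K n) ∂(Q n) - ∫ x, min (p x) (K n) ∂P) atTop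
      (𝓝 0) := by
    refine squeeze_zero_norm' ?_ h2
    filter_upwards [hb, eventually_natCast_pos] with n hn hpos
    have hs0 : 0 < Real.sqrt n := Real.sqrt_pos.2 hpos
    have ha := hn _ (hm n) (K n) (hK0 n) fun x => by
      rw [abs_of_nonneg (le_min (hp0 x) (hK0 n))]; exact min_le_right _ _
    have hc : |∫ x, min (p x) (K n) * h x ∂P| ≤ M := by
      refine (abs_integral_le_integral_abs).trans (integral_mono_of_nonneg
        (ae_of_all _ fun x => abs_nonneg _) hI (ae_of_all _ fun x => ?_))
      dsimp only
      rw [abs_mul, abs_mul]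
      exact mul_le_mul_of_nonneg_right ((hle n x).trans (le_abs_self _)) (abs_nonneg _)
    rw [Real.norm_eq_abs, div_mul_eq_mul_div, ← add_div, le_div_iff₀ hs0]
    have e1 : |∫ x, min (p x) (K n) ∂(Q n) - ∫ x, min (p x) (K n) ∂P| * Real.sqrt n =
        |Real.sqrt n * (∫ x, min (p x) (K n) ∂(Q n) - ∫ x, min (p x) (K n) ∂P)| := by
      rw [abs_mul, abs_of_pos hs0, mul_comm]
    rw [e1]
    have := abs_sub_abs_le_abs_sub
      (Real.sqrt n * (∫ x, min (p x) (K n) ∂(Q n) - ∫ x, min (p x) (K n) ∂P))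
      (∫ x, min (p x) (K n) * h x ∂P)
    linarith
  simpa using h3.add h1

/-- `p` and `m` are probability densities under `Q`, so their integrals over any set differ by at
most one. The radius is met exactly and not only up to `o(1 / √n)`. -/
lemma tvDistance_tilt_le {Q : Measure Ω} [IsProbabilityMeasure Q] {p m : Ω → ℝ} {c : ℝ} {n : ℕ}
    (hp : Measurable p) (hm : Measurable m) (hp0 : ∀ x, 0 ≤ p x) (hm0 : ∀ x, 0 ≤ m x)
    (hpi : Integrable p Q) (hmi : Integrable m Q) (hp1 : ∫ x, p x ∂Q = 1) (hm1 : ∫ x, m x ∂Q = 1)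
    (hb : ∀ x, |c * (p x - m x) / Real.sqrt n| ≤ 1) :
    tilt Q (fun x => c * (p x - m x)) n ∈ tvBall Q (|c| / Real.sqrt n) := by
  have hw : Measurable fun x => c * (p x - m x) := (hp.sub hm).const_mul c
  have h0 : ∫ x, c * (p x - m x) ∂Q = 0 := by
    rw [integral_const_mul, integral_sub hpi hmi, hp1, hm1, sub_self, mul_zero]
  have hprob := tilt_isProbabilityMeasure hw hb h0
  refine ⟨hprob, tvDistance_le_of_forall fun A hA => ?_⟩
  have ei : ∀ μ : Measure Ω, μ.real A = ∫ x, A.indicator 1 x ∂μ := fun μ =>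
    (integral_indicator_one hA).symm
  have i1 : Integrable (A.indicator (1 : Ω → ℝ)) Q := (integrable_const 1).indicator hA
  have i2 : Integrable (fun x => c * (p x - m x) / Real.sqrt n * A.indicator 1 x) Q := by
    have : (fun x => c * (p x - m x) / Real.sqrt n * A.indicator 1 x) =
        A.indicator fun x => c * (p x - m x) / Real.sqrt n := by
      funext x
      by_cases hx : x ∈ A <;> simp [hx]
    rw [this]
    exact (((hpi.sub hmi).const_mul c).div_const _).indicator hA
  have e2 : ∫ x, c * (p x - m x) / Real.sqrt n * A.indicator 1 x ∂Q =
      c / Real.sqrt n * (∫ x in A, p x ∂Q - ∫ x in A, m x ∂Q) := by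
    rw [← integral_sub hpi.integrableOn hmi.integrableOn, ← integral_const_mul,
      ← integral_indicator hA]
    refine integral_congr_ae (ae_of_all _ fun x => ?_)
    by_cases hx : x ∈ A
    · simp only [Set.indicator_of_mem hx, Pi.one_apply]; ring
    · simp [hx]
  have e3 : (tilt Q (fun x => c * (p x - m x)) n).real A - Q.real A =
      c / Real.sqrt n * (∫ x in A, p x ∂Q - ∫ x in A, m x ∂Q) := by
    rw [ei, ei, integral_tilt hw hb, ← e2, sub_eq_iff_eq_add, ← integral_add i2 i1]
    exact integral_congr_ae (ae_of_all _ fun x => by dsimp only; ring)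
  have bp : 0 ≤ ∫ x in A, p x ∂Q ∧ ∫ x in A, p x ∂Q ≤ 1 :=
    ⟨integral_nonneg fun x => hp0 x, hp1 ▸ setIntegral_le_integral hpi (ae_of_all _ hp0)⟩
  have bm : 0 ≤ ∫ x in A, m x ∂Q ∧ ∫ x in A, m x ∂Q ≤ 1 :=
    ⟨integral_nonneg fun x => hm0 x, hm1 ▸ setIntegral_le_integral hmi (ae_of_all _ hm0)⟩
  rw [e3]
  refine (le_abs_self _).trans ?_
  rw [abs_mul, abs_div, abs_of_nonneg (Real.sqrt_nonneg _)]
  refine mul_le_of_le_one_right (by positivity) ?_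
  rw [abs_le]; constructor <;> linarith [bp.1, bp.2, bm.1, bm.2]

/-- Local alternatives with tangent `h + c g` inside total variation balls. -/
lemma IsQMD.exists_mem_tvBall {Q : ℕ → Measure Ω} {h : Ω → ℝ} {ξ : ℕ → Ω → ℝ} (hQ : IsQMD P Q h ξ)
    {g : Ω → ℝ} (hg : Measurable g) (hgL : MemLp g 2 P) (hp1 : ∫ x, max (g x) 0 ∂P = 1)
    (hm1 : ∫ x, max (-g x) 0 ∂P = 1) (c : ℝ) :
    ∃ (Q' : ℕ → Measure Ω) (ξ' : ℕ → Ω → ℝ), IsQMD P Q' (fun x => h x + c * g x) ξ' ∧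
      ∀ᶠ n : ℕ in atTop, Q' n ∈ tvBall (Q n) (|c| / Real.sqrt n) := by
  -- The level `n^{1/4}` tends to infinity, but slower than `√n`.
  set K : ℕ → ℝ := fun n => Real.sqrt (Real.sqrt n) with hK
  have hK0 : ∀ n, 0 ≤ K n := fun n => Real.sqrt_nonneg _
  have hKt : Tendsto K atTop atTop := Real.tendsto_sqrt_atTop.comp tendsto_sqrt_natCast
  have hKs : Tendsto (fun n : ℕ => K n / Real.sqrt n) atTop (𝓝 0) := by
    refine hKt.inv_tendsto_atTop.congr fun n => ?_
    simp only [Pi.inv_apply, hK]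
    rw [Real.sqrt_div_self', one_div]
  have hpm : Measurable fun x => max (g x) 0 := hg.max measurable_const
  have hmm : Measurable fun x => max (-g x) 0 := hg.neg.max measurable_const
  have hpL : MemLp (fun x => max (g x) 0) 2 P := hgL.pos_part
  have hmL : MemLp (fun x => max (-g x) 0) 2 P := hgL.neg.pos_part
  have ta := tendsto_integral_trunc hQ hpm (fun x => le_max_right _ _) hpL hK0 hKt hKs
  have tb := tendsto_integral_trunc hQ hmm (fun x => le_max_right _ _) hmL hK0 hKt hKs
  rw [hp1] at ta
  rw [hm1] at tb
  -- Both truncated parts are normalized under `Q n` itself; so the tilt is a probability and stays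
  -- in the ball. The constants tend to one, and the limiting tangent is unaffected.
  set a : ℕ → ℝ := fun n => ∫ x, min (max (g x) 0) (K n) ∂(Q n) with ha
  set b : ℕ → ℝ := fun n => ∫ x, min (max (-g x) 0) (K n) ∂(Q n) with hb
  set p : ℕ → Ω → ℝ := fun n x => min (max (g x) 0) (K n) / a n with hp
  set m : ℕ → Ω → ℝ := fun n x => min (max (-g x) 0) (K n) / b n with hm
  have hpM : ∀ n, Measurable (p n) := fun n => (hpm.min measurable_const).div_const _
  have hmM : ∀ n, Measurable (m n) := fun n => (hmm.min measurable_const).div_const _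
  have hae : ∀ᶠ n in atTop, 1 / 2 < a n := ta.eventually (lt_mem_nhds (by norm_num))
  have hbe : ∀ᶠ n in atTop, 1 / 2 < b n := tb.eventually (lt_mem_nhds (by norm_num))
  have hdiv : ∀ {y z s : ℝ}, 0 ≤ y → 1 / 2 < s → y ≤ z → y / s ≤ 2 * z := fun {y z s} hy hs hz => by
    rw [div_le_iff₀ (by linarith)]; nlinarith
  have hwK : ∀ᶠ n in atTop, ∀ x, |c * (p n x - m n x)| ≤ |c| * (2 * K n) := by
    filter_upwards [hae, hbe] with n h1 h2 x
    rw [abs_mul]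
    refine mul_le_mul_of_nonneg_left ?_ (abs_nonneg c)
    have q1 := hdiv (le_min (le_max_right (g x) 0) (hK0 n)) h1 (min_le_right _ _)
    have q2 := hdiv (le_min (le_max_right (-g x) 0) (hK0 n)) h2 (min_le_right _ _)
    have q3 : 0 ≤ p n x := div_nonneg (le_min (le_max_right _ _) (hK0 n)) (by linarith)
    have q4 : 0 ≤ m n x := div_nonneg (le_min (le_max_right _ _) (hK0 n)) (by linarith)
    rw [abs_le]; constructor <;> linarith
  have hKc : Tendsto (fun n : ℕ => |c| * (2 * K n) / Real.sqrt n) atTop (𝓝 0) := by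
    have := hKs.const_mul (|c| * 2)
    rw [mul_zero] at this
    exact this.congr fun n => by ring
  have hfacts : ∀ᶠ n in atTop, IsProbabilityMeasure (Q n) ∧ Integrable (p n) (Q n) ∧
      Integrable (m n) (Q n) ∧ ∫ x, p n x ∂(Q n) = 1 ∧ ∫ x, m n x ∂(Q n) = 1 := by
    filter_upwards [hae, hbe, hQ.prob] with n h1 h2 h3
    have b1 : ∀ y : ℝ, 0 ≤ min (max y 0) (K n) ∧ min (max y 0) (K n) ≤ K n := fun y =>
      ⟨le_min (le_max_right _ _) (hK0 n), min_le_right _ _⟩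
    refine ⟨h3, ?_, ?_, ?_, ?_⟩
    · exact (integrable_of_mem_Icc (hpm.min measurable_const) fun x => b1 _).div_const _
    · exact (integrable_of_mem_Icc (hmm.min measurable_const) fun x => b1 _).div_const _
    · rw [integral_div]; exact div_self (by linarith : (0 : ℝ) < a n).ne'
    · rw [integral_div]; exact div_self (by linarith : (0 : ℝ) < b n).ne'
  refine ⟨fun n => RobustTest.tilt (Q n) (fun x => c * (p n x - m n x)) n, _,
    IsQMD.tilt hQ (fun n => ((hpM n).sub (hmM n)).const_mul c) hwK hKc (hgL.const_mul c) ?_ ?_, ?_⟩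
  · have hlim : ∀ x, Tendsto (fun n => (c * (p n x - m n x) - c * g x) ^ 2) atTop (𝓝 0) := fun x => by
      have t1 : Tendsto (fun n => p n x) atTop (𝓝 (max (g x) 0 / 1)) := by
        refine Tendsto.div (tendsto_const_nhds.congr' ?_) ta one_ne_zero
        filter_upwards [hKt.eventually_ge_atTop (max (g x) 0)] with n hn
        rw [min_eq_left hn]
      have t2 : Tendsto (fun n => m n x) atTop (𝓝 (max (-g x) 0 / 1)) := by
        refine Tendsto.div (tendsto_const_nhds.congr' ?_) tb one_ne_zero
        filter_upwards [hKt.eventually_ge_atTop (max (-g x) 0)] with n hn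
        rw [min_eq_left hn]
      have t3 := (((t1.sub t2).const_mul c).sub_const (c * g x)).pow 2
      have e : (c * (max (g x) 0 / 1 - max (-g x) 0 / 1) - c * g x) ^ 2 = 0 := by
        rw [div_one, div_one, max_zero_sub_max_neg_zero_eq_self]
        ring
      rwa [e] at t3
    have := tendsto_integral_filter_of_dominated_convergence (μ := P) (l := atTop)
      (F := fun n x => (c * (p n x - m n x) - c * g x) ^ 2) (f := fun _ => 0)
      (fun x => (3 * c * g x) ^ 2) ?_ ?_ ?_ (ae_of_all _ hlim)
    · simpa using this
    · refine Eventually.of_forall fun n => Measurable.aestronglyMeasurable ?_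
      have := hpM n
      have := hmM n
      fun_prop
    · filter_upwards [hae, hbe] with n h1 h2
      refine ae_of_all _ fun x => ?_
      have q1 : p n x ≤ 2 * max (g x) 0 :=
        hdiv (le_min (le_max_right (g x) 0) (hK0 n)) h1 (min_le_left _ _)
      have q2 : m n x ≤ 2 * max (-g x) 0 :=
        hdiv (le_min (le_max_right (-g x) 0) (hK0 n)) h2 (min_le_left _ _)
      have q3 : 0 ≤ p n x := div_nonneg (le_min (le_max_right _ _) (hK0 n)) (by linarith)
      have q4 : 0 ≤ m n x := div_nonneg (le_min (le_max_right _ _) (hK0 n)) (by linarith)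
      rw [Real.norm_eq_abs, abs_of_nonneg (sq_nonneg _), sq_le_sq]
      rw [show c * (p n x - m n x) - c * g x = c * (p n x - m n x - g x) by ring, mul_assoc,
        mul_left_comm, abs_mul, abs_mul c]
      refine mul_le_mul_of_nonneg_left ?_ (abs_nonneg c)
      rw [abs_mul, abs_of_pos (by norm_num : (0 : ℝ) < 3), abs_le]
      rcases le_total 0 (g x) with hg0 | hg0
      · rw [abs_of_nonneg hg0]
        rw [max_eq_left hg0] at q1
        rw [max_eq_right (by linarith)] at q2
        constructor <;> linarith
      · rw [abs_of_nonpos hg0]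
        rw [max_eq_right hg0] at q1
        rw [max_eq_left (by linarith)] at q2
        constructor <;> linarith
    · exact (hgL.const_mul (3 * c)).integrable_sq
  · filter_upwards [hfacts] with n ⟨h1, h2, h3, h4, h5⟩
    rw [integral_const_mul, integral_sub h2 h3, h4, h5, sub_self, mul_zero]
  · filter_upwards [hfacts, hwK, hKc.eventually (gt_mem_nhds one_pos), hae, hbe]
      with n ⟨h1, h2, h3, h4, h5⟩ h6 h7 h8 h9
    exact tvDistance_tilt_le (hpM n) (hmM n)
      (fun x => div_nonneg (le_min (le_max_right _ _) (hK0 n)) (by linarith))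
      (fun x => div_nonneg (le_min (le_max_right _ _) (hK0 n)) (by linarith)) h2 h3 h4 h5
      fun x => (abs_div_sqrt_le (h6 x) n).trans h7.le

/-! ### The clipped test over total variation balls -/

namespace ClipData

variable {Λ : Ω → ℝ} {τ r₀ r₁ v' v'' u : ℝ} {D : ℕ → Measure Ω} {η : ℕ → Ω → ℝ}

lemma diff_mem (h : ClipData P Λ τ (r₀ + r₁) v' v'') (x : Ω) : τ * v' ≤ τ * clip Λ v' v'' x ∧ τ * clip Λ v' v'' x ≤ τ * v'' :=
  ⟨mul_le_mul_of_nonneg_left (le_clip x) h.tau_pos.le,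
    mul_le_mul_of_nonneg_left (h.clip_le x) h.tau_pos.le⟩

/-- In the ball the drift of the sum is at most the oscillation `τ (v'' - v')` times `r₀`, which is
the centring term in the critical value. No differentiability is used. -/
lemma eventually_size_ball_le (h : ClipData P Λ τ (r₀ + r₁) v' v'') (hr₀ : 0 ≤ r₀) {ε : ℝ} (hε : 0 < ε) :
    ∀ᶠ n : ℕ in atTop, ∀ Q ∈ tvBall P (r₀ / Real.sqrt n),
      ∫ x, optTest P Λ τ r₀ v' v'' u n x ∂(iid Q n) ≤ Phi (-u) + ε := by
  refine eventually_forall_mem (D := fun _ => P) (Eventually.of_forall fun n =>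
    self_mem_tvBall P (div_nonneg hr₀ (Real.sqrt_nonneg _))) fun Q hQ => ?_
  have hc := (isQMD_const P).convergesTo.of_mem_tvBall hQ
  have hm : ∀ η > 0, ∀ᶠ n : ℕ in atTop, Real.sqrt n * ∫ y, τ * clip Λ v' v'' y ∂(Q n) ≤
      (τ * v'' - τ * v') * r₀ + η := fun η hη => by
    filter_upwards [hQ, eventually_natCast_pos] with n hn hpos
    have := hn.1
    have h1 := abs_integral_sub_le_tvDistance (Q := Q n) (P := P) h.measurable_diff h.diff_mem
    rw [h.integral_diff, sub_zero] at h1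
    have h0 : 0 ≤ τ * v'' - τ * v' := by nlinarith [h.tau_pos, h.neg, h.pos]
    have h2 := mul_le_mul_of_nonneg_left ((le_abs_self _).trans (h1.trans
      (mul_le_mul_of_nonneg_left hn.2 h0))) (Real.sqrt_nonneg n)
    rw [mul_sqrt_div_cancel hpos] at h2
    linarith
  have := eventually_integral_sumTest_le hc h.measurable_diff h.abs_diff_le h.integral_diff
    h.nrm_diff_pos (c := crit P Λ τ r₀ v' v'' u) hm ε hε
  have e : ((τ * v'' - τ * v') * r₀ - crit P Λ τ r₀ v' v'' u) /
      nrm P (fun x => τ * clip Λ v' v'' x) = -u := by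
    rw [div_eq_iff h.nrm_diff_pos.ne', h.nrm_diff, crit]; ring
  rwa [e] at this

/-- Under `D` the drift is `τ (τ ‖clip‖² + (r₀ + r₁)(v'' - v'))` in the limit; passing to another
member of the ball lowers it by at most `τ r₁ (v'' - v')`. -/
lemma eventually_le_power_ball (h : ClipData P Λ τ (r₀ + r₁) v' v'') (hD : IsQMD P D (fun x => τ * Λ x) η) (hr₁ : 0 ≤ r₁)
    {ε : ℝ} (hε : 0 < ε) :
    ∀ᶠ n : ℕ in atTop, ∀ Q ∈ tvBall (D n) (r₁ / Real.sqrt n),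
      Phi (-u + τ * nrm P (clip Λ v' v'')) - ε ≤
        ∫ x, optTest P Λ τ r₀ v' v'' u n x ∂(iid Q n) := by
  refine eventually_forall_mem (D := D) (hD.prob.mono fun n hn =>
    self_mem_tvBall (D n) (div_nonneg hr₁ (Real.sqrt_nonneg _))) fun Q hQ => ?_
  have hc := hD.convergesTo.of_mem_tvBall hQ
  have hl := hD.tendsto_sqrt_mul_integral h.measurable_diff h.abs_diff_le
  have hi : ∫ x, τ * clip Λ v' v'' x * (τ * Λ x) ∂P =
      τ * (τ * nrm P (clip Λ v' v'') ^ 2 + (r₀ + r₁) * (v'' - v')) := by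
    rw [← h.inn_clip_score, ← inn_const_mul_left, inn]
  rw [hi, h.integral_diff] at hl
  simp only [sub_zero] at hl
  have hm : ∀ η > 0, ∀ᶠ n : ℕ in atTop,
      τ * (τ * nrm P (clip Λ v' v'') ^ 2 + r₀ * (v'' - v')) - η ≤
        Real.sqrt n * ∫ y, τ * clip Λ v' v'' y ∂(Q n) := fun η hη => by
    filter_upwards [hQ, hD.prob, eventually_natCast_pos,
      hl.eventually (lt_mem_nhds (sub_lt_self _ hη))] with n hn hDn hpos h3
    have := hn.1
    have h1 := abs_integral_sub_le_tvDistance (Q := Q n) (P := D n) h.measurable_diff h.diff_mem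
    have h0 : 0 ≤ τ * v'' - τ * v' := by nlinarith [h.tau_pos, h.neg, h.pos]
    have h2 := mul_le_mul_of_nonneg_left ((neg_le_abs _).trans (h1.trans
      (mul_le_mul_of_nonneg_left hn.2 h0))) (Real.sqrt_nonneg n)
    rw [mul_sqrt_div_cancel hpos] at h2
    linarith
  have := eventually_le_integral_sumTest hc h.measurable_diff h.abs_diff_le h.integral_diff
    h.nrm_diff_pos (c := crit P Λ τ r₀ v' v'' u) hm ε hε
  have e : (τ * (τ * nrm P (clip Λ v' v'') ^ 2 + r₀ * (v'' - v')) - crit P Λ τ r₀ v' v'' u) /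
      nrm P (fun x => τ * clip Λ v' v'' x) = -u + τ * nrm P (clip Λ v' v'') := by
    rw [div_eq_iff h.nrm_diff_pos.ne', h.nrm_diff, crit]; ring
  rwa [e] at this

lemma integral_pos_extremeTangent (h : ClipData P Λ τ (r₀ + r₁) v' v'') :
    ∫ x, max (extremeTangent Λ τ (r₀ + r₁) v' v'' x) 0 ∂P = 1 ∧
      ∫ x, max (-extremeTangent Λ τ (r₀ + r₁) v' v'' x) 0 ∂P = 1 := by
  obtain ⟨h1, h2⟩ := integral_pos_part_of_tangent h.isTangent_extremeTangent
  have e : ∀ x, max (extremeTangent Λ τ (r₀ + r₁) v' v'' x) 0 =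
      τ / (r₀ + r₁) * max (Λ x - v'') 0 := fun x => by
    have := h.neg
    have := h.pos
    have hq : 0 < τ / (r₀ + r₁) := div_pos h.tau_pos h.r_pos
    have e1 : extremeTangent Λ τ (r₀ + r₁) v' v'' x =
      τ / (r₀ + r₁) * (max (Λ x - v'') 0 - max (v' - Λ x) 0) := by rw [extremeTangent]; ring
    rw [e1]
    rcases le_total (Λ x) v'' with hl | hl
    · rw [max_eq_right (by linarith : Λ x - v'' ≤ 0), mul_zero]
      exact max_eq_right (mul_nonpos_of_nonneg_of_nonpos hq.le
        (by linarith [le_max_right (v' - Λ x) 0]))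
    · rw [max_eq_right (by linarith : v' - Λ x ≤ 0), sub_zero]
      exact max_eq_left (mul_nonneg hq.le (le_max_right _ _))
  have h3 : ∫ x, max (extremeTangent Λ τ (r₀ + r₁) v' v'' x) 0 ∂P = 1 := by
    simp_rw [e]
    rw [integral_const_mul, div_mul_eq_mul_div, h.upper, div_self h.r_pos.ne']
  exact ⟨h3, by rw [h2, ← h1, h3]⟩

/-- Members of the balls that asymptotically form the least favorable tangent pair. -/
lemma exists_least_favorable_sequences (h : ClipData P Λ τ (r₀ + r₁) v' v'') (hD : IsQMD P D (fun x => τ * Λ x) η) (hr₀ : 0 ≤ r₀)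
    (hr₁ : 0 ≤ r₁) :
    ∃ (B C : ℕ → Measure Ω) (ξ ζ : ℕ → Ω → ℝ),
      IsQMD P B (fun x => r₀ * extremeTangent Λ τ (r₀ + r₁) v' v'' x) ξ ∧
      IsQMD P C (fun x => τ * Λ x - r₁ * extremeTangent Λ τ (r₀ + r₁) v' v'' x) ζ ∧
      (∀ᶠ n : ℕ in atTop, B n ∈ tvBall P (r₀ / Real.sqrt n)) ∧
      ∀ᶠ n : ℕ in atTop, C n ∈ tvBall (D n) (r₁ / Real.sqrt n) := by
  obtain ⟨h1, h2⟩ := h.integral_pos_extremeTangent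
  obtain ⟨B, ξ, hB, hBm⟩ := (isQMD_const P).exists_mem_tvBall h.measurable_extremeTangent
    h.memLp_extremeTangent h1 h2 r₀
  obtain ⟨C, ζ, hC, hCm⟩ := hD.exists_mem_tvBall h.measurable_extremeTangent
    h.memLp_extremeTangent h1 h2 (-r₁)
  rw [abs_of_nonneg hr₀] at hBm
  rw [abs_neg, abs_of_nonneg hr₁] at hCm
  simp only [zero_add] at hB
  simp only [neg_mul, ← sub_eq_add_neg] at hC
  exact ⟨B, C, ξ, ζ, hB, hC, hBm, hCm⟩

/-- The sequences `B` and `C` lie in the balls, so a competitor's maximum size and minimum power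
bound its size and power in the simple problem, where the power cannot exceed `Φ(-u + τ ‖clip‖)`.
The clipped test reaches this value uniformly. -/
theorem isRobustMaxminTest_optTest (h : ClipData P Λ τ (r₀ + r₁) v' v'') (hD : IsQMD P D (fun x => τ * Λ x) η) (hr₀ : 0 ≤ r₀)
    (hr₁ : 0 ≤ r₁) :
    IsRobustMaxminTest P D r₀ r₁ (Phi (-u)) (optTest P Λ τ r₀ v' v'' u) := by
  refine ⟨h.isTestSeq_optTest, ?_, fun δ hδ hsize => ?_⟩
  · exact limsup_le_of_forall (Eventually.of_forall fun n => (maxSize_mem hr₀ h.isTestSeq_optTest n).1)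
      fun ε hε => (h.eventually_size_ball_le hr₀ hε).mono fun n hn => maxSize_le hr₀ hn
  · obtain ⟨B, C, ξ, ζ, hB, hC, hBm, hCm⟩ := h.exists_least_favorable_sequences hD hr₀ hr₁
    refine (liminf_le_of_forall (a := Phi (-u + τ * nrm P (clip Λ v' v'')))
      (hD.prob.mono fun n hn => (minPower_mem hr₁ hδ n).1) fun ε hε => ?_).trans
      (le_liminf_of_forall (hD.prob.mono fun n hn => (minPower_mem hr₁ h.isTestSeq_optTest n).2)
        fun ε hε => ?_)
    · have hs : ∀ ε > 0, ∀ᶠ n in atTop, ∫ x, δ n x ∂(iid (B n) n) ≤ Phi (-u) + ε := fun ε hε => by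
        filter_upwards [hBm, eventually_le_of_limsup_le (Eventually.of_forall fun n =>
          (maxSize_mem hr₀ hδ n).2) hsize hε] with n h1 h2
        exact (integral_le_maxSize hδ h1).trans h2
      have hp := eventually_power_le hB hC h.measurable_diff h.abs_diff_le h.integral_diff
        h.nrm_diff_pos (ae_of_all _ h.diff_eq) hδ hs ε hε
      rw [h.nrm_diff] at hp
      filter_upwards [hp, hCm] with n h1 h2
      exact (minPower_le_integral hδ h2).trans h1
    · filter_upwards [h.eventually_le_power_ball hD hr₁ hε, hD.prob] with n h1 h2
      exact le_minPower hr₁ h1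

end ClipData

end Balls

/-! ### Stochastic order and randomized quantiles -/

section StochasticOrder

lemma measure_Ioi_le_of_forall {M : Measure ℝ≥0} {a : ℝ≥0} {b : ℝ≥0∞}
    (h : ∀ t, a < t → M (Set.Ioi t) ≤ b) : M (Set.Ioi a) ≤ b := by
  obtain ⟨u, hu, hau, hlim⟩ := exists_seq_strictAnti_tendsto a
  have e : Set.Ioi a = ⋃ k, Set.Ioi (u k) := by
    ext x
    simp only [Set.mem_Ioi, Set.mem_iUnion]
    exact ⟨fun hx => (hlim.eventually (gt_mem_nhds hx)).exists, fun ⟨k, hk⟩ => (hau k).trans hk⟩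
  rw [e]
  refine le_of_tendsto (tendsto_measure_iUnion_atTop fun i j hij =>
    Set.Ioi_subset_Ioi (hu.antitone hij)) (Eventually.of_forall fun k => h _ (hau k))

lemma le_measure_Ici {M : Measure ℝ≥0} [IsFiniteMeasure M] {a : ℝ≥0} (ha : 0 < a) {b : ℝ≥0∞}
    (h : ∀ t, 0 < t → t < a → b ≤ M (Set.Ioi t)) : b ≤ M (Set.Ici a) := by
  obtain ⟨u, hu, hau, hlim⟩ := exists_seq_strictMono_tendsto' ha
  have e : Set.Ici a = ⋂ k, Set.Ioi (u k) := by
    ext x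
    simp only [Set.mem_Ici, Set.mem_iInter, Set.mem_Ioi]
    exact ⟨fun hx k => (hau k).2.trans_le hx, fun hx => le_of_tendsto' hlim fun k => (hx k).le⟩
  rw [e]
  refine ge_of_tendsto (tendsto_measure_iInter_atTop (fun i => measurableSet_Ioi.nullMeasurableSet)
    (fun i j hij => Set.Ioi_subset_Ioi (hu.monotone hij)) ⟨0, measure_ne_top _ _⟩)
    (Eventually.of_forall fun k => h _ (hau k).1 (hau k).2)

lemma Ici_zero_eq_univ : Set.Ici (0 : ℝ≥0) = Set.univ := 
  Set.eq_univ_of_forall fun _ => Set.mem_Ici.2 zero_le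

/-- An upper set is a ray, closed or open according to whether it contains its infimum, and rays are
monotone limits of open rays with positive end points. The closed ray at zero is the whole space,
where the masses agree. -/
lemma measure_upperSet_le {M N : Measure ℝ≥0} [IsProbabilityMeasure M] [IsProbabilityMeasure N]
    (h : ∀ t, 0 < t → M (Set.Ioi t) ≤ N (Set.Ioi t)) {A : Set ℝ≥0} (hA : IsUpperSet A) :
    M A ≤ N A := by
  rcases A.eq_empty_or_nonempty with rfl | hne
  · simp
  by_cases ha : sInf A ∈ A
  · have e : A = Set.Ici (sInf A) :=
      Set.Subset.antisymm (fun x hx => csInf_le (OrderBot.bddBelow A) hx) fun x hx => hA hx ha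
    rw [e]
    rcases eq_or_lt_of_le (zero_le : 0 ≤ sInf A) with h0 | h0
    · rw [← h0, Ici_zero_eq_univ, measure_univ, measure_univ]
    · exact le_measure_Ici h0 fun t ht hta =>
        (measure_mono fun x hx => hta.trans_le hx).trans (h t ht)
  · have e : A = Set.Ioi (sInf A) := by
      refine Set.Subset.antisymm (fun x hx => lt_of_le_of_ne (csInf_le (OrderBot.bddBelow A) hx)
        fun hxe => ha (hxe ▸ hx)) fun x hx => ?_
      obtain ⟨y, hy, hyx⟩ := exists_lt_of_csInf_lt hne hx
      exact hA hyx.le hy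
    rw [e]
    exact measure_Ioi_le_of_forall fun t ht =>
      (h t (lt_of_le_of_lt zero_le ht)).trans (measure_mono (Set.Ioi_subset_Ioi ht.le))

/-- Layer cake formula: the superlevel sets of a monotone function are upper sets. -/
lemma lintegral_monotone_le {M N : Measure ℝ≥0} [IsProbabilityMeasure M] [IsProbabilityMeasure N]
    (h : ∀ t, 0 < t → M (Set.Ioi t) ≤ N (Set.Ioi t)) {G : ℝ≥0 → ℝ} (hG : Monotone G)
    (hG0 : ∀ t, 0 ≤ G t) : ∫⁻ t, ENNReal.ofReal (G t) ∂M ≤ ∫⁻ t, ENNReal.ofReal (G t) ∂N := by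
  rw [lintegral_eq_lintegral_meas_lt M (ae_of_all _ hG0) hG.measurable.aemeasurable,
    lintegral_eq_lintegral_meas_lt N (ae_of_all _ hG0) hG.measurable.aemeasurable]
  exact lintegral_mono fun s => measure_upperSet_le h fun x y hxy hx => hx.trans_le (hG hxy)

lemma iid_succ_apply (μ : Measure Ω) [IsProbabilityMeasure μ] {n : ℕ} {S : Set (Fin (n + 1) → Ω)}
    (hS : MeasurableSet S) :
    iid μ (n + 1) S = ∫⁻ a, iid μ n {y | (Fin.cons a y : Fin (n + 1) → Ω) ∈ S} ∂μ := by
  have hmp := (measurePreserving_piFinSuccAbove (fun _ : Fin (n + 1) => μ) 0).symm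
  have hm : MeasurableSet ((MeasurableEquiv.piFinSuccAbove (fun _ : Fin (n + 1) => Ω) 0).symm ⁻¹' S) :=
    (MeasurableEquiv.measurable _) hS
  rw [iid, ← hmp.measure_preimage hS.nullMeasurableSet, Measure.prod_apply hm]
  refine lintegral_congr fun a => congrArg _ (Set.ext fun y => ?_)
  simp only [Set.mem_preimage, MeasurableEquiv.piFinSuccAbove_symm_apply, Fin.insertNthEquiv,
    Equiv.coe_fn_mk, Fin.insertNth_zero]
  rfl

variable {μ ν : Measure Ω} [IsProbabilityMeasure μ] [IsProbabilityMeasure ν] {π : Ω → ℝ≥0}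

lemma measurable_prod_comp (hπ : Measurable π) (n : ℕ) :
    Measurable fun x : Fin n → Ω => ∏ i, π (x i) :=
  Finset.measurable_prod _ fun i _ => hπ.comp (measurable_pi_apply i)

lemma map_Ioi_le (hπ : Measurable π) (h : ∀ t, 0 < t → μ {x | t < π x} ≤ ν {x | t < π x})
    (t : ℝ≥0) (ht : 0 < t) : μ.map π (Set.Ioi t) ≤ ν.map π (Set.Ioi t) := by
  rw [Measure.map_apply hπ measurableSet_Ioi, Measure.map_apply hπ measurableSet_Ioi]
  exact h t ht

/-- Induction on `n`. Given the value `r` of the first factor, the induction hypothesis at `t / r`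
replaces `μ` by `ν` in the other coordinates; the resulting probability increases with `r`, so the
first coordinate may be exchanged as well. -/
lemma iid_prod_gt_le (hπ : Measurable π) (h : ∀ t, 0 < t → μ {x | t < π x} ≤ ν {x | t < π x})
    (n : ℕ) (t : ℝ≥0) :
    iid μ n {x | t < ∏ i, π (x i)} ≤ iid ν n {x | t < ∏ i, π (x i)} := by
  have := Measure.isProbabilityMeasure_map (μ := μ) hπ.aemeasurable
  have := Measure.isProbabilityMeasure_map (μ := ν) hπ.aemeasurable
  induction n generalizing t with
  | zero =>
    have := iid_isProbabilityMeasure μ 0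
    have := iid_isProbabilityMeasure ν 0
    simp only [Finset.univ_eq_empty, Finset.prod_empty]
    by_cases ht : t < 1 <;> simp [ht]
  | succ n ih =>
    have := iid_isProbabilityMeasure ν n
    have hm : MeasurableSet {x : Fin (n + 1) → Ω | t < ∏ i, π (x i)} :=
      measurable_prod_comp hπ (n + 1) measurableSet_Ioi
    rw [iid_succ_apply μ hm, iid_succ_apply ν hm]
    simp only [Set.mem_ofPred_eq, Fin.prod_univ_succ, Fin.cons_zero, Fin.cons_succ]
    set G : ℝ≥0 → ℝ := fun r => (iid ν n).real {y | t < r * ∏ i, π (y i)} with hG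
    have hGm : Monotone G := fun r r' hr => measureReal_mono fun y hy =>
      lt_of_lt_of_le hy (mul_le_mul_left hr _)
    have step : ∀ r : ℝ≥0, iid μ n {y | t < r * ∏ i, π (y i)} ≤ ENNReal.ofReal (G r) := fun r => by
      rw [hG, ofReal_measureReal]
      rcases eq_or_lt_of_le (zero_le : 0 ≤ r) with h0 | h0
      · rw [← h0]; simp
      · have e : ∀ y : Fin n → Ω, t < r * ∏ i, π (y i) ↔ t / r < ∏ i, π (y i) := fun y => by
          rw [div_lt_iff₀ h0, mul_comm]
        simp only [e]
        exact ih _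
    calc ∫⁻ a, iid μ n {y | t < π a * ∏ i, π (y i)} ∂μ
        ≤ ∫⁻ a, ENNReal.ofReal (G (π a)) ∂μ := lintegral_mono fun a => step (π a)
      _ = ∫⁻ r, ENNReal.ofReal (G r) ∂(μ.map π) :=
          (lintegral_map hGm.measurable.ennreal_ofReal hπ).symm
      _ ≤ ∫⁻ r, ENNReal.ofReal (G r) ∂(ν.map π) :=
          lintegral_monotone_le (map_Ioi_le hπ h) hGm fun r => measureReal_nonneg
      _ = ∫⁻ a, ENNReal.ofReal (G (π a)) ∂ν := lintegral_map hGm.measurable.ennreal_ofReal hπ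
      _ = ∫⁻ a, iid ν n {y | t < π a * ∏ i, π (y i)} ∂ν :=
          lintegral_congr fun a => by rw [hG, ofReal_measureReal]

/-- Expectations of increasing functions of the product statistic are stochastically ordered. -/
lemma integral_monotone_prod_le (hπ : Measurable π)
    (h : ∀ t, 0 < t → μ {x | t < π x} ≤ ν {x | t < π x}) {G : ℝ≥0 → ℝ} (hG : Monotone G)
    (hG0 : ∀ t, 0 ≤ G t) (hG1 : ∀ t, G t ≤ 1) (n : ℕ) :
    ∫ x, G (∏ i, π (x i)) ∂(iid μ n) ≤ ∫ x, G (∏ i, π (x i)) ∂(iid ν n) := by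
  have := iid_isProbabilityMeasure μ n
  have := iid_isProbabilityMeasure ν n
  have hT := measurable_prod_comp hπ n
  have := Measure.isProbabilityMeasure_map (μ := iid μ n) hT.aemeasurable
  have := Measure.isProbabilityMeasure_map (μ := iid ν n) hT.aemeasurable
  have hGT : Measurable fun x : Fin n → Ω => G (∏ i, π (x i)) := hG.measurable.comp hT
  have key := lintegral_monotone_le (map_Ioi_le (μ := iid μ n) (ν := iid ν n) hT
    fun t _ => iid_prod_gt_le hπ h n t) hG hG0
  rw [lintegral_map hG.measurable.ennreal_ofReal hT,
    lintegral_map hG.measurable.ennreal_ofReal hT] at key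
  rw [integral_eq_lintegral_of_nonneg_ae (ae_of_all _ fun x => hG0 _) hGT.aestronglyMeasurable,
    integral_eq_lintegral_of_nonneg_ae (ae_of_all _ fun x => hG0 _) hGT.aestronglyMeasurable]
  refine ENNReal.toReal_mono (ne_top_of_le_ne_top ENNReal.one_ne_top ?_) key
  calc ∫⁻ x, ENNReal.ofReal (G (∏ i, π (x i))) ∂(iid ν n) ≤ ∫⁻ _, 1 ∂(iid ν n) :=
        lintegral_mono fun x => by simpa using hG1 _
    _ = 1 := by simp

open Classical in
/-- Rejection probability of the test with critical value `c` and randomization constant `γ`. -/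
def randomized (c : ℝ≥0) (γ : ℝ) (t : ℝ≥0) : ℝ := if c < t then 1 else if t = c then γ else 0

lemma randomized_mem {c : ℝ≥0} {γ : ℝ} (h0 : 0 ≤ γ) (h1 : γ ≤ 1) (t : ℝ≥0) :
    0 ≤ randomized c γ t ∧ randomized c γ t ≤ 1 := by
  unfold randomized
  split_ifs <;> constructor <;> linarith

lemma monotone_randomized {c : ℝ≥0} {γ : ℝ} (h0 : 0 ≤ γ) (h1 : γ ≤ 1) :
    Monotone (randomized c γ) := fun s t hst => by
  unfold randomized
  by_cases hs : c < s
  · rw [if_pos hs, if_pos (hs.trans_le hst)]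
  · rw [if_neg hs]
    by_cases hsc : s = c
    · rw [if_pos hsc]
      subst hsc
      rcases eq_or_lt_of_le hst with h | h
      · rw [← h]; simp
      · rw [if_pos h]; exact h1
    · rw [if_neg hsc]
      exact (randomized_mem h0 h1 t).1

lemma integral_randomized (M : Measure ℝ≥0) [IsProbabilityMeasure M] (c : ℝ≥0) (γ : ℝ) :
    ∫ t, randomized c γ t ∂M = M.real (Set.Ioi c) + γ * M.real {c} := by
  have e : ∀ t, randomized c γ t =
      (Set.Ioi c).indicator 1 t + γ * ({c} : Set ℝ≥0).indicator 1 t := fun t => by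
    unfold randomized
    by_cases h1 : c < t
    · have : t ∉ ({c} : Set ℝ≥0) := fun h => h1.ne' h
      rw [if_pos h1, Set.indicator_of_mem (by exact h1), Set.indicator_of_notMem this]
      simp
    · rw [if_neg h1, Set.indicator_of_notMem (by exact h1)]
      by_cases h2 : t = c
      · rw [if_pos h2, Set.indicator_of_mem (by exact h2)]; simp
      · rw [if_neg h2, Set.indicator_of_notMem (by exact h2)]; simp
  simp_rw [e]
  have i1 : Integrable ((Set.Ioi c).indicator (1 : ℝ≥0 → ℝ)) M :=
    (integrable_const 1).indicator measurableSet_Ioi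
  have i2 : Integrable (({c} : Set ℝ≥0).indicator (1 : ℝ≥0 → ℝ)) M :=
    (integrable_const 1).indicator (measurableSet_singleton c)
  rw [integral_add i1 (i2.const_mul γ), integral_const_mul,
    integral_indicator_one measurableSet_Ioi, integral_indicator_one (measurableSet_singleton c)]

/-- With `c` the upper quantile, `α` lies between the masses of the open and of the closed ray at
`c`; randomization at the atom makes up the difference. -/
lemma exists_randomized_quantile (M : Measure ℝ≥0) [IsProbabilityMeasure M] {α : ℝ} (h0 : 0 < α)
    (h1 : α < 1) : ∃ (c : ℝ≥0) (γ : ℝ), 0 ≤ γ ∧ γ ≤ 1 ∧ ∫ t, randomized c γ t ∂M = α := by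
  set S : Set ℝ≥0 := {t | M (Set.Ioi t) ≤ ENNReal.ofReal α} with hS
  have hne : S.Nonempty := by
    have hl : Tendsto (M ∘ fun k : ℕ => Set.Ioi (k : ℝ≥0)) atTop (𝓝 (M (⋂ k : ℕ, Set.Ioi (k : ℝ≥0)))) :=
      tendsto_measure_iInter_atTop (fun i => measurableSet_Ioi.nullMeasurableSet)
        (fun i j hij => Set.Ioi_subset_Ioi (by exact_mod_cast hij)) ⟨0, measure_ne_top _ _⟩
    have e : (⋂ k : ℕ, Set.Ioi (k : ℝ≥0)) = ∅ := by
      refine Set.eq_empty_of_forall_notMem fun x hx => ?_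
      obtain ⟨k, hk⟩ := exists_nat_gt x
      exact absurd (Set.mem_iInter.1 hx k) (not_lt.2 hk.le)
    rw [e, measure_empty] at hl
    obtain ⟨k, hk⟩ := (hl.eventually (gt_mem_nhds (ENNReal.ofReal_pos.2 h0))).exists
    exact ⟨k, hk.le⟩
  set c := sInf S with hc
  have hup : ∀ t, c < t → M (Set.Ioi t) ≤ ENNReal.ofReal α := fun t ht => by
    obtain ⟨s, hs, hst⟩ := exists_lt_of_csInf_lt hne ht
    exact (measure_mono (Set.Ioi_subset_Ioi hst.le)).trans hs
  have hlo : ∀ t, t < c → ENNReal.ofReal α ≤ M (Set.Ioi t) := fun t ht => by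
    by_contra hcon
    exact absurd (csInf_le (OrderBot.bddBelow S) (not_le.1 hcon).le) (not_le.2 ht)
  have hgt : M (Set.Ioi c) ≤ ENNReal.ofReal α := measure_Ioi_le_of_forall hup
  have hge : ENNReal.ofReal α ≤ M (Set.Ici c) := by
    rcases eq_or_lt_of_le (zero_le : 0 ≤ c) with h | h
    · rw [← h, Ici_zero_eq_univ, measure_univ]
      exact ENNReal.ofReal_le_one.2 h1.le
    · exact le_measure_Ici h fun t _ => hlo t
  have hgt' : M.real (Set.Ioi c) ≤ α := ENNReal.toReal_le_of_le_ofReal h0.le hgt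
  have hge' : α ≤ M.real (Set.Ioi c) + M.real {c} := by
    have e : Set.Ici c = Set.Ioi c ∪ {c} := by rw [Set.Ioi_union_left]
    have h2 : α ≤ M.real (Set.Ici c) := (ENNReal.ofReal_le_iff_le_toReal (measure_ne_top _ _)).1 hge
    rwa [e, measureReal_union (by simp) (measurableSet_singleton c)] at h2
  rcases eq_or_lt_of_le (measureReal_nonneg (μ := M) (s := {c})) with h | h
  · refine ⟨c, 0, le_rfl, zero_le_one, ?_⟩
    rw [integral_randomized]
    linarith
  · refine ⟨c, (α - M.real (Set.Ioi c)) / M.real {c}, div_nonneg (by linarith) h.le, ?_, ?_⟩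
    · rw [div_le_one h]; linarith
    · rw [integral_randomized, div_mul_cancel₀ _ h.ne']; ring

end StochasticOrder

/-! ### Least favorable probability pairs for total variation balls -/

section HuberPair

lemma real_withDensity_ofReal {ν : Measure Ω} {f : Ω → ℝ} (hf : Measurable f) (hf0 : ∀ x, 0 ≤ f x)
    {A : Set Ω} (hA : MeasurableSet A) :
    (ν.withDensity fun x => ENNReal.ofReal (f x)).real A = ∫ x in A, f x ∂ν := by
  rw [← integral_indicator_one hA, integral_withDensity_ofReal hf hf0, ← integral_indicator hA]
  refine integral_congr_ae (ae_of_all _ fun x => ?_)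
  by_cases hx : x ∈ A <;> simp [hx]

lemma isProbabilityMeasure_withDensity_ofReal {ν : Measure Ω} {f : Ω → ℝ} (hf : Integrable f ν)
    (hf0 : ∀ x, 0 ≤ f x) (h1 : ∫ x, f x ∂ν = 1) :
    IsProbabilityMeasure (ν.withDensity fun x => ENNReal.ofReal (f x)) := by
  refine ⟨?_⟩
  rw [withDensity_apply _ MeasurableSet.univ, Measure.restrict_univ,
    ← ofReal_integral_eq_lintegral_ofReal hf (ae_of_all _ hf0), h1, ENNReal.ofReal_one]

variable (P D : Measure Ω)

/-- The positive part of `dD - c dP`. -/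
def excess (c : ℝ) (x : Ω) : ℝ := max (dens D P x - c * dens P D x) 0

/-- The positive part of `c dP - dD`. -/
def deficit (c : ℝ) (x : Ω) : ℝ := max (c * dens P D x - dens D P x) 0

open Classical in
/-- The truncated likelihood ratio. -/
def clippedRatio (c₀ c₁ : ℝ) (x : Ω) : ℝ :=
  -- The first branch covers the points where only the density of `P` vanishes. Where both vanish
  -- the quotient is zero by convention, and the value is `c₀` if `c₀ ≥ 0`.
  if c₁ * dens P D x < dens D P x then c₁ else max c₀ (dens D P x / dens P D x)

lemma measurable_excess (c : ℝ) : Measurable (excess P D c) :=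
  ((measurable_dens D P).sub ((measurable_dens P D).const_mul c)).max measurable_const

lemma measurable_deficit (c : ℝ) : Measurable (deficit P D c) :=
  (((measurable_dens P D).const_mul c).sub (measurable_dens D P)).max measurable_const

lemma measurable_clippedRatio (c₀ c₁ : ℝ) : Measurable (clippedRatio P D c₀ c₁) :=
  Measurable.ite (measurableSet_lt ((measurable_dens P D).const_mul c₁) (measurable_dens D P))
    measurable_const (measurable_const.max ((measurable_dens D P).div (measurable_dens P D)))

variable {P D} in
lemma le_clippedRatio {c₀ c₁ : ℝ} (h : c₀ ≤ c₁) (x : Ω) : c₀ ≤ clippedRatio P D c₀ c₁ x := by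
  unfold clippedRatio
  split_ifs
  · exact h
  · exact le_max_left _ _

variable {P D} in
lemma clippedRatio_le {c₀ c₁ : ℝ} (h0 : 0 ≤ c₁) (h : c₀ ≤ c₁) (x : Ω) :
    clippedRatio P D c₀ c₁ x ≤ c₁ := by
  unfold clippedRatio
  split_ifs with hx
  · exact le_rfl
  · refine max_le h ?_
    rcases eq_or_lt_of_le (dens_nonneg P D x) with h1 | h1
    · rw [← h1, div_zero]; exact h0
    · rw [div_le_iff₀ h1]; exact not_lt.1 hx

variable {P D} in
lemma excess_eq_zero {c₀ c₁ t : ℝ} (ht : t < c₁) {x : Ω}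
    (hx : ¬ t < clippedRatio P D c₀ c₁ x) : excess P D c₁ x = 0 := by
  refine max_eq_right ?_
  by_contra hcon
  refine hx ?_
  unfold clippedRatio
  rw [if_pos (by linarith)]
  exact ht

variable {P D} in
lemma deficit_eq_zero {c₀ c₁ t : ℝ} (h : c₀ ≤ c₁) (ht : c₀ ≤ t) {x : Ω}
    (hx : t < clippedRatio P D c₀ c₁ x) : deficit P D c₀ x = 0 := by
  refine max_eq_right ?_
  unfold clippedRatio at hx
  split_ifs at hx with h1
  · have := mul_le_mul_of_nonneg_right h (dens_nonneg P D x)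
    linarith
  · have h2 : c₀ < dens D P x / dens P D x := by
      rcases lt_max_iff.1 hx with h2 | h2 <;> linarith
    rcases eq_or_lt_of_le (dens_nonneg P D x) with h3 | h3
    · rw [← h3, mul_zero]; linarith [dens_nonneg D P x]
    · rw [lt_div_iff₀ h3] at h2; linarith

-- The denominators `r₁ + c r₀` are chosen such that beyond the threshold `c` both modified
-- densities are multiples of `r₁ dP + r₀ dD`, in the ratio `1 : c`. Between the thresholds nothing
-- is changed.
variable {P D} in
lemma clippedRatio_mul {r₀ r₁ c₀ c₁ : ℝ} (hr₀ : 0 ≤ r₀) (hr₁ : 0 ≤ r₁) (hr : 0 < r₀ + r₁)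
    (h0 : 0 < c₀) (h : c₀ < c₁) (x : Ω) :
    0 ≤ dens P D x + r₀ * (excess P D c₁ x / (r₁ + c₁ * r₀) - deficit P D c₀ x / (r₁ + c₀ * r₀)) ∧
    dens D P x - r₁ * (excess P D c₁ x / (r₁ + c₁ * r₀) - deficit P D c₀ x / (r₁ + c₀ * r₀)) =
      clippedRatio P D c₀ c₁ x * (dens P D x + r₀ * (excess P D c₁ x / (r₁ + c₁ * r₀) -
        deficit P D c₀ x / (r₁ + c₀ * r₀))) := by
  have ha : ∀ c : ℝ, 0 < c → 0 < r₁ + c * r₀ := fun c hc => by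
    rcases eq_or_lt_of_le hr₀ with h1 | h1
    · rw [← h1] at hr ⊢; linarith
    · linarith [mul_pos hc h1]
  have a0 := ha c₀ h0
  have a1 := ha c₁ (h0.trans h)
  have hp := dens_nonneg P D x
  have hd := dens_nonneg D P x
  unfold excess deficit clippedRatio
  set p := dens P D x
  set d := dens D P x
  have hcp := mul_le_mul_of_nonneg_right h.le hp
  by_cases h1 : c₁ * p < d
  · rw [if_pos h1, max_eq_left (by linarith), max_eq_right (by linarith), zero_div, sub_zero]
    refine ⟨add_nonneg hp (mul_nonneg hr₀ (div_nonneg (by linarith) a1.le)), ?_⟩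
    field_simp
    ring
  · rw [if_neg h1, max_eq_right (by linarith : d - c₁ * p ≤ 0), zero_div, zero_sub]
    by_cases h2 : d < c₀ * p
    · have hp0 : 0 < p := by
        rcases eq_or_lt_of_le hp with h3 | h3
        · rw [← h3] at h2; linarith
        · exact h3
      have h4 : max c₀ (d / p) = c₀ := max_eq_left ((div_le_iff₀ hp0).2 h2.le)
      rw [h4, max_eq_left (by linarith)]
      constructor
      · have e : p + r₀ * -((c₀ * p - d) / (r₁ + c₀ * r₀)) = (r₁ * p + r₀ * d) / (r₁ + c₀ * r₀) := by
          rw [eq_div_iff a0.ne', add_mul, mul_assoc r₀, neg_mul, div_mul_cancel₀ _ a0.ne']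
          ring
        rw [e]
        exact div_nonneg (add_nonneg (mul_nonneg hr₁ hp) (mul_nonneg hr₀ hd)) a0.le
      · field_simp
        ring
    · rw [max_eq_right (by linarith : c₀ * p - d ≤ 0), zero_div, neg_zero, mul_zero, mul_zero,
        add_zero, sub_zero]
      refine ⟨hp, ?_⟩
      rcases eq_or_lt_of_le hp with h3 | h3
      · rw [← h3] at h1 ⊢
        linarith
      · rw [max_eq_right ((le_div_iff₀ h3).2 (not_lt.1 h2)), div_mul_cancel₀ _ h3.ne']

variable {P D} [IsProbabilityMeasure P] [IsProbabilityMeasure D]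

lemma integrable_dens_left : Integrable (dens P D) (P + D) := by
  simpa using integrable_dens_mul' (Q := D) (P := P) (integrable_const (1 : ℝ))

lemma integrable_dens_right : Integrable (dens D P) (P + D) := by
  simpa using integrable_dens_mul (Q := D) (P := P) (integrable_const (1 : ℝ))

lemma setIntegral_dens_left {A : Set Ω} (hA : MeasurableSet A) :
    ∫ x in A, dens P D x ∂(P + D) = P.real A := by
  rw [← integral_indicator_one hA, ← integral_dens_mul' (Q := D) (P := P), ← integral_indicator hA]
  refine integral_congr_ae (ae_of_all _ fun x => ?_)
  by_cases hx : x ∈ A <;> simp [hx]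

lemma setIntegral_dens_right {A : Set Ω} (hA : MeasurableSet A) :
    ∫ x in A, dens D P x ∂(P + D) = D.real A := by
  rw [← integral_indicator_one hA, ← integral_dens_mul (Q := D) (P := P), ← integral_indicator hA]
  refine integral_congr_ae (ae_of_all _ fun x => ?_)
  by_cases hx : x ∈ A <;> simp [hx]

lemma integrable_excess (c : ℝ) : Integrable (excess P D c) (P + D) :=
  (integrable_dens_right.sub (integrable_dens_left.const_mul c)).pos_part

lemma integrable_deficit (c : ℝ) : Integrable (deficit P D c) (P + D) :=
  ((integrable_dens_left.const_mul c).sub integrable_dens_right).pos_part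

/-- Existence of a least favorable probability pair, given the clipping constants. -/
lemma exists_isLeastFavorableProbPair {r₀ r₁ c₀ c₁ ε : ℝ} (hr₀ : 0 ≤ r₀) (hr₁ : 0 ≤ r₁)
    (hr : 0 < r₀ + r₁) (h0 : 0 < c₀) (h : c₀ < c₁)
    (h1 : ∫ x, excess P D c₁ x ∂(P + D) = ε * (r₁ + c₁ * r₀))
    (h2 : ∫ x, deficit P D c₀ x ∂(P + D) = ε * (r₁ + c₀ * r₀)) :
    ∃ Q₀ Q₁ π, IsLeastFavorableProbPair (tvBall P (r₀ * ε)) (tvBall D (r₁ * ε)) Q₀ Q₁ π := by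
  set ν := P + D with hν
  have ha : ∀ c : ℝ, 0 < c → 0 < r₁ + c * r₀ := fun c hc => by
    rcases eq_or_lt_of_le hr₀ with h1 | h1
    · rw [← h1] at hr ⊢; linarith
    · linarith [mul_pos hc h1]
  have a0 := ha c₀ h0
  have a1 := ha c₁ (h0.trans h)
  set s : Ω → ℝ := fun x => excess P D c₁ x / (r₁ + c₁ * r₀) with hs
  set t : Ω → ℝ := fun x => deficit P D c₀ x / (r₁ + c₀ * r₀) with ht
  set q₀ : Ω → ℝ := fun x => dens P D x + r₀ * (s x - t x) with hq₀
  set q₁ : Ω → ℝ := fun x => dens D P x - r₁ * (s x - t x) with hq₁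
  set ρ := clippedRatio P D c₀ c₁ with hρ
  have hρM : Measurable ρ := measurable_clippedRatio P D c₀ c₁
  have hρ0 : ∀ x, 0 ≤ ρ x := fun x => h0.le.trans (le_clippedRatio h.le x)
  have q0n : ∀ x, 0 ≤ q₀ x := fun x => (clippedRatio_mul hr₀ hr₁ hr h0 h x).1
  have q10 : ∀ x, q₁ x = ρ x * q₀ x := fun x => (clippedRatio_mul hr₀ hr₁ hr h0 h x).2
  have q1n : ∀ x, 0 ≤ q₁ x := fun x => by rw [q10]; exact mul_nonneg (hρ0 x) (q0n x)
  have sM : Measurable s := (measurable_excess P D c₁).div_const _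
  have tM : Measurable t := (measurable_deficit P D c₀).div_const _
  have q0M : Measurable q₀ := (measurable_dens P D).add ((sM.sub tM).const_mul _)
  have q1M : Measurable q₁ := (measurable_dens D P).sub ((sM.sub tM).const_mul _)
  have sI : Integrable s ν := (integrable_excess c₁).div_const _
  have tI : Integrable t ν := (integrable_deficit c₀).div_const _
  have s0 : ∀ x, 0 ≤ s x := fun x => div_nonneg (le_max_right _ _) a1.le
  have t0 : ∀ x, 0 ≤ t x := fun x => div_nonneg (le_max_right _ _) a0.le
  have sε : ∫ x, s x ∂ν = ε := by rw [integral_div, h1, mul_div_cancel_right₀ _ a1.ne']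
  have tε : ∫ x, t x ∂ν = ε := by rw [integral_div, h2, mul_div_cancel_right₀ _ a0.ne']
  have stI : Integrable (fun x => s x - t x) ν := sI.sub tI
  have q0I : Integrable q₀ ν := integrable_dens_left.add (stI.const_mul _)
  have q1I : Integrable q₁ ν := integrable_dens_right.sub (stI.const_mul _)
  have q0A : ∀ A, MeasurableSet A → ∫ x in A, q₀ x ∂ν =
      P.real A + r₀ * (∫ x in A, s x ∂ν - ∫ x in A, t x ∂ν) := fun A hA => by
    rw [integral_add integrable_dens_left.integrableOn (stI.const_mul _).integrableOn,
      setIntegral_dens_left hA, integral_const_mul, integral_sub sI.integrableOn tI.integrableOn]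
  have q1A : ∀ A, MeasurableSet A → ∫ x in A, q₁ x ∂ν =
      D.real A - r₁ * (∫ x in A, s x ∂ν - ∫ x in A, t x ∂ν) := fun A hA => by
    rw [integral_sub integrable_dens_right.integrableOn (stI.const_mul _).integrableOn,
      setIntegral_dens_right hA, integral_const_mul, integral_sub sI.integrableOn tI.integrableOn]
  have q01 : ∫ x, q₀ x ∂ν = 1 := by
    have := q0A Set.univ MeasurableSet.univ
    simpa [sε, tε] using this
  have q11 : ∫ x, q₁ x ∂ν = 1 := by
    have := q1A Set.univ MeasurableSet.univ
    simpa [sε, tε] using this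
  have iP0 := isProbabilityMeasure_withDensity_ofReal q0I q0n q01
  have iP1 := isProbabilityMeasure_withDensity_ofReal q1I q1n q11
  have hQ : (ν.withDensity fun x => ENNReal.ofReal (q₁ x)) =
      (ν.withDensity fun x => ENNReal.ofReal (q₀ x)).withDensity
        fun x => ((ρ x).toNNReal : ℝ≥0∞) := by
    rw [← withDensity_mul _ q0M.ennreal_ofReal hρM.real_toNNReal.coe_nnreal_ennreal]
    congr 1
    funext x
    rw [Pi.mul_apply, q10, mul_comm, ENNReal.ofReal_mul (q0n x)]
    rfl
  have hsA : ∀ A : Set Ω, 0 ≤ ∫ x in A, s x ∂ν ∧ ∫ x in A, s x ∂ν ≤ ε := fun A =>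
    ⟨integral_nonneg fun x => s0 x, sε ▸ setIntegral_le_integral sI (ae_of_all _ s0)⟩
  have htA : ∀ A : Set Ω, 0 ≤ ∫ x in A, t x ∂ν ∧ ∫ x in A, t x ∂ν ≤ ε := fun A =>
    ⟨integral_nonneg fun x => t0 x, tε ▸ setIntegral_le_integral tI (ae_of_all _ t0)⟩
  refine ⟨_, _, fun x => (ρ x).toNNReal, ⟨iP0, ?_⟩, ⟨iP1, ?_⟩, hρM.real_toNNReal, hQ, fun y hy => ?_⟩
  · refine tvDistance_le_of_forall fun A hA => ?_
    rw [real_withDensity_ofReal q0M q0n hA, q0A A hA, add_sub_cancel_left]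
    exact mul_le_mul_of_nonneg_left (by linarith [hsA A, htA A]) hr₀
  · refine tvDistance_le_of_forall fun A hA => ?_
    rw [real_withDensity_ofReal q1M q1n hA, q1A A hA, sub_sub_cancel_left, ← mul_neg]
    exact mul_le_mul_of_nonneg_left (by linarith [hsA A, htA A]) hr₁
  · have hS : {x | y < (ρ x).toNNReal} = {x | (y : ℝ) < ρ x} := by
      ext x
      simp only [Set.mem_ofPred_eq]
      rw [Real.lt_toNNReal_iff_coe_lt]
    rw [hS]
    set S := {x | (y : ℝ) < ρ x} with hSdef
    have hSm : MeasurableSet S := measurableSet_lt measurable_const hρM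
    by_cases hy1 : c₁ ≤ y
    · have hemp : S = ∅ := Set.eq_empty_of_forall_notMem fun x hx =>
        absurd (lt_of_lt_of_le hx (clippedRatio_le (h0.trans h).le h.le x)) (not_lt.2 hy1)
      rw [hemp]
      exact ⟨fun _ _ => by simp, fun _ _ => by simp⟩
    by_cases hy0 : (y : ℝ) < c₀
    · have huniv : S = Set.univ := Set.eq_univ_of_forall fun x =>
        lt_of_lt_of_le hy0 (le_clippedRatio h.le x)
      rw [huniv]
      refine ⟨fun Q' hQ' => ?_, fun Q'' hQ'' => ?_⟩
      · have := hQ'.1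
        rw [measure_univ, measure_univ]
      · have := hQ''.1
        rw [measure_univ, measure_univ]
    rw [not_le] at hy1
    rw [not_lt] at hy0
    -- For `c₀ ≤ y < c₁` the set `S` contains all of the excess and none of the deficit. So `Q₀`
    -- exceeds `P` there by `r₀ ε` and `Q₁` falls short of `D` by `r₁ ε`, the most that the balls
    -- allow.
    have eS : ∫ x in S, s x ∂ν = ε := by
      rw [← sε]
      refine setIntegral_eq_integral_of_forall_compl_eq_zero fun x hx => ?_
      simp only [hs]
      rw [excess_eq_zero hy1 hx, zero_div]
    have eT : ∫ x in S, t x ∂ν = 0 := by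
      refine setIntegral_eq_zero_of_forall_eq_zero fun x hx => ?_
      simp only [ht]
      rw [deficit_eq_zero h.le hy0 hx, zero_div]
    refine ⟨fun Q' hQ' => ?_, fun Q'' hQ'' => ?_⟩
    · have := hQ'.1
      rw [← ENNReal.toReal_le_toReal (measure_ne_top _ _) (measure_ne_top _ _)]
      change Q'.real S ≤ Measure.real _ S
      rw [real_withDensity_ofReal q0M q0n hSm, q0A S hSm, eS, eT]
      have := (abs_le.1 ((real_sub_le_tvDistance (Q := Q') (P := P) hSm).trans hQ'.2)).2
      linarith
    · have := hQ''.1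
      rw [← ENNReal.toReal_le_toReal (measure_ne_top _ _) (measure_ne_top _ _)]
      change Measure.real _ S ≤ Q''.real S
      rw [real_withDensity_ofReal q1M q1n hSm, q1A S hSm, eS, eT]
      have := (abs_le.1 ((real_sub_le_tvDistance (Q := Q'') (P := D) hSm).trans hQ''.2)).1
      linarith

/-! ### Solving for the truncation constants -/

lemma continuous_integral_max {ν : Measure Ω} {f g : Ω → ℝ} (hf : Integrable f ν)
    (hg : Integrable g ν) (a b : ℝ) :
    ContinuousOn (fun c => ∫ x, max (f x + c * g x) 0 ∂ν) (Set.Icc a b) := by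
  refine continuousOn_of_dominated (bound := fun x => |f x| + max |a| |b| * |g x|)
    (fun c _ => (hf.add (hg.const_mul c)).pos_part.aestronglyMeasurable)
    (fun c hc => ae_of_all _ fun x => ?_) (hf.abs.add (hg.abs.const_mul _))
    (ae_of_all _ fun x => by fun_prop)
  rw [Real.norm_eq_abs, abs_of_nonneg (le_max_right _ _)]
  have h1 : |c| ≤ max |a| |b| := abs_le_max_abs_abs hc.1 hc.2
  have h2 : c * g x ≤ max |a| |b| * |g x| :=
    (le_abs_self _).trans (by rw [abs_mul]; exact mul_le_mul_of_nonneg_right h1 (abs_nonneg _))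
  refine max_le (add_le_add (le_abs_self _) h2) (by positivity)

lemma continuousOn_excess (a b : ℝ) :
    ContinuousOn (fun c => ∫ x, excess P D c x ∂(P + D)) (Set.Icc a b) := by
  refine (continuous_integral_max integrable_dens_right (integrable_dens_left (P := P) (D := D)).neg
    a b).congr fun c _ => ?_
  refine integral_congr_ae (ae_of_all _ fun x => ?_)
  simp only [excess, Pi.neg_apply, mul_neg, sub_eq_add_neg]

lemma continuousOn_deficit (a b : ℝ) :
    ContinuousOn (fun c => ∫ x, deficit P D c x ∂(P + D)) (Set.Icc a b) := by
  refine (continuous_integral_max integrable_dens_right.neg (integrable_dens_left (P := P) (D := D))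
    a b).congr fun c _ => ?_
  refine integral_congr_ae (ae_of_all _ fun x => ?_)
  simp only [deficit, Pi.neg_apply]
  congr 1
  ring

lemma setIntegral_eq_of_pos_part {ν : Measure Ω} {f : Ω → ℝ} (hf : Measurable f) :
    ∫ x, max (f x) 0 ∂ν = ∫ x in {x | 0 < f x}, f x ∂ν := by
  rw [← integral_indicator (measurableSet_lt measurable_const hf)]
  refine integral_congr_ae (ae_of_all _ fun x => ?_)
  by_cases hx : 0 < f x
  · rw [Set.indicator_of_mem (by exact hx)]; exact max_eq_left hx.le
  · rw [Set.indicator_of_notMem (by exact hx)]; exact max_eq_right (not_lt.1 hx)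

lemma setIntegral_le_pos_part {ν : Measure Ω} {f : Ω → ℝ} (hf : Integrable f ν) (A : Set Ω) :
    ∫ x in A, f x ∂ν ≤ ∫ x, max (f x) 0 ∂ν :=
  (integral_mono hf.integrableOn hf.pos_part.integrableOn fun _ => le_max_left _ _).trans
    (setIntegral_le_integral hf.pos_part (ae_of_all _ fun _ => le_max_right _ _))

lemma setIntegral_dens_sub {A : Set Ω} (hA : MeasurableSet A) (c : ℝ) :
    ∫ x in A, (dens D P x - c * dens P D x) ∂(P + D) = D.real A - c * P.real A := by
  rw [integral_sub integrable_dens_right.integrableOn (integrable_dens_left.const_mul c).integrableOn,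
    setIntegral_dens_right hA, integral_const_mul, setIntegral_dens_left hA]

lemma setIntegral_sub_dens {A : Set Ω} (hA : MeasurableSet A) (c : ℝ) :
    ∫ x in A, (c * dens P D x - dens D P x) ∂(P + D) = c * P.real A - D.real A := by
  rw [integral_sub (integrable_dens_left.const_mul c).integrableOn integrable_dens_right.integrableOn,
    setIntegral_dens_right hA, integral_const_mul, setIntegral_dens_left hA]

lemma exists_integral_excess (c : ℝ) : ∃ A, MeasurableSet A ∧
    ∫ x, excess P D c x ∂(P + D) = D.real A - c * P.real A := by
  have hm : Measurable fun x => dens D P x - c * dens P D x :=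
    (measurable_dens D P).sub ((measurable_dens P D).const_mul c)
  have hA := measurableSet_lt (measurable_const (a := (0 : ℝ))) hm
  exact ⟨_, hA, (setIntegral_eq_of_pos_part hm).trans (setIntegral_dens_sub hA c)⟩

lemma exists_integral_deficit (c : ℝ) : ∃ A, MeasurableSet A ∧
    ∫ x, deficit P D c x ∂(P + D) = c * P.real A - D.real A := by
  have hm : Measurable fun x => c * dens P D x - dens D P x :=
    ((measurable_dens P D).const_mul c).sub (measurable_dens D P)
  have hA := measurableSet_lt (measurable_const (a := (0 : ℝ))) hm
  exact ⟨_, hA, (setIntegral_eq_of_pos_part hm).trans (setIntegral_sub_dens hA c)⟩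

lemma le_integral_excess {A : Set Ω} (hA : MeasurableSet A) (c : ℝ) :
    D.real A - c * P.real A ≤ ∫ x, excess P D c x ∂(P + D) := by
  rw [← setIntegral_dens_sub hA]
  exact setIntegral_le_pos_part (integrable_dens_right.sub (integrable_dens_left.const_mul c)) A

lemma le_integral_deficit {A : Set Ω} (hA : MeasurableSet A) (c : ℝ) :
    c * P.real A - D.real A ≤ ∫ x, deficit P D c x ∂(P + D) := by
  rw [← setIntegral_sub_dens hA]
  exact setIntegral_le_pos_part ((integrable_dens_left.const_mul c).sub integrable_dens_right) A

/-- Uniform over sets, because it is applied to level sets of the likelihood ratio, which vary with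
`n`. -/
lemma IsQMD.exists_real_bound {Q : ℕ → Measure Ω} {h : Ω → ℝ} {ξ : ℕ → Ω → ℝ}
    (hQ : IsQMD P Q h ξ) :
    ∃ e : ℕ → ℝ, Tendsto e atTop (𝓝 0) ∧ ∀ᶠ n : ℕ in atTop, ∀ A : Set Ω, MeasurableSet A →
      |Real.sqrt n * ((Q n).real A - P.real A) - ∫ x in A, h x ∂P| ≤ e n := by
  obtain ⟨e, he, hb⟩ := hQ.exists_integral_bound
  refine ⟨e, he, ?_⟩
  filter_upwards [hb] with n hn A hA
  have := hn (A.indicator 1) (measurable_one.indicator hA) 1 zero_le_one fun x => by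
    by_cases hx : x ∈ A <;> simp [hx]
  rw [integral_indicator_one hA, integral_indicator_one hA, one_mul] at this
  have e2 : ∫ x, A.indicator 1 x * h x ∂P = ∫ x in A, h x ∂P := by
    rw [← integral_indicator hA]
    refine integral_congr_ae (ae_of_all _ fun x => ?_)
    by_cases hx : x ∈ A <;> simp [hx]
  rwa [e2] at this

/-- Intermediate values at distance `O(ε)` from one, where `ε = 1 / √n`. At `c = 1` excess and
deficit are about `ε τ E|Λ| / 2`, more than the required `ε (r₀ + r₁)`; at `1 + κ₁ ε` and `1 - κ₀ ε`
they are at most about half the required amount. -/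
lemma eventually_exists_isLeastFavorableProbPair {Λ : Ω → ℝ} {τ r₀ r₁ : ℝ} {D : ℕ → Measure Ω}
    {η : ℕ → Ω → ℝ} (hΛ : IsTangent P Λ) (hD : IsQMD P D (fun x => τ * Λ x) η) (hr₀ : 0 ≤ r₀)
    (hr₁ : 0 ≤ r₁) (hr : 0 < r₀ + r₁) (hsmall : 2 * (r₀ + r₁) < τ * ∫ x, |Λ x| ∂P) :
    ∀ᶠ n : ℕ in atTop, ∃ Q₀ Q₁ π, IsLeastFavorableProbPair (tvBall P (r₀ / Real.sqrt n))
      (tvBall (D n) (r₁ / Real.sqrt n)) Q₀ Q₁ π := by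
  set r := r₀ + r₁ with hrdef
  -- Clipping levels for half the radius: the spare half absorbs the error terms.
  obtain ⟨w', w'', hw, -⟩ := exists_clipData (τ := τ) hΛ (half_pos hr) (by linarith)
  have hτ := hw.tau_pos
  have hi := hw.integrable_score
  obtain ⟨hpos, hneg⟩ := integral_pos_part_of_tangent hΛ
  obtain ⟨e, he, hb⟩ := hD.exists_real_bound
  set κ₁ := τ * w'' with hκ₁
  set κ₀ := -(τ * w') with hκ₀
  have hκ₁p : 0 < κ₁ := mul_pos hτ hw.pos
  have hκ₀p : 0 < κ₀ := by rw [hκ₀]; nlinarith [hw.neg]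
  set L := τ * (∫ x, |Λ x| ∂P) / 2 with hL
  have hε0 : Tendsto (fun n : ℕ => 1 / Real.sqrt n) atTop (𝓝 0) :=
    tendsto_sqrt_natCast.const_div_atTop 1
  have ev1 : ∀ᶠ n in atTop, e n < L - r := he.eventually (gt_mem_nhds (by linarith))
  have ev2 : ∀ᶠ n in atTop, e n < r / 4 := he.eventually (gt_mem_nhds (by linarith))
  have ev3 : ∀ᶠ n : ℕ in atTop, κ₀ * r₀ * (1 / Real.sqrt n) < r / 4 := by
    have := hε0.const_mul (κ₀ * r₀)
    rw [mul_zero] at this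
    exact this.eventually (gt_mem_nhds (by linarith))
  have ev4 : ∀ᶠ n : ℕ in atTop, κ₀ * (1 / Real.sqrt n) < 1 := by
    have := hε0.const_mul κ₀
    rw [mul_zero] at this
    exact this.eventually (gt_mem_nhds one_pos)
  filter_upwards [hb, hD.prob, eventually_natCast_pos, ev1, ev2, ev3, ev4]
    with n hn hDn hnpos h1 h2 h3 h4
  have hs0 : 0 < Real.sqrt n := Real.sqrt_pos.2 hnpos
  set ε := 1 / Real.sqrt n with hε
  have hεp : 0 < ε := by positivity
  have hsε : Real.sqrt n * ε = 1 := by rw [hε, mul_one_div_cancel hs0.ne']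
  -- scaling of inequalities
  have scale : ∀ {a b : ℝ}, Real.sqrt n * a ≤ b → a ≤ ε * b := fun {a b} hab => by
    have := mul_le_mul_of_nonneg_left hab hεp.le
    calc a = ε * (Real.sqrt n * a) := by rw [← mul_assoc, mul_comm ε, hsε, one_mul]
      _ ≤ ε * b := this
  have scale' : ∀ {a b : ℝ}, b < Real.sqrt n * a → ε * b < a := fun {a b} hab => by
    have := mul_lt_mul_of_pos_left hab hεp
    calc ε * b < ε * (Real.sqrt n * a) := this
      _ = a := by rw [← mul_assoc, mul_comm ε, hsε, one_mul]
  have up1 : ε * r < ∫ x, excess P (D n) 1 x ∂(P + D n) := by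
    have hA : MeasurableSet {x | 0 < Λ x} := measurableSet_lt measurable_const hΛ.1
    refine lt_of_lt_of_le (scale' ?_) (le_integral_excess hA 1)
    have ha := (abs_le.1 (hn _ hA)).1
    have e1 : ∫ x in {x | 0 < Λ x}, τ * Λ x ∂P = L := by
      rw [integral_const_mul, ← setIntegral_eq_of_pos_part hΛ.1, hpos]; ring
    rw [e1] at ha
    rw [one_mul]
    linarith
  have low1 : ε * r < ∫ x, deficit P (D n) 1 x ∂(P + D n) := by
    have hA : MeasurableSet {x | 0 < -Λ x} := measurableSet_lt measurable_const hΛ.1.neg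
    refine lt_of_lt_of_le (scale' ?_) (le_integral_deficit hA 1)
    have ha := (abs_le.1 (hn _ hA)).2
    have e1 : ∫ x in {x | 0 < -Λ x}, τ * Λ x ∂P = -L := by
      have e2 : ∀ x, τ * Λ x = -τ * -Λ x := fun x => by ring
      simp_rw [e2]
      rw [integral_const_mul, ← setIntegral_eq_of_pos_part (f := fun x => -Λ x) hΛ.1.neg, hneg]; ring
    rw [e1] at ha
    rw [one_mul]
    linarith
  have setInt : ∀ (A : Set Ω) (k : ℝ), ∫ x in A, (τ * Λ x - k) ∂P =
      ∫ x in A, τ * Λ x ∂P - k * P.real A := fun A k => by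
    rw [integral_sub (hi.const_mul τ).integrableOn (integrable_const k), setIntegral_const,
      smul_eq_mul, mul_comm k]
  have up2 : ∫ x, excess P (D n) (1 + κ₁ * ε) x ∂(P + D n) ≤ ε * (r₁ + (1 + κ₁ * ε) * r₀) := by
    obtain ⟨A, hA, eA⟩ := exists_integral_excess (P := P) (D := D n) (1 + κ₁ * ε)
    rw [eA]
    refine scale ?_
    have ha := (abs_le.1 (hn A hA)).2
    have hb1 : ∫ x in A, (τ * Λ x - κ₁) ∂P ≤ r / 2 := by
      refine (setIntegral_le_pos_part ((hi.const_mul τ).sub (integrable_const κ₁)) A).trans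
        (le_of_eq ?_)
      rw [← hw.upper, ← integral_const_mul]
      refine integral_congr_ae (ae_of_all _ fun x => ?_)
      simp only [Pi.sub_apply]
      rw [hκ₁, ← mul_sub, mul_max_of_nonneg _ _ hτ.le, mul_zero]
    rw [setInt] at hb1
    have e1 : Real.sqrt n * ((D n).real A - (1 + κ₁ * ε) * P.real A) =
        Real.sqrt n * ((D n).real A - P.real A) - κ₁ * P.real A * (Real.sqrt n * ε) := by ring
    rw [e1, hsε]
    have : 0 ≤ κ₁ * ε * r₀ := by positivity
    linarith
  have low2 : ∫ x, deficit P (D n) (1 - κ₀ * ε) x ∂(P + D n) ≤ ε * (r₁ + (1 - κ₀ * ε) * r₀) := by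
    obtain ⟨A, hA, eA⟩ := exists_integral_deficit (P := P) (D := D n) (1 - κ₀ * ε)
    rw [eA]
    refine scale ?_
    have ha := (abs_le.1 (hn A hA)).1
    have hb1 : ∫ x in A, -(τ * Λ x - -κ₀) ∂P ≤ r / 2 := by
      refine (setIntegral_le_pos_part ((hi.const_mul τ).sub (integrable_const (-κ₀))).neg A).trans
        (le_of_eq ?_)
      rw [← hw.lower, ← integral_const_mul]
      refine integral_congr_ae (ae_of_all _ fun x => ?_)
      simp only [Pi.sub_apply, Pi.neg_apply]
      rw [hκ₀, neg_neg, neg_sub, ← mul_sub, mul_max_of_nonneg _ _ hτ.le, mul_zero]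
    rw [integral_neg, setInt] at hb1
    have e1 : Real.sqrt n * ((1 - κ₀ * ε) * P.real A - (D n).real A) =
        -(Real.sqrt n * ((D n).real A - P.real A)) - κ₀ * P.real A * (Real.sqrt n * ε) := by ring
    rw [e1, hsε]
    have e2 : (1 - κ₀ * ε) * r₀ = r₀ - κ₀ * r₀ * ε := by ring
    rw [e2]
    linarith
  have lin : ∀ a b : ℝ, ContinuousOn (fun c : ℝ => ε * (r₁ + c * r₀)) (Set.Icc a b) :=
    fun a b => by fun_prop
  obtain ⟨c₁, hc₁, e1⟩ := intermediate_value_Icc' (by linarith [mul_pos hκ₁p hεp] : 1 ≤ 1 + κ₁ * ε)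
    ((continuousOn_excess (P := P) (D := D n) 1 (1 + κ₁ * ε)).sub (lin _ _))
    (Set.mem_Icc.2 ⟨sub_nonpos.2 up2, sub_nonneg.2 (by
      dsimp only; rw [one_mul, add_comm r₁]; exact up1.le)⟩)
  obtain ⟨c₀, hc₀, e0⟩ := intermediate_value_Icc (by linarith [mul_pos hκ₀p hεp] : 1 - κ₀ * ε ≤ 1)
    ((continuousOn_deficit (P := P) (D := D n) (1 - κ₀ * ε) 1).sub (lin _ _))
    (Set.mem_Icc.2 ⟨sub_nonpos.2 low2, sub_nonneg.2 (by
      dsimp only; rw [one_mul, add_comm r₁]; exact low1.le)⟩)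
  -- The strict inequality at `1` separates the constants: `c₀ ≤ 1 < c₁`.
  have hne : c₁ ≠ 1 := fun h => by
    rw [h, Pi.sub_apply] at e1
    replace e1 : _ - ε * (r₁ + 1 * r₀) = 0 := e1
    rw [one_mul, add_comm r₁] at e1
    exact up1.ne' (sub_eq_zero.1 e1)
  have hlt : c₀ < c₁ := lt_of_le_of_lt hc₀.2 (lt_of_le_of_ne hc₁.1 hne.symm)
  have := exists_isLeastFavorableProbPair (P := P) (D := D n) hr₀ hr₁ hr
    (by linarith [hc₀.1] : 0 < c₀) hlt (sub_eq_zero.1 e1) (sub_eq_zero.1 e0)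
  rwa [hε, mul_one_div, mul_one_div] at this

end HuberPair

/-! ### Tests based on least favorable probability pairs -/

section HuberStrassen

/-- If the critical value is not attained, `γ` is arbitrary. Clamping it to `[0, 1]` leaves the test
unchanged and makes the rejection function monotone. -/
lemma exists_eq_randomized {n : ℕ} {π : Ω → ℝ≥0} {d : (Fin n → Ω) → ℝ} (hd : IsTest d) {c : ℝ≥0}
    {γ : ℝ} (h : ∀ x : Fin n → Ω,
      (c < ∏ i, π (x i) → d x = 1) ∧ (∏ i, π (x i) = c → d x = γ) ∧
      (∏ i, π (x i) < c → d x = 0)) :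
    ∃ γ', 0 ≤ γ' ∧ γ' ≤ 1 ∧ ∀ x, d x = randomized c γ' (∏ i, π (x i)) := by
  refine ⟨max 0 (min γ 1), le_max_left _ _, max_le zero_le_one (min_le_right _ _), fun x => ?_⟩
  obtain ⟨h1, h2, h3⟩ := h x
  unfold randomized
  rcases lt_trichotomy c (∏ i, π (x i)) with hlt | heq | hgt
  · rw [if_pos hlt, h1 hlt]
  · have hx := hd.2 x
    rw [h2 heq.symm] at hx
    rw [if_neg (by rw [heq]; exact lt_irrefl _), if_pos heq.symm, h2 heq.symm, min_eq_left hx.2,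
      max_eq_right hx.1]
  · rw [if_neg (not_lt.2 hgt.le), if_neg hgt.ne, h3 hgt]

lemma randomized_spec {c t : ℝ≥0} {γ : ℝ} : (c < t → randomized c γ t = 1) ∧
    (t = c → randomized c γ t = γ) ∧ (t < c → randomized c γ t = 0) := by
  unfold randomized
  refine ⟨fun h => if_pos h, fun h => ?_, fun h => ?_⟩
  · rw [if_neg (by rw [h]; exact lt_irrefl _), if_pos h]
  · rw [if_neg (not_lt.2 h.le), if_neg h.ne]

lemma isTest_randomized {π : Ω → ℝ≥0} (hπ : Measurable π) {c : ℝ≥0} {γ : ℝ} (h0 : 0 ≤ γ)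
    (h1 : γ ≤ 1) (n : ℕ) : IsTest fun x : Fin n → Ω => randomized c γ (∏ i, π (x i)) :=
  ⟨(monotone_randomized h0 h1).measurable.comp (measurable_prod_comp hπ n),
    fun _ => randomized_mem h0 h1 _⟩

namespace IsLeastFavorableProbPair

variable {P D Q₀ Q₁ : Measure Ω} {ρ₀ ρ₁ : ℝ} {π : Ω → ℝ≥0}

lemma integral_le_left (h : IsLeastFavorableProbPair (tvBall P ρ₀) (tvBall D ρ₁) Q₀ Q₁ π)
    {c : ℝ≥0} {γ : ℝ} (h0 : 0 ≤ γ) (h1 : γ ≤ 1) {n : ℕ} {Q : Measure Ω} (hQ : Q ∈ tvBall P ρ₀) :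
    ∫ x, randomized c γ (∏ i, π (x i)) ∂(iid Q n) ≤
      ∫ x, randomized c γ (∏ i, π (x i)) ∂(iid Q₀ n) := by
  have := hQ.1
  have := h.1.1
  exact integral_monotone_prod_le h.2.2.1 (fun t ht => (h.2.2.2.2 t ht).1 Q hQ)
    (monotone_randomized h0 h1) (fun t => (randomized_mem h0 h1 t).1)
    (fun t => (randomized_mem h0 h1 t).2) n

lemma le_integral_right (h : IsLeastFavorableProbPair (tvBall P ρ₀) (tvBall D ρ₁) Q₀ Q₁ π)
    {c : ℝ≥0} {γ : ℝ} (h0 : 0 ≤ γ) (h1 : γ ≤ 1) {n : ℕ} {Q : Measure Ω} (hQ : Q ∈ tvBall D ρ₁) :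
    ∫ x, randomized c γ (∏ i, π (x i)) ∂(iid Q₁ n) ≤
      ∫ x, randomized c γ (∏ i, π (x i)) ∂(iid Q n) := by
  have := hQ.1
  have := h.2.1.1
  exact integral_monotone_prod_le h.2.2.1 (fun t ht => (h.2.2.2.2 t ht).2 Q hQ)
    (monotone_randomized h0 h1) (fun t => (randomized_mem h0 h1 t).1)
    (fun t => (randomized_mem h0 h1 t).2) n

/-- The Neyman-Pearson lemma for the least favorable pair. -/
lemma neymanPearson (h : IsLeastFavorableProbPair (tvBall P ρ₀) (tvBall D ρ₁) Q₀ Q₁ π)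
    {c : ℝ≥0} {γ : ℝ} (h0 : 0 ≤ γ) (h1 : γ ≤ 1) {n : ℕ} {φ : (Fin n → Ω) → ℝ} (hφ : IsTest φ) :
    c * (∫ x, randomized c γ (∏ i, π (x i)) ∂(iid Q₀ n) - ∫ x, φ x ∂(iid Q₀ n)) ≤
      ∫ x, randomized c γ (∏ i, π (x i)) ∂(iid Q₁ n) - ∫ x, φ x ∂(iid Q₁ n) := by
  obtain ⟨hQ₀, hQ₁, hπ, hQ, -⟩ := h
  have := hQ₀.1
  have i1 := hQ₁.1
  have := iid_isProbabilityMeasure Q₀ n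
  have := iid_isProbabilityMeasure Q₁ n
  have hT := measurable_prod_comp hπ n
  have hiid : iid Q₁ n = (iid Q₀ n).withDensity fun x => ((∏ i, π (x i) : ℝ≥0) : ℝ≥0∞) := by
    rw [hQ] at i1 ⊢
    rw [iid_withDensity Q₀ hπ.coe_nnreal_ennreal n]
    simp only [ENNReal.ofNNReal_finsetProd]
  have key : ∀ ψ : (Fin n → Ω) → ℝ, IsTest ψ →
      Integrable (fun x => ((∏ i, π (x i) : ℝ≥0) : ℝ) * ψ x) (iid Q₀ n) ∧
      ∫ x, ψ x ∂(iid Q₁ n) = ∫ x, ((∏ i, π (x i) : ℝ≥0) : ℝ) * ψ x ∂(iid Q₀ n) := fun ψ hψ => by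
    have hi := hψ.integrable (iid Q₁ n)
    rw [hiid] at hi ⊢
    exact ⟨(integrable_withDensity_iff_integrable_smul hT).1 hi,
      integral_withDensity_eq_integral_smul hT ψ⟩
  have hδ := isTest_randomized (c := c) hπ h0 h1 n
  obtain ⟨iδ, eδ⟩ := key _ hδ
  obtain ⟨iφ, eφ⟩ := key φ hφ
  have jδ := hδ.integrable (iid Q₀ n)
  have jφ := hφ.integrable (iid Q₀ n)
  rw [eδ, eφ, ← sub_nonneg, ← integral_sub iδ iφ, ← integral_sub jδ jφ, ← integral_const_mul,
    ← integral_sub (integrable_fun_sub iδ iφ) ((integrable_fun_sub jδ jφ).const_mul _)]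
  refine integral_nonneg fun x => ?_
  have hx := hφ.2 x
  obtain ⟨s1, s2, s3⟩ := randomized_spec (c := c) (t := ∏ i, π (x i)) (γ := γ)
  show (0 : ℝ) ≤ _ - _
  rcases lt_trichotomy c (∏ i, π (x i)) with hlt | heq | hgt
  · rw [s1 hlt]
    have : (c : ℝ) < ((∏ i, π (x i) : ℝ≥0) : ℝ) := hlt
    nlinarith
  · rw [← heq]; linarith
  · rw [s3 hgt]
    have : ((∏ i, π (x i) : ℝ≥0) : ℝ) < (c : ℝ) := hgt
    nlinarith

end IsLeastFavorableProbPair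

namespace ClipData

variable {P : Measure Ω} [IsProbabilityMeasure P] {Λ : Ω → ℝ} {τ r₀ r₁ v' v'' u : ℝ}
  {D : ℕ → Measure Ω} {η : ℕ → Ω → ℝ}

/-- By uniqueness of optimal tests it suffices to bound size at `B` and power at `C`. The power at
`C n` is at least that at `Q₁`, by stochastic order. There it is compared with the clipped test,
which is controlled on all members of the balls, hence also at `Q₀` and `Q₁`, although the latter
are not known to have tangents. -/
theorem asyEquiv_of_isHuberStrassenTest (h : ClipData P Λ τ (r₀ + r₁) v' v'') (hD : IsQMD P D (fun x => τ * Λ x) η) (hr₀ : 0 ≤ r₀)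
    (hr₁ : 0 ≤ r₁) {δ : (n : ℕ) → (Fin n → Ω) → ℝ}
    (hδ : IsHuberStrassenTest P D r₀ r₁ (Phi (-u)) δ) :
    AsyEquiv P δ (optTest P Λ τ r₀ v' v'' u) := by
  obtain ⟨hδt, hpair, hlim⟩ := hδ
  obtain ⟨B, C, ξ, ζ, hB, hC, hBm, hCm⟩ := h.exists_least_favorable_sequences hD hr₀ hr₁
  have hq0 := isTangent_of_mem_nullTangents h.null_mem
  rw [optTest, h.crit_eq]
  refine asyEquiv_of_power hB hC hq0 h.measurable_diff h.abs_diff_le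
    h.integral_diff h.nrm_diff_pos (ae_of_all _ h.diff_eq) hδt (fun ε hε => ?_) fun ε hε => ?_
  · filter_upwards [hBm, hlim.eventually (gt_mem_nhds (lt_add_of_pos_right _ hε))] with n h1 h2
    exact (integral_le_maxSize hδt h1).trans h2.le
  · rw [h.nrm_diff]
    set s := nrm P (clip Λ v' v'') with hs
    obtain ⟨κ, hκ, -, hκε⟩ := exists_Phi_le (y := -u + τ * s) (half_pos hε) 1
    rw [div_one] at hκε
    -- The competitor has the slightly smaller level `Φ(-(u + κ))`, so eventually its size at `Q₀`
    -- is below that of `δ`. The left side of the Neyman-Pearson inequality is then nonnegative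
    -- whatever the critical value `c ≥ 0`, which needs no control.
    have hlt : Phi (-(u + κ)) < Phi (-u) := Phi_strictMono (by linarith)
    set g := (Phi (-u) - Phi (-(u + κ))) / 2 with hg
    have hg0 : 0 < g := by linarith
    filter_upwards [hpair, hCm, hlim.eventually (lt_mem_nhds (sub_lt_self _ hg0)),
      h.eventually_size_ball_le (u := u + κ) hr₀ hg0,
      h.eventually_le_power_ball (u := u + κ) hD hr₁ (half_pos hε)] with
      n ⟨Q₀, Q₁, π, c, γ, hQ, hform⟩ h1 h2 h3 h4
    obtain ⟨γ', hγ0, hγ1, hform'⟩ := exists_eq_randomized (hδt n) hform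
    have a1 : maxSize P r₀ δ n ≤ ∫ x, δ n x ∂(iid Q₀ n) := maxSize_le hr₀ fun Q hQ' => by
      simp only [hform']
      exact hQ.integral_le_left hγ0 hγ1 hQ'
    have a2 := hQ.le_integral_right (c := c) hγ0 hγ1 (n := n) h1
    have a3 := hQ.neymanPearson (c := c) hγ0 hγ1
      ((h.isTestSeq_optTest (u := u + κ)) n)
    simp only [← hform'] at a2 a3
    have a4 := h3 Q₀ hQ.1
    have a5 := h4 Q₁ hQ.2.1
    have a6 : 0 ≤ (c : ℝ) * (∫ x, δ n x ∂(iid Q₀ n) -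
        ∫ x, optTest P Λ τ r₀ v' v'' (u + κ) n x ∂(iid Q₀ n)) :=
      mul_nonneg c.2 (by linarith)
    have e : -(u + κ) + τ * s = -u + τ * s - κ := by ring
    rw [e] at a5
    linarith

lemma pairTest_eq (h : ClipData P Λ τ (r₀ + r₁) v' v'') : pairTest P u (fun x => r₀ * extremeTangent Λ τ (r₀ + r₁) v' v'' x)
    (fun x => τ * Λ x - r₁ * extremeTangent Λ τ (r₀ + r₁) v' v'' x) =
      optTest P Λ τ r₀ v' v'' u := by
  have e : ∀ x, τ * Λ x - r₁ * extremeTangent Λ τ (r₀ + r₁) v' v'' x -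
      r₀ * extremeTangent Λ τ (r₀ + r₁) v' v'' x = τ * clip Λ v' v'' x := fun x => by
    rw [h.diff_eq]; ring
  funext n x
  rw [optTest, h.crit_eq]
  simp only [pairTest, sumTest, normSum, e]

open Classical in
lemma optTest_apply (h : ClipData P Λ τ (r₀ + r₁) v' v'') (n : ℕ) (x : Fin n → Ω) : optTest P Λ τ r₀ v' v'' u n x =
    if nrm P (clip Λ v' v'') * u + r₀ * (v'' - v') <
      1 / Real.sqrt n * ∑ i, clip Λ v' v'' (x i) then 1 else 0 := by
  rw [optTest, sumTest, normSum_const_mul, crit]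
  simp only [mul_lt_mul_iff_right₀ h.tau_pos, normSum]

end ClipData

/-- Randomization gives size exactly `α` at `Q₀`, and stochastic order makes `Q₀` the maximizer over
the ball. At the finitely many sample sizes where no pair is available the zero test may be used. -/
theorem exists_isHuberStrassenTest {P : Measure Ω} [IsProbabilityMeasure P] {Λ : Ω → ℝ}
    {τ r₀ r₁ α : ℝ} {D : ℕ → Measure Ω}
    {η : ℕ → Ω → ℝ} (hΛ : IsTangent P Λ) (hD : IsQMD P D (fun x => τ * Λ x) η) (hr₀ : 0 ≤ r₀)
    (hr₁ : 0 ≤ r₁) (hr : 0 < r₀ + r₁) (hsmall : 2 * (r₀ + r₁) < τ * ∫ x, |Λ x| ∂P)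
    (h0 : 0 < α) (h1 : α < 1) : ∃ δ, IsHuberStrassenTest P D r₀ r₁ α δ := by
  classical
  let good : (n : ℕ) → ((Fin n → Ω) → ℝ) → Prop := fun n d =>
    ∃ (Q₀ Q₁ : Measure Ω) (π : Ω → ℝ≥0) (c : ℝ≥0) (γ : ℝ), 0 ≤ γ ∧ γ ≤ 1 ∧
      IsLeastFavorableProbPair (tvBall P (r₀ / Real.sqrt n)) (tvBall (D n) (r₁ / Real.sqrt n))
        Q₀ Q₁ π ∧ (∀ x, d x = randomized c γ (∏ i, π (x i))) ∧ ∫ x, d x ∂(iid Q₀ n) = α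
  have hex : ∀ᶠ n in atTop, ∃ d, good n d := by
    filter_upwards [eventually_exists_isLeastFavorableProbPair hΛ hD hr₀ hr₁ hr hsmall] with
      n ⟨Q₀, Q₁, π, hQ⟩
    have := hQ.1.1
    have := iid_isProbabilityMeasure Q₀ n
    have hT := measurable_prod_comp hQ.2.2.1 n
    have := Measure.isProbabilityMeasure_map (μ := iid Q₀ n) hT.aemeasurable
    obtain ⟨c, γ, hγ0, hγ1, he⟩ :=
      exists_randomized_quantile ((iid Q₀ n).map fun x => ∏ i, π (x i)) h0 h1
    refine ⟨_, Q₀, Q₁, π, c, γ, hγ0, hγ1, hQ, fun x => rfl, ?_⟩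
    rw [← he, integral_map hT.aemeasurable
      (monotone_randomized hγ0 hγ1).measurable.aestronglyMeasurable]
  have hch : ∀ n, ∃ d : (Fin n → Ω) → ℝ, IsTest d ∧ ((∃ d, good n d) → good n d) := fun n => by
    by_cases hn : ∃ d, good n d
    · obtain ⟨d, hd⟩ := hn
      refine ⟨d, ?_, fun _ => hd⟩
      obtain ⟨Q₀, Q₁, π, c, γ, hγ0, hγ1, hQ, hform, -⟩ := hd
      rw [funext hform]
      exact isTest_randomized hQ.2.2.1 hγ0 hγ1 n
    · exact ⟨fun _ => 0, ⟨measurable_const, fun _ => ⟨le_rfl, zero_le_one⟩⟩, fun hg => absurd hg hn⟩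
  choose δ hδ hgood using hch
  refine ⟨δ, hδ, ?_, ?_⟩
  · filter_upwards [hex] with n hn
    obtain ⟨Q₀, Q₁, π, c, γ, hγ0, hγ1, hQ, hform, -⟩ := hgood n hn
    refine ⟨Q₀, Q₁, π, c, γ, hQ, fun x => ?_⟩
    rw [hform]
    exact randomized_spec
  · refine tendsto_const_nhds.congr' ?_
    filter_upwards [hex] with n hn
    obtain ⟨Q₀, Q₁, π, c, γ, hγ0, hγ1, hQ, hform, he⟩ := hgood n hn
    refine le_antisymm ?_ ?_
    · rw [← he]
      exact integral_le_maxSize hδ hQ.1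
    · refine maxSize_le hr₀ fun Q hQ' => ?_
      rw [← he]
      simp only [hform]
      exact hQ.integral_le_left hγ0 hγ1 hQ'

end HuberStrassen

end RobustTest

end

/-! ### The theorem -/

open Classical in
theorem mainTheorem2 {Ω : Type*} [MeasurableSpace Ω]
    (Θ : Set ℝ) (hΘ : IsOpen Θ) (θ₀ : ℝ) (hθ₀ : θ₀ ∈ Θ)
    (P : ℝ → Measure Ω) (hP : ∀ θ ∈ Θ, IsProbabilityMeasure (P θ))
    (Λ : Ω → ℝ) (hΛ : RobustTest.HasScoresAt P θ₀ Λ)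
    (A : (Ω → ℝ) → ℕ → Measure Ω) (hA : RobustTest.IsLocalAlternatives (P θ₀) A)
    (τ r₀ r₁ : ℝ) (hr₀ : 0 ≤ r₀) (hr₁ : 0 ≤ r₁) (hr : 0 < r₀ + r₁)
    (hsmall : 2 * (r₀ + r₁) < τ * ∫ x, |Λ x| ∂(P θ₀))
    (α u : ℝ) (hα₀ : 0 < α) (hα₁ : α < 1) (hu : RobustTest.Phi (-u) = α) :
    ∃ v' v'' : ℝ, v' < 0 ∧ 0 < v'' ∧
      -- the clipping constants are determined by the two equations
      (∀ w' w'' : ℝ,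
        (τ * ∫ x, max (w' - Λ x) 0 ∂(P θ₀) = r₀ + r₁ ∧
          τ * ∫ x, max (Λ x - w'') 0 ∂(P θ₀) = r₀ + r₁) ↔ w' = v' ∧ w'' = v'') ∧
      ∃ gt q₀ q₁ : Ω → ℝ,
        (∀ x, (r₀ + r₁) * gt x = τ * max (Λ x - v'') 0 - τ * max (v' - Λ x) 0) ∧
        (∀ x, q₀ x = r₀ * gt x) ∧
        (∀ x, q₁ x = τ * Λ x - r₁ * gt x) ∧
        gt ∈ RobustTest.tangentBall (P θ₀) ∧
        -- the pair is least favorable; its test provides the saddle point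
        RobustTest.IsLeastFavorable A α (RobustTest.nullTangents (P θ₀) r₀)
          (RobustTest.altTangents (P θ₀) Λ τ r₁) q₀ q₁ ∧
        RobustTest.IsSaddlePoint A α (RobustTest.nullTangents (P θ₀) r₀)
          (RobustTest.altTangents (P θ₀) Λ τ r₁) q₀ q₁
          (RobustTest.pairTest (P θ₀) u q₀ q₁) ∧
        -- characterization of all least favorable tangent pairs
        (∀ g₀ ∈ RobustTest.tangentBall (P θ₀), ∀ g₁ ∈ RobustTest.tangentBall (P θ₀),
          RobustTest.IsLeastFavorable A α (RobustTest.nullTangents (P θ₀) r₀)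
              (RobustTest.altTangents (P θ₀) Λ τ r₁)
              (fun x => r₀ * g₀ x) (fun x => τ * Λ x - r₁ * g₁ x) ↔
            ((∀ᵐ x ∂(P θ₀), r₀ * max (g₀ x) 0 + r₁ * max (g₁ x) 0 = τ * max (Λ x - v'') 0) ∧
              ∀ᵐ x ∂(P θ₀),
                r₀ * max (-g₀ x) 0 + r₁ * max (-g₁ x) 0 = τ * max (v' - Λ x) 0)) ∧
        -- explicit form of the test
        (∀ (n : ℕ) (x : Fin n → Ω),
          RobustTest.pairTest (P θ₀) u q₀ q₁ n x =
            if RobustTest.nrm (P θ₀) (RobustTest.clip Λ v' v'') * u + r₀ * (v'' - v') <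
                1 / Real.sqrt n * ∑ i, RobustTest.clip Λ v' v'' (x i) then 1 else 0) ∧
        -- it is the maxmin test, with the stated maxmin asymptotic power
        RobustTest.IsMaxminTest A α (RobustTest.nullTangents (P θ₀) r₀)
          (RobustTest.altTangents (P θ₀) Λ τ r₁) (RobustTest.pairTest (P θ₀) u q₀ q₁) ∧
        (∀ δ, RobustTest.IsMaxminTest A α (RobustTest.nullTangents (P θ₀) r₀)
            (RobustTest.altTangents (P θ₀) Λ τ r₁) δ →
          RobustTest.AsyEquiv (P θ₀) δ (RobustTest.pairTest (P θ₀) u q₀ q₁)) ∧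
        RobustTest.minAsyPower A (RobustTest.altTangents (P θ₀) Λ τ r₁)
            (RobustTest.pairTest (P θ₀) u q₀ q₁) =
          RobustTest.Phi (-u + τ * RobustTest.nrm (P θ₀) (RobustTest.clip Λ v' v'')) ∧
        -- coincidence with the test based on least favorable probability pairs
        (∃ δ, RobustTest.IsHuberStrassenTest (P θ₀)
          (fun n => P (θ₀ + τ / Real.sqrt n)) r₀ r₁ α δ) ∧
        (∀ δ, RobustTest.IsHuberStrassenTest (P θ₀)
            (fun n => P (θ₀ + τ / Real.sqrt n)) r₀ r₁ α δ →
          RobustTest.AsyEquiv (P θ₀) δ (RobustTest.pairTest (P θ₀) u q₀ q₁)) ∧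
        RobustTest.IsRobustMaxminTest (P θ₀)
          (fun n => P (θ₀ + τ / Real.sqrt n)) r₀ r₁ α (RobustTest.pairTest (P θ₀) u q₀ q₁) := by
  have := hP θ₀ hθ₀
  subst hu
  obtain ⟨v', v'', h, huniq⟩ := RobustTest.exists_clipData hΛ.1 hr hsmall
  have hD := RobustTest.isQMD_of_hasScoresAt hΘ hθ₀ hP hΛ h.tau_pos
  have hpair := h.pairTest_eq (u := u)
  have hsaddle := h.isSaddlePoint_of_diff (u := u) hA hr₀ hr₁ h.null_mem
    (RobustTest.ClipData.alt_mem_of_ball h.extremeTangent_mem) (ae_of_all _ h.diff_eq)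
  refine ⟨v', v'', h.neg, h.pos, huniq,
    RobustTest.extremeTangent Λ τ (r₀ + r₁) v' v'',
    fun x => r₀ * RobustTest.extremeTangent Λ τ (r₀ + r₁) v' v'' x,
    fun x => τ * Λ x - r₁ * RobustTest.extremeTangent Λ τ (r₀ + r₁) v' v'' x,
    h.mul_extremeTangent, fun _ => rfl, fun _ => rfl, h.extremeTangent_mem, ⟨_, hsaddle⟩, ?_⟩
  rw [hpair]
  exact ⟨hsaddle, fun g₀ hg₀ g₁ hg₁ => h.isLeastFavorable_iff hA hr₀ hr₁ hg₀ hg₁,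
    h.optTest_apply, h.isMaxminTest_optTest hA hr₀ hr₁,
    fun δ hδ => h.asyEquiv_of_isMaxminTest hA hr₀ hr₁ hδ, h.minAsyPower_optTest hA hr₀ hr₁,
    RobustTest.exists_isHuberStrassenTest hΛ.1 hD hr₀ hr₁ hr hsmall hα₀ hα₁,
    fun δ hδ => h.asyEquiv_of_isHuberStrassenTest hD hr₀ hr₁ hδ,
    h.isRobustMaxminTest_optTest hD hr₀ hr₁⟩
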